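/- **Setting.** For a compactly supported $U\in L^\infty(\mathbb R;\mathbb C)$, let $R_U(\lambda)=(-\frac{d^2}{dx^2}+U-\lambda^2)^{-1}$, which is a bounded operator on $L^2(\mathbb R)$ for $\operatorname{Im}\lambda\gg 1$. It continues meromorphically to $\lambda\in\mathbb C$ as a family of operators from $L^2_c(\mathbb R)$ to $L^2_{\mathrm{loc}}(\mathbb R)$. The *resonances* of $-\frac{d^2}{dx^2}+U$ are the poles of this continuation; a resonance $\lambda_0\neq 0$ has as its multiplicity the rank of the residue of $R_U$ at $\lambda_0$. For integers $j,k\ge 0$, real $a<b$ and constants $C_1,C_2\in\mathbb C\setminus\{0\}$, we say that $V:\mathbb R\to\mathbb C$ belongs to $\mathcal V_{j,k}([a,b])$ with constants $C_1,C_2$ if the convex hull of $\operatorname{supp}V$ is $[a,b]$, if $V\in C^N([a,b];\mathbb C)$ for some integer $N>\max(j,k)$, and if $V(x)\sim C_1(x-a)^j$ as $x\to a^+$ and $V(x)\sim C_2(b-x)^k$ as $x\to b^-$. For $M>0$ put $$\hat L_M=\{\lambda\in\mathbb C:\ \operatorname{Im}\lambda>-M\log(1+|\lambda|)\}.$$ **Theorem.**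 Let $V\in\mathcal V_{j,k}([a,b])$ with constants $C_1,C_2$, let $W\in C_c^\infty(\mathbb R;\mathbb C)$, and let $M>\frac{j+k+4}{2(b-a)}$. Then there are $R>0$, integers $N_+,N_-\ge 0$ and complex numbers $\lambda_n$ $(n>N_+)$ and $\lambda_{-n}$ $(n>N_-)$, pairwise distinct, such that the resonances of $-\frac{d^2}{dx^2}+V+W$ in $\hat L_M\cap\{|\lambda|>R\}$ are exactly the numbers $\lambda_n$ $(n>N_+)$ and $\lambda_{-n}$ $(n>N_-)$, each of multiplicity one, and $$\lambda_{\pm n}=\pm\frac{n\pi}{b-a}\pm\frac{j+k+4}{2(b-a)}\,\frac{\pi}{2}+i\,\frac{\log C}{2(b-a)}-i\,\frac{j+k+4}{2(b-a)}\log\Big(\frac{n\pi}{b-a}\Big)+\varepsilon_{\pm n},$$ where $C=\dfrac{j!\,k!\,C_1C_2}{2^{\,j+k+4}}$, $\log C$ is the principal value, and $\varepsilon_{\pm n}\to 0$ as $n\to\infty$. -/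

import Mathlib

open MeasureTheory Filter Topology Asymptotics
open scoped ContDiff

noncomputable section

namespace ResonanceSequence

/-- The Hilbert space `L²(ℝ; ℂ)`. -/
abbrev L2 : Type := Lp ℂ 2 (volume : Measure ℝ)

/-- `u` solves `-u'' + V u - z² u = f` on `ℝ` in the sense of distributions, where `u, f ∈ L²(ℝ)`.
For bounded `V` this forces `u ∈ H²(ℝ)`, the domain of `-d²/dx² + V`. -/
def IsWeakSolution (V : ℝ → ℂ) (z : ℂ) (f u : L2) : Prop :=
  ∀ φ : ℝ → ℂ, ContDiff ℝ ∞ φ → HasCompactSupport φ →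
    ∫ x, u x * (-(deriv (deriv φ) x) + V x * φ x - z ^ 2 * φ x) = ∫ x, f x * φ x

/-- The bounded operator `T` on `L²(ℝ)` is the inverse `(-d²/dx² + V - z²)⁻¹`: for every
`f ∈ L²(ℝ)`, `T f` is the one and only solution `u ∈ L²(ℝ)` of `-u'' + V u - z² u = f`. -/
def IsResolventAt (V : ℝ → ℂ) (z : ℂ) (T : L2 →L[ℂ] L2) : Prop :=
  ∀ f u : L2, IsWeakSolution V z f u ↔ u = T f

/-- Multiplication by the indicator function of `[-ρ, ρ]`, as an operator on `L²(ℝ)`. -/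
def cutoff (ρ : ℝ) : L2 →L[ℂ] L2 :=
  LinearMap.mkContinuous
    { toFun := fun f => ((Lp.memLp f).indicator (measurableSet_Icc (a := -ρ) (b := ρ))).toLp _
      map_add' := by
        intro f g
        rw [← MemLp.toLp_add]
        refine MemLp.toLp_congr _ _ ?_
        filter_upwards [Lp.coeFn_add f g] with x hx
        by_cases h : x ∈ Set.Icc (-ρ) ρ
        · simp only [Set.indicator_of_mem h, Pi.add_apply]
          exact hx
        · simp only [Set.indicator_of_notMem h, Pi.add_apply, add_zero]
      map_smul' := by
        intro c f
        rw [RingHom.id_apply, ← MemLp.toLp_const_smul]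
        refine MemLp.toLp_congr _ _ ?_
        filter_upwards [Lp.coeFn_smul c f] with x hx
        by_cases h : x ∈ Set.Icc (-ρ) ρ
        · simp only [Set.indicator_of_mem h, Pi.smul_apply]
          exact hx
        · simp only [Set.indicator_of_notMem h, Pi.smul_apply, smul_zero] }
    1 (by
      intro f
      rw [one_mul]
      simp only [LinearMap.coe_mk, AddHom.coe_mk]
      rw [Lp.norm_toLp, Lp.norm_def]
      exact ENNReal.toReal_mono (Lp.eLpNorm_ne_top f) (eLpNorm_indicator_le _))

/-- `F` is the meromorphic continuation of the resolvent `R_V(z) = (-d²/dx² + V - z²)⁻¹`, defined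
for `Im z ≫ 1`, to all of `ℂ` as a family of operators from `L²_c(ℝ)` to `L²_loc(ℝ)`: for each
`ρ`, the function `z ↦ F ρ z` is meromorphic on `ℂ` with values in the bounded operators on
`L²(ℝ)`, and it agrees with `χ R_V(z) χ`, `χ = 1_{[-ρ, ρ]}`, for `Im z ≫ 1`. -/
def IsContinuedResolvent (V : ℝ → ℂ) (F : ℝ → ℂ → (L2 →L[ℂ] L2)) : Prop :=
  (∀ ρ : ℝ, MeromorphicOn (F ρ) Set.univ) ∧
  ∃ A : ℝ, ∀ z : ℂ, A < z.im →
    ∃ T : L2 →L[ℂ] L2, IsResolventAt V z T ∧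
      ∀ ρ : ℝ, F ρ z = (cutoff ρ).comp (T.comp (cutoff ρ))

open Classical in
/-- The meromorphic continuation of the cut-off resolvents `z ↦ χ R_V(z) χ`, `χ = 1_{[-ρ, ρ]}`.
It is unique up to the values at isolated points, which affect neither poles nor residues.
(If there were no continuation it would be `0`, which has no poles.) -/
def continuedResolvent (V : ℝ → ℂ) : ℝ → ℂ → (L2 →L[ℂ] L2) :=
  if h : ∃ F, IsContinuedResolvent V F then h.choose else 0

/-- The resonances of `-d²/dx² + V`: the poles of the meromorphic continuation of `R_V`. -/
def IsResonance (V : ℝ → ℂ) (z : ℂ) : Prop :=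
  ∃ ρ : ℝ, meromorphicOrderAt (continuedResolvent V ρ) z < 0

/-- The residue at `z₀` of an operator-valued function that is meromorphic at `z₀` (the circle
integral is then constant for small radii). -/
def residue (G : ℂ → (L2 →L[ℂ] L2)) (z₀ : ℂ) : L2 →L[ℂ] L2 :=
  limUnder (𝓝[>] (0 : ℝ)) fun r => (2 * Real.pi * Complex.I : ℂ)⁻¹ • ∮ z in C(z₀, r), G z

/-- The multiplicity of a resonance `z₀ ≠ 0`: the rank of the residue at `z₀` of the continued
resolvent `L²_c(ℝ) → L²_loc(ℝ)`, that is, the supremum of the ranks of its cut-offs. -/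
def resonanceMultiplicity (V : ℝ → ℂ) (z₀ : ℂ) : ℕ∞ :=
  ⨆ ρ : ℝ, Cardinal.toENat (LinearMap.rank (residue (continuedResolvent V ρ) z₀).toLinearMap)

/-- `V` belongs to the class `𝒱_{j,k}([a,b])`, with leading constants `C₁` at `a` and `C₂` at
`b`. -/
structure IsInClass (j k : ℕ) (a b : ℝ) (C₁ C₂ : ℂ) (V : ℝ → ℂ) : Prop where
  lt : a < b
  convexHull_support : convexHull ℝ (tsupport V) = Set.Icc a b
  smooth : ∃ N : ℕ, j < N ∧ k < N ∧ ContDiffOn ℝ N V (Set.Icc a b)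
  left_ne : C₁ ≠ 0
  right_ne : C₂ ≠ 0
  left_equiv : V ~[𝓝[>] a] fun x => C₁ * ((x - a : ℝ) : ℂ) ^ j
  right_equiv : V ~[𝓝[<] b] fun x => C₂ * ((b - x : ℝ) : ℂ) ^ k

/-- The logarithmic region `{Im z > -M log (1 + |z|)}`. -/
def logRegion (M : ℝ) : Set ℂ := {z | z.im > -M * Real.log (1 + ‖z‖)}

/-- The explicit part of the sequence, for the sign `s = 1` or `s = -1` and the index `n ≥ 1`,
with `C` the leading constant and `log C` the principal logarithm. -/
def leadingTerm (j k : ℕ) (a b : ℝ) (C : ℂ) (s : ℝ) (n : ℕ) : ℂ :=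
  s * (n * Real.pi / (b - a)) + s * ((j + k + 4) / (2 * (b - a)) * (Real.pi / 2))
    + Complex.I * (Complex.log C / (2 * (b - a)))
    - Complex.I * ((j + k + 4) / (2 * (b - a)) * (Real.log (n * Real.pi / (b - a)) : ℝ))

end ResonanceSequence

end

/-!
# Resonances of a potential with jumps at the ends of its support

Put `U = V + W`, `L = b - a` and `p = j + k + 4`. The equation `-u'' + U u = z² u` has Jost
solutions, equal to `e^{-i z x}` far to the left and to `e^{i z x}` far to the right, which are
entire in `z`. Green's kernel is `left z (min x y) * right z (max x y)` divided by minus their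
Wronskian `det z`. Cut off to a bounded interval it is an entire operator-valued function divided by
an entire scalar function, which is therefore the continued resolvent
(`JostPair.isContinuedResolvent`, `IsContinuedResolvent.eventuallyEq`). At a zero of `det` the two
Jost solutions are proportional, so the numerator is a nonzero operator of rank one: the resonances
are the zeros of `det`, and a simple zero has multiplicity one (`JostPair.isResonance_iff`).

The zeros are found from the asymptotics, in the logarithmic region `Im z > -M log (1 + |z|)`,
`det z / (2 i z) = 1 - E + o(1 + |E|)`, with `E = C e^{2 i z L} (i z)^{-p}`
(`IsJumpData.det_asymptotics`). A wave travelling across `[a, b]` is reflected at `b` with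
coefficient `-k! C₂ / (2 i z)^{k + 2}` and at `a` with coefficient `-j! C₁ / (2 i z)^{j + 2}`, to
leading order, and `E` is the amplitude after one round trip. These coefficients are read off from
WKB solutions of order `N`: the logarithmic derivatives `± i z + wkb U n (x, ± 1 / (2 i z))` solve
the Riccati equation up to `O(z^{-n})`, and at an end point the approximation inside `[a, b]` differs
from the one outside by the jump of the first discontinuous derivative (`tendsto_wkb_jump`). Since
`e^{2 i z x}` may be as large as a power of `|z|`, the growing wave has to be controlled through the
decaying one; the transport estimate (`transport_estimate`) bounds the transmitted and the reflected
component relative to each other, with a gain of `1 / (1 + 2 Im⁻ z)`, where `Im⁻ z = max 0 (-Im z)`,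
which is what makes `N > max j k` derivatives enough.

Finally, a function asymptotic to `1 - E` in this sense has its large zeros in the region near the
solutions of `E = 1`, and they are simple (`HasOscillation.exists_zeros`): near each approximate
solution the function is a small perturbation of `1 - e^{2 i L z}`, and conversely `E ≈ 1` forces
`log E` to be near a multiple of `2 π i`. The hypothesis `M > p / (2 L)` ensures that the approximate
solutions lie in the region.
-/

open scoped BoundedContinuousFunction

noncomputable section

namespace ResonanceSequence

/-! ### Extension and Taylor coefficients of functions smooth up to the boundary -/

theorem exists_contDiff_extension {a b : ℝ} (hab : a < b) (N : ℕ) (f : ℝ → ℂ)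
    (hf : ContDiffOn ℝ N f (Set.Icc a b)) :
    ∃ g : ℝ → ℂ, ContDiff ℝ N g ∧ Set.EqOn g f (Set.Icc a b) := by
  induction N generalizing f with
  | zero =>
    refine ⟨Set.IccExtend hab.le ((Set.Icc a b).domRestrict f), ?_, ?_⟩
    · rw [Nat.cast_zero, contDiff_zero]
      rw [Nat.cast_zero, contDiffOn_zero] at hf
      exact (continuousOn_iff_continuous_domRestrict.1 hf).Icc_extend'
    · intro x hx
      rw [Set.IccExtend_of_mem _ _ hx]
      rfl
  | succ n ih =>
    have huniq : UniqueDiffOn ℝ (Set.Icc a b) := uniqueDiffOn_Icc hab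
    have hf' := hf
    rw [Nat.cast_succ, contDiffOn_succ_iff_derivWithin huniq] at hf'
    obtain ⟨g', hg', heq⟩ := ih _ hf'.2.2
    have hder : ∀ x, HasDerivAt (fun y => f a + ∫ t in a..y, g' t) (g' x) x := fun x =>
      (intervalIntegral.integral_hasDerivAt_right (hg'.continuous.intervalIntegrable _ _)
        (hg'.continuous.stronglyMeasurableAtFilter _ _) hg'.continuous.continuousAt).const_add _
    refine ⟨fun y => f a + ∫ t in a..y, g' t, ?_, ?_⟩
    · rw [Nat.cast_succ, contDiff_succ_iff_deriv]
      refine ⟨fun x => (hder x).differentiableAt, by simp, ?_⟩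
      rwa [show deriv (fun y => f a + ∫ t in a..y, g' t) = g' from
        funext fun x => (hder x).deriv]
    · intro x hx
      have : ∫ t in a..x, g' t = f x - f a := by
        refine intervalIntegral.integral_eq_sub_of_hasDerivAt_of_le hx.1
          (hf.continuousOn.mono (Set.Icc_subset_Icc_right hx.2)) ?_
          (hg'.continuous.intervalIntegrable _ _)
        intro t ht
        have htm : t ∈ Set.Ioo a b := ⟨ht.1, ht.2.trans_le hx.2⟩
        have h1 := (hf'.1 t ⟨htm.1.le, htm.2.le⟩).hasDerivWithinAt.hasDerivAt
          (Icc_mem_nhds htm.1 htm.2)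
        rwa [← heq ⟨htm.1.le, htm.2.le⟩] at h1
      simp only [this]
      ring

/-- A polynomial of degree at most `n` that is `o(t ^ n)` at `0` vanishes. -/
theorem coeff_eq_zero_of_isLittleO {l : Filter ℝ} [l.NeBot] (hl : l ≤ 𝓝[≠] 0) (n : ℕ)
    (c : ℕ → ℂ)
    (h : (fun t : ℝ => ∑ i ∈ Finset.range (n + 1), c i * (t : ℂ) ^ i) =o[l] fun t => (t : ℂ) ^ n) :
    ∀ i ≤ n, c i = 0 := by
  have hlim : Tendsto (fun t : ℝ => (t : ℂ)) l (𝓝 0) := by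
    have : Tendsto (fun t : ℝ => (t : ℂ)) (𝓝 0) (𝓝 0) := by
      simpa using Complex.continuous_ofReal.tendsto 0
    exact this.mono_left (hl.trans nhdsWithin_le_nhds)
  induction n generalizing c with
  | zero =>
    intro i hi
    obtain rfl : i = 0 := by omega
    simp only [zero_add, Finset.range_one, Finset.sum_singleton, pow_zero, mul_one] at h
    rw [isLittleO_one_iff] at h
    exact tendsto_nhds_unique tendsto_const_nhds h
  | succ n ih =>
    have h0 : c 0 = 0 := by
      have h1 : Tendsto (fun t : ℝ => ∑ i ∈ Finset.range (n + 1 + 1), c i * (t : ℂ) ^ i) l (𝓝 0) := by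
        refine h.trans_tendsto ?_
        simpa using hlim.pow (n + 1)
      have h2 : Tendsto (fun t : ℝ => ∑ i ∈ Finset.range (n + 1 + 1), c i * (t : ℂ) ^ i) l
          (𝓝 (∑ i ∈ Finset.range (n + 1 + 1), c i * (0 : ℂ) ^ i)) :=
        tendsto_finsetSum _ fun i _ => (hlim.pow i).const_mul _
      have h3 := tendsto_nhds_unique h2 h1
      rw [Finset.sum_range_succ'] at h3
      simpa using h3
    have hne : ∀ᶠ t : ℝ in l, (t : ℂ) ≠ 0 := by
      filter_upwards [hl self_mem_nhdsWithin] with t ht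
      exact_mod_cast ht
    have h4 := ih (fun i => c (i + 1)) (by
      have h5 := (isBigO_refl (fun t : ℝ => ((t : ℂ))⁻¹) l).mul_isLittleO h
      refine (h5.congr' ?_ ?_)
      · filter_upwards [hne] with t ht
        rw [Finset.sum_range_succ', h0]
        simp only [zero_mul, add_zero, Finset.mul_sum]
        refine Finset.sum_congr rfl fun i _ => ?_
        field_simp
        ring
      · filter_upwards [hne] with t ht
        field_simp
        ring)
    intro i hi
    rcases i with _ | i
    · exact h0
    · exact h4 i (by omega)

/-- The Taylor coefficients of a function equivalent to a monomial. -/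
theorem iteratedDeriv_of_isEquivalent {f : ℝ → ℂ} {a : ℝ} {j : ℕ} {c : ℂ} {l : Filter ℝ} [l.NeBot]
    (hl : l ≤ 𝓝[≠] a) (hf : ContDiff ℝ j f)
    (h : f ~[l] fun x => c * ((x - a : ℝ) : ℂ) ^ j) :
    (∀ i < j, iteratedDeriv i f a = 0) ∧ iteratedDeriv j f a = j.factorial * c := by
  have h1 := (taylor_isLittleO_univ (x₀ := a) hf).mono (hl.trans nhdsWithin_le_nhds)
  have h2 : (f - fun x => c * ((x - a : ℝ) : ℂ) ^ j) =o[l] fun x => ((x - a : ℝ) : ℂ) ^ j :=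
    h.isLittleO.trans_isBigO (isBigO_const_mul_self _ _ _)
  have h1' : (fun x ↦ f x - taylorWithinEval f j Set.univ a x) =o[l]
      fun x => ((x - a : ℝ) : ℂ) ^ j := by
    refine h1.trans_isBigO (isBigO_of_le _ fun x => ?_)
    rw [norm_pow, norm_pow, Complex.norm_real]
  have h3 := h2.sub h1'
  have hl0 : Tendsto (fun t => t - a) l (𝓝[≠] 0) := by
    have : Tendsto (fun t => t - a) (𝓝[≠] a) (𝓝[≠] 0) := by
      refine tendsto_nhdsWithin_of_tendsto_nhds_of_eventually_within _ ?_ ?_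
      · have : Tendsto (fun t => t - a) (𝓝 a) (𝓝 (a - a)) := tendsto_id.sub_const a
        rw [sub_self] at this
        exact this.mono_left nhdsWithin_le_nhds
      · filter_upwards [self_mem_nhdsWithin] with t ht
        exact sub_ne_zero.2 ht
    exact this.mono_left hl
  have key := coeff_eq_zero_of_isLittleO (l := l.map fun t => t - a) hl0 j
    (fun i => (i.factorial : ℂ)⁻¹ * iteratedDeriv i f a - if i = j then c else 0) (by
      rw [isLittleO_map]
      refine h3.congr (fun x => ?_) (fun x => rfl)
      simp only [Pi.sub_apply, Function.comp_apply]
      rw [taylor_within_apply]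
      simp only [sub_mul, Finset.sum_sub_distrib, ite_mul, zero_mul]
      rw [Finset.sum_ite_eq' (Finset.range (j + 1)) j, if_pos (Finset.mem_range.2 (by omega))]
      simp only [iteratedDerivWithin_univ, sub_sub_sub_cancel_left]
      congr 1
      refine Finset.sum_congr rfl fun i _ => ?_
      rw [Complex.real_smul]
      push_cast
      ring)
  refine ⟨fun i hi => ?_, ?_⟩
  · have := key i hi.le
    rw [if_neg hi.ne, sub_zero, mul_eq_zero] at this
    exact this.resolve_left (inv_ne_zero (by exact_mod_cast i.factorial_ne_zero))
  · have := key j le_rfl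
    rw [if_pos rfl, sub_eq_zero] at this
    rw [← this, mul_inv_cancel_left₀ (by exact_mod_cast j.factorial_ne_zero)]

/-! ### Approximate solutions of the Riccati equation -/

/-- The derivative in the first (spatial) variable. -/
def dx (f : ℝ × ℂ → ℂ) (p : ℝ × ℂ) : ℂ := deriv (fun x => f (x, p.2)) p.1

theorem hasDerivAt_slice {f : ℝ × ℂ → ℂ} (hf : ContDiff ℝ 1 f) (x : ℝ) (ε : ℂ) :
    HasDerivAt (fun x => f (x, ε)) (dx f (x, ε)) x := by
  have : ContDiff ℝ 1 (fun x : ℝ => f (x, ε)) := hf.comp (by fun_prop)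
  exact (this.differentiable one_ne_zero x).hasDerivAt

theorem contDiff_dx {f : ℝ × ℂ → ℂ} {k : ℕ} (hf : ContDiff ℝ (k + 1 : ℕ) f) :
    ContDiff ℝ k (dx f) := by
  have h1 : dx f = fun p => fderiv ℝ f p (1, 0) := by
    funext p
    have hd : HasFDerivAt f (fderiv ℝ f p) p :=
      (hf.differentiable (by simp) p).hasFDerivAt
    have hg : HasDerivAt (fun x : ℝ => (x, p.2)) ((1 : ℝ), (0 : ℂ)) p.1 :=
      (hasDerivAt_id p.1).prodMk (hasDerivAt_const _ _)
    exact (HasFDerivAt.comp_hasDerivAt (f := fun x : ℝ => (x, p.2)) p.1 hd hg).deriv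
  rw [h1]
  exact (hf.fderiv_right (m := k) (by norm_cast)).clm_apply contDiff_const

/-- The iterates `s₀ = 0`, `sₙ₊₁ = ε (U - sₙ' - sₙ²)`, as functions of `(x, ε)`. With
`ε = 1 / (2 i λ)` they solve the Riccati equation `s' + 2 i λ s + s² = U` to higher and higher
order in `ε`, so that `exp ∫ (i λ + s)` is an approximate solution of `-u'' + U u = λ² u`. -/
def wkb (U : ℝ → ℂ) : ℕ → ℝ × ℂ → ℂ
  | 0 => fun _ => 0
  | n + 1 => fun p => p.2 * (U p.1 - dx (wkb U n) p - wkb U n p ^ 2)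

/-- The defect `ε⁻ⁿ (s' + s² + s / ε - U)` of the iterate `s = wkb U n` in the Riccati equation,
given by a recursion that makes sense also for `ε = 0`. -/
def wkbDefect (U : ℝ → ℂ) : ℕ → ℝ × ℂ → ℂ
  | 0 => fun p => -U p.1
  | n + 1 => fun p =>
      -(dx (wkbDefect U n) p + wkbDefect U n p * (wkb U n p + wkb U (n + 1) p))

section smooth
variable {U : ℝ → ℂ} {m : ℕ}

theorem contDiff_wkb (hU : ContDiff ℝ m U) (n k : ℕ) (h : n + k ≤ m + 1) :
    ContDiff ℝ k (wkb U n) := by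
  induction n generalizing k with
  | zero => exact contDiff_const
  | succ n ih =>
    have h1 : ContDiff ℝ k (dx (wkb U n)) := contDiff_dx (ih (k + 1) (by omega))
    have h2 : ContDiff ℝ k (wkb U n) := ih k (by omega)
    have h3 : ContDiff ℝ k U := hU.of_le (by exact_mod_cast (by omega : k ≤ m))
    exact contDiff_snd.mul (((h3.comp contDiff_fst).sub h1).sub (h2.pow 2))

theorem contDiff_wkbDefect (hU : ContDiff ℝ m U) (n k : ℕ) (h : n + k ≤ m) :
    ContDiff ℝ k (wkbDefect U n) := by
  induction n generalizing k with
  | zero =>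
    have h3 : ContDiff ℝ k U := hU.of_le (by exact_mod_cast (by omega : k ≤ m))
    exact (h3.comp contDiff_fst).neg
  | succ n ih =>
    have h1 : ContDiff ℝ k (dx (wkbDefect U n)) := contDiff_dx (ih (k + 1) (by omega))
    have h2 : ContDiff ℝ k (wkbDefect U n) := ih k (by omega)
    exact (h1.add (h2.mul ((contDiff_wkb hU n k (by omega)).add
      (contDiff_wkb hU (n + 1) k (by omega))))).neg

theorem wkb_succ_sub (hU : ContDiff ℝ m U) (n : ℕ) (h : n ≤ m) (p : ℝ × ℂ) :
    wkb U (n + 1) p - wkb U n p = -p.2 ^ (n + 1) * wkbDefect U n p := by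
  induction n generalizing p with
  | zero =>
    simp [wkb, wkbDefect, dx]
  | succ n ih =>
    have hs : ContDiff ℝ 1 (wkb U n) := by exact_mod_cast contDiff_wkb hU n 1 (by omega)
    have hg : ContDiff ℝ 1 (wkbDefect U n) := by
      exact_mod_cast contDiff_wkbDefect hU n 1 (by omega)
    have heq : ∀ q, wkb U (n + 1) q = wkb U n q + -q.2 ^ (n + 1) * wkbDefect U n q := fun q => by
      rw [← ih (by omega) q]; ring
    have hdx : dx (wkb U (n + 1)) p = dx (wkb U n) p + -p.2 ^ (n + 1) * dx (wkbDefect U n) p := by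
      have h1 := (hasDerivAt_slice hs p.1 p.2).add
        ((hasDerivAt_slice hg p.1 p.2).const_mul (-p.2 ^ (n + 1)))
      refine Eq.trans ?_ h1.deriv
      rw [dx]
      congr 1
      funext x
      exact heq (x, p.2)
    have e1 : wkb U (n + 1 + 1) p = p.2 * (U p.1 - dx (wkb U (n + 1)) p - wkb U (n + 1) p ^ 2) := rfl
    have e2 : wkb U (n + 1) p = p.2 * (U p.1 - dx (wkb U n) p - wkb U n p ^ 2) := rfl
    have e3 : wkbDefect U (n + 1) p =
      -(dx (wkbDefect U n) p + wkbDefect U n p * (wkb U n p + wkb U (n + 1) p)) := rfl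
    have e4 : wkb U (n + 1 + 1) p - wkb U (n + 1) p =
        -p.2 * ((dx (wkb U (n + 1)) p - dx (wkb U n) p) +
          (wkb U (n + 1) p - wkb U n p) * (wkb U n p + wkb U (n + 1) p)) := by
      linear_combination e1 - e2
    rw [e4, hdx, ih (by omega), e3]
    ring

/-- The Riccati equation up to a defect of order `ε ^ n`. -/
theorem wkb_riccati (hU : ContDiff ℝ m U) (n : ℕ) (h : n ≤ m) (x : ℝ) {ε : ℂ} (hε : ε ≠ 0) :
    dx (wkb U n) (x, ε) + wkb U n (x, ε) ^ 2 + wkb U n (x, ε) / ε - U x =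
      ε ^ n * wkbDefect U n (x, ε) := by
  have h1 := wkb_succ_sub hU n h (x, ε)
  have e1 : wkb U (n + 1) (x, ε) = ε * (U x - dx (wkb U n) (x, ε) - wkb U n (x, ε) ^ 2) := rfl
  rw [e1] at h1
  simp only at h1
  field_simp
  linear_combination -h1

theorem wkb_eq_sum (hU : ContDiff ℝ m U) (n : ℕ) (h : n ≤ m + 1) (p : ℝ × ℂ) :
    wkb U n p = -∑ l ∈ Finset.range n, p.2 ^ (l + 1) * wkbDefect U l p := by
  induction n with
  | zero => simp [wkb]
  | succ n ih =>
    rw [Finset.sum_range_succ, neg_add, ← ih (by omega)]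
    linear_combination wkb_succ_sub hU n (by omega) p

theorem exists_bound_wkbDefect (hU : ContDiff ℝ m U) (n : ℕ) (h : n ≤ m) (c d : ℝ) :
    ∃ B, 0 ≤ B ∧ ∀ x ∈ Set.Icc c d, ∀ ε : ℂ, ‖ε‖ ≤ 1 → ‖wkbDefect U n (x, ε)‖ ≤ B := by
  have hc : Continuous (wkbDefect U n) := (contDiff_wkbDefect hU n 0 (by omega)).continuous
  obtain ⟨B, hB⟩ := (isCompact_Icc.prod (isCompact_closedBall (0 : ℂ) 1)).exists_bound_of_continuousOn
    (hc.continuousOn (s := Set.Icc c d ×ˢ Metric.closedBall (0 : ℂ) 1))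
  refine ⟨max B 0, le_max_right _ _, fun x hx ε hε => (hB (x, ε) ⟨hx, ?_⟩).trans (le_max_left _ _)⟩
  simpa using hε

theorem exists_bound_wkb (hU : ContDiff ℝ m U) (n : ℕ) (h : n ≤ m + 1) (c d : ℝ) :
    ∃ B, 0 ≤ B ∧ ∀ x ∈ Set.Icc c d, ∀ ε : ℂ, ‖ε‖ ≤ 1 → ‖wkb U n (x, ε)‖ ≤ B * ‖ε‖ := by
  choose! B hB0 hB using fun l (hl : l ≤ m) => exists_bound_wkbDefect hU l hl c d
  refine ⟨∑ l ∈ Finset.range n, B l, Finset.sum_nonneg fun l hl => hB0 l ?_, fun x hx ε hε => ?_⟩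
  · have := Finset.mem_range.1 hl; omega
  · rw [wkb_eq_sum hU n h, norm_neg, Finset.sum_mul]
    refine norm_sum_le_of_le _ fun l hl => ?_
    have hl' : l ≤ m := by have := Finset.mem_range.1 hl; omega
    rw [norm_mul, norm_pow, mul_comm]
    refine mul_le_mul (hB l hl' x hx ε hε) ?_ (by positivity) (hB0 l hl')
    rw [pow_succ]
    exact mul_le_of_le_one_left (norm_nonneg _) (pow_le_one₀ (norm_nonneg _) hε)

theorem wkb_at_zero (U : ℝ → ℂ) (n : ℕ) (x : ℝ) : wkb U n (x, 0) = 0 := by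
  cases n <;> simp [wkb]

theorem wkbDefect_at_zero (U : ℝ → ℂ) (n : ℕ) (x : ℝ) :
    wkbDefect U n (x, 0) = (-1) ^ (n + 1) * iteratedDeriv n U x := by
  induction n generalizing x with
  | zero => simp [wkbDefect]
  | succ n ih =>
    have h1 : wkbDefect U (n + 1) (x, 0) = -(dx (wkbDefect U n) (x, 0) + wkbDefect U n (x, 0) *
      (wkb U n (x, 0) + wkb U (n + 1) (x, 0))) := rfl
    rw [h1, wkb_at_zero, wkb_at_zero, dx]
    simp only [ih]
    rw [deriv_const_mul_field, ← iteratedDeriv_succ]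
    ring

end smooth

theorem wkb_eq_zero_of_eqOn {U : ℝ → ℂ} {O : Set ℝ} (hO : IsOpen O) (hU : ∀ x ∈ O, U x = 0)
    (n : ℕ) {x : ℝ} (hx : x ∈ O) (ε : ℂ) : wkb U n (x, ε) = 0 := by
  induction n generalizing x with
  | zero => rfl
  | succ n ih =>
    have h1 : dx (wkb U n) (x, ε) = 0 := by
      have : (fun y => wkb U n (y, ε)) =ᶠ[𝓝 x] fun _ => 0 := by
        filter_upwards [hO.mem_nhds hx] with y hy using ih hy
      rw [dx, this.deriv_eq, deriv_const]
    have e1 : wkb U (n + 1) (x, ε) = ε * (U x - dx (wkb U n) (x, ε) - wkb U n (x, ε) ^ 2) := rfl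
    rw [e1, h1, hU x hx, ih hx]
    ring

theorem wkb_comp_neg (U : ℝ → ℂ) (n : ℕ) (x : ℝ) (ε : ℂ) :
    wkb (fun y => U (-y)) n (x, ε) = -wkb U n (-x, -ε) := by
  induction n generalizing x with
  | zero => simp [wkb]
  | succ n ih =>
    have h1 : dx (wkb (fun y => U (-y)) n) (x, ε) = dx (wkb U n) (-x, -ε) := by
      simp only [dx, ih]
      rw [deriv.fun_neg, deriv_comp_neg (f := fun y => wkb U n (y, -ε)), neg_neg]
    have e1 : wkb (fun y => U (-y)) (n + 1) (x, ε) = ε * (U (-x) -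
      dx (wkb (fun y => U (-y)) n) (x, ε) - wkb (fun y => U (-y)) n (x, ε) ^ 2) := rfl
    have e2 : wkb U (n + 1) (-x, -ε) =
      -ε * (U (-x) - dx (wkb U n) (-x, -ε) - wkb U n (-x, -ε) ^ 2) := rfl
    rw [e1, e2, h1, ih]
    ring

/-! ### The jump of the approximate solutions -/

/-- `f` is of class `C ^ k` and its derivatives of order less than `k` vanish at `a`. -/
def Flat (k : ℕ) (f : ℝ → ℂ) (a : ℝ) : Prop :=
  ContDiff ℝ k f ∧ ∀ i < k, iteratedDeriv i f a = 0

namespace Flat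
variable {k : ℕ} {f g : ℝ → ℂ} {a : ℝ}

theorem sub (hf : Flat k f a) (hg : Flat k g a) : Flat k (fun x => f x - g x) a := by
  refine ⟨hf.1.sub hg.1, fun i hi => ?_⟩
  have hi' : (i : WithTop ℕ∞) ≤ k := by exact_mod_cast hi.le
  rw [iteratedDeriv_fun_sub (hf.1.of_le hi').contDiffAt (hg.1.of_le hi').contDiffAt, hf.2 i hi,
    hg.2 i hi, sub_zero]

theorem mul (hf : Flat k f a) (hg : ContDiff ℝ k g) : Flat k (fun x => f x * g x) a := by
  refine ⟨hf.1.mul hg, fun i hi => ?_⟩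
  have hi' : (i : WithTop ℕ∞) ≤ k := by exact_mod_cast hi.le
  rw [iteratedDeriv_fun_mul (hf.1.of_le hi').contDiffAt (hg.of_le hi').contDiffAt]
  refine Finset.sum_eq_zero fun l hl => ?_
  rw [hf.2 l (by have := Finset.mem_range.1 hl; omega)]
  simp

theorem deriv (hf : Flat (k + 1) f a) : Flat k (deriv f) a := by
  refine ⟨?_, fun i hi => ?_⟩
  · have := hf.1
    rw [Nat.cast_succ, contDiff_succ_iff_deriv] at this
    exact this.2.2
  · rw [← iteratedDeriv_succ']
    exact hf.2 _ (by omega)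

theorem eq_zero (hf : Flat (k + 1) f a) : f a = 0 := by
  have := hf.2 0 (by omega)
  rwa [iteratedDeriv_zero] at this

end Flat

section jump
variable {V W : ℝ → ℂ} {N j : ℕ} {a : ℝ}

theorem contDiff_slice {f : ℝ × ℂ → ℂ} {k : ℕ} (hf : ContDiff ℝ k f) (ε : ℂ) :
    ContDiff ℝ k (fun x => f (x, ε)) := hf.comp (by fun_prop)

/-- The `n`-th iterate at `a` depends on the derivatives of `U` of order less than `n` only, and
its derivatives accordingly. -/
theorem flat_wkb_sub (hV : ContDiff ℝ N V) (hW : ContDiff ℝ N W) (hj : j ≤ N)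
    (hflat : ∀ i < j, iteratedDeriv i V a = 0) (ε : ℂ) (n k : ℕ) (h : n + k ≤ j + 1) :
    Flat k (fun x => wkb (V + W) n (x, ε) - wkb W n (x, ε)) a := by
  induction n generalizing k with
  | zero =>
    refine ⟨by simpa [wkb] using contDiff_const, fun i _ => ?_⟩
    simp [wkb]
  | succ n ih =>
    have hVW : ContDiff ℝ N (V + W) := hV.add hW
    have hVflat : Flat k V a :=
      ⟨hV.of_le (by exact_mod_cast (by omega : k ≤ N)), fun i hi => hflat i (by omega)⟩
    have h1 := (ih (k + 1) (by omega)).deriv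
    have h2 := (ih k (by omega)).mul
      ((contDiff_slice (contDiff_wkb hVW n k (by omega)) ε).add
        (contDiff_slice (contDiff_wkb hW n k (by omega)) ε))
    have h3 := ((hVflat.sub h1).sub h2).mul (contDiff_const (c := ε))
    convert h3 using 1
    funext x
    have d1 := hasDerivAt_slice (f := wkb (V + W) n)
      (by exact_mod_cast contDiff_wkb hVW n 1 (by omega)) x ε
    have d2 := hasDerivAt_slice (f := wkb W n)
      (by exact_mod_cast contDiff_wkb hW n 1 (by omega)) x ε
    have d3 : deriv (fun x => wkb (V + W) n (x, ε) - wkb W n (x, ε)) x = _ := (d1.sub d2).deriv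
    rw [d3]
    simp only [wkb, Pi.add_apply]
    ring

theorem tendsto_wkb_sub_div (hW : ContDiff ℝ N W) (j n : ℕ) (hn : j + 1 + n ≤ N + 1) :
    Tendsto (fun ε : ℂ => (wkb W (j + 1 + n) (a, ε) - wkb W (j + 1) (a, ε)) / ε ^ (j + 1))
      (𝓝[≠] 0) (𝓝 0) := by
  induction n with
  | zero => simp
  | succ n ih =>
    have hc : Continuous (wkbDefect W (j + 1 + n)) :=
      (contDiff_wkbDefect hW (j + 1 + n) 0 (by omega)).continuous
    have h1 : Tendsto (fun ε : ℂ => -ε ^ (n + 1) * wkbDefect W (j + 1 + n) (a, ε)) (𝓝[≠] 0)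
        (𝓝 0) := by
      have : Continuous fun ε : ℂ => -ε ^ (n + 1) * wkbDefect W (j + 1 + n) (a, ε) := by fun_prop
      have h2 := this.tendsto 0
      simp only [zero_pow (Nat.succ_ne_zero n), neg_zero, zero_mul] at h2
      exact h2.mono_left nhdsWithin_le_nhds
    have h3 := (ih (by omega)).add h1
    rw [add_zero] at h3
    refine h3.congr' ?_
    filter_upwards [self_mem_nhdsWithin] with ε hε
    have hε' : ε ≠ 0 := hε
    have h4 := wkb_succ_sub hW (j + 1 + n) (by omega) (a, ε)
    simp only at h4
    rw [show j + 1 + (n + 1) = j + 1 + n + 1 by ring]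
    have h5 : wkb W (j + 1 + n + 1) (a, ε) =
      wkb W (j + 1 + n) (a, ε) + -ε ^ (j + 1 + n + 1) * wkbDefect W (j + 1 + n) (a, ε) := by
        rw [← h4]; ring
    rw [h5]
    field_simp
    ring

/-- If the derivatives of `V` of order less than `j` vanish at `a`, then adding `V` to the
potential changes the approximate solutions at `a` by a multiple of `ε ^ (j + 1)`, to leading
order, and the factor is the `j`-th derivative of `V` up to a sign. -/
theorem tendsto_wkb_jump {K : ℕ} (hV : ContDiff ℝ N V) (hW : ContDiff ℝ K W) (hj : j < N)
    (hNK : N ≤ K) (hflat : ∀ i < j, iteratedDeriv i V a = 0) :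
    Tendsto (fun ε : ℂ => (wkb (V + W) N (a, ε) - wkb W K (a, ε)) / ε ^ (j + 1))
      (𝓝[≠] 0) (𝓝 ((-1) ^ j * iteratedDeriv j V a)) := by
  have hWN : ContDiff ℝ N W := hW.of_le (by exact_mod_cast hNK)
  have hVW : ContDiff ℝ N (V + W) := hV.add hWN
  obtain ⟨n1, hn1⟩ := Nat.exists_eq_add_of_le (show j + 1 ≤ N by omega)
  obtain ⟨n2, hn2⟩ := Nat.exists_eq_add_of_le (show j + 1 ≤ K by omega)
  have t1 := tendsto_wkb_sub_div (a := a) hVW j n1 (by omega)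
  have t2 := tendsto_wkb_sub_div (a := a) hW j n2 (by omega)
  have t3 : Tendsto (fun ε : ℂ => -(wkbDefect (V + W) j (a, ε) - wkbDefect W j (a, ε))) (𝓝[≠] 0)
      (𝓝 ((-1) ^ j * iteratedDeriv j V a)) := by
    have c1 : Continuous (wkbDefect (V + W) j) :=
      (contDiff_wkbDefect hVW j 0 (by omega)).continuous
    have c2 : Continuous (wkbDefect W j) := (contDiff_wkbDefect hWN j 0 (by omega)).continuous
    have hc : Continuous fun ε : ℂ => -(wkbDefect (V + W) j (a, ε) - wkbDefect W j (a, ε)) := by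
      fun_prop
    have := hc.tendsto 0
    rw [wkbDefect_at_zero, wkbDefect_at_zero,
      iteratedDeriv_add (hV.of_le (by exact_mod_cast hj.le)).contDiffAt
        (hWN.of_le (by exact_mod_cast hj.le)).contDiffAt] at this
    have e : -((-1 : ℂ) ^ (j + 1) * (iteratedDeriv j V a + iteratedDeriv j W a) -
      (-1) ^ (j + 1) * iteratedDeriv j W a) = (-1) ^ j * iteratedDeriv j V a := by ring
    rw [e] at this
    exact this.mono_left nhdsWithin_le_nhds
  have t4 := (t1.sub t2).add t3
  rw [sub_zero, zero_add] at t4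
  refine t4.congr' ?_
  filter_upwards [self_mem_nhdsWithin] with ε hε
  have hε' : ε ≠ 0 := hε
  have h0 := (flat_wkb_sub hV hWN hj.le hflat ε j 1 le_rfl).eq_zero
  have h1 := wkb_succ_sub hVW j hj.le (a, ε)
  have h2 := wkb_succ_sub hWN j hj.le (a, ε)
  simp only at h1 h2
  rw [← hn1, ← hn2]
  field_simp
  linear_combination -h1 + h2 - h0

end jump

/-! ### Transport across an interval -/

theorem integral_exp_le {c d x τ : ℝ} (hτ : 0 ≤ τ) (hcx : c ≤ x) (hxd : x ≤ d) :
    ∫ t in c..x, Real.exp (2 * τ * (t - c)) ≤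
      (1 + (d - c)) / (1 + 2 * τ) * Real.exp (2 * τ * (x - c)) ∧
    ∫ t in c..x, Real.exp (2 * τ * (t - c)) ≤ (d - c) * Real.exp (2 * τ * (x - c)) ∧
    ∫ t in c..x, Real.exp (2 * τ * (x - t)) ≤
      (1 + (d - c)) / (1 + 2 * τ) * Real.exp (2 * τ * (x - c)) := by
  have hcont : Continuous fun t => Real.exp (2 * τ * (t - c)) := by fun_prop
  have hcont' : Continuous fun t => Real.exp (2 * τ * (x - t)) := by fun_prop
  have e1 : ∫ t in c..x, 2 * τ * Real.exp (2 * τ * (t - c)) = Real.exp (2 * τ * (x - c)) - 1 := by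
    have := intervalIntegral.integral_eq_sub_of_hasDerivAt (a := c) (b := x)
      (f := fun t => Real.exp (2 * τ * (t - c)))
      (f' := fun t => 2 * τ * Real.exp (2 * τ * (t - c))) (fun t _ => by
        exact (((hasDerivAt_id' t).sub_const c).const_mul (2 * τ)).exp.congr_deriv (by ring)) ((by fun_prop : Continuous _).intervalIntegrable _ _)
    simpa using this
  have e2 : ∫ t in c..x, 2 * τ * Real.exp (2 * τ * (x - t)) = Real.exp (2 * τ * (x - c)) - 1 := by
    have := intervalIntegral.integral_eq_sub_of_hasDerivAt (a := c) (b := x)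
      (f := fun t => -Real.exp (2 * τ * (x - t)))
      (f' := fun t => 2 * τ * Real.exp (2 * τ * (x - t))) (fun t _ => by
        exact (((hasDerivAt_id' t).const_sub x).const_mul (2 * τ)).exp.fun_neg.congr_deriv
          (by ring)) ((by fun_prop : Continuous _).intervalIntegrable _ _)
    rw [this]
    simp
    ring
  rw [intervalIntegral.integral_const_mul] at e1 e2
  have hG : 0 < Real.exp (2 * τ * (x - c)) := Real.exp_pos _
  have hℓ : 0 ≤ d - c := by linarith
  have key : ∀ f : ℝ → ℝ, Continuous f → (∀ t ∈ Set.Icc c x, f t ≤ Real.exp (2 * τ * (x - c))) →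
      ∫ t in c..x, f t ≤ (d - c) * Real.exp (2 * τ * (x - c)) := by
    intro f hf hb
    have h1 : ∫ t in c..x, f t ≤ ∫ _ in c..x, Real.exp (2 * τ * (x - c)) :=
      intervalIntegral.integral_mono_on hcx (hf.intervalIntegrable _ _) (by simp) hb
    rw [intervalIntegral.integral_const, smul_eq_mul] at h1
    refine h1.trans ?_
    gcongr
  have k1 := key _ hcont fun t ht => by
    rw [Real.exp_le_exp]
    have := ht.2
    gcongr
  have k2 := key _ hcont' fun t ht => by
    rw [Real.exp_le_exp]
    have := ht.1
    gcongr
  refine ⟨?_, k1, ?_⟩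
  · rw [div_mul_eq_mul_div, le_div_iff₀ (by positivity)]
    nlinarith
  · rw [div_mul_eq_mul_div, le_div_iff₀ (by positivity)]
    nlinarith

section transport
variable {c d κ τ : ℝ} {Q σ₁ σ₂ ξ η : ℝ → ℂ}

/-- Duhamel's formula. -/
theorem duhamel (hQ : Continuous Q) {g : ℝ → ℂ} {x : ℝ} (hcx : c ≤ x)
    (hg : ContinuousOn g (Set.Icc c x)) (hξ : ContinuousOn ξ (Set.Icc c x))
    (hξ' : ∀ t ∈ Set.Ioo c x, HasDerivAt ξ (Q t * ξ t - g t) t) :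
    ξ x - Complex.exp (∫ t in c..x, Q t) * ξ c =
      -∫ t in c..x, Complex.exp (∫ r in t..x, Q r) * g t := by
  have hI : Continuous fun t => ∫ r in t..x, Q r := by
    have := (intervalIntegral.continuous_primitive
      (fun a b => hQ.intervalIntegrable (μ := volume) a b) x).neg
    refine this.congr fun t => ?_
    rw [intervalIntegral.integral_symm x t, Pi.neg_apply]
  have hE : Continuous fun t => Complex.exp (∫ r in t..x, Q r) := Complex.continuous_exp.comp hI
  have h := intervalIntegral.integral_eq_sub_of_hasDerivAt_of_le hcx
    (f := fun t => Complex.exp (∫ r in t..x, Q r) * ξ t)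
    (f' := fun t => -(Complex.exp (∫ r in t..x, Q r) * g t))
    (hE.continuousOn.mul hξ) (fun t ht => by
      have h1 : HasDerivAt (fun t => ∫ r in t..x, Q r) (-Q t) t :=
        intervalIntegral.integral_hasDerivAt_left (hQ.intervalIntegrable _ _)
          (hQ.stronglyMeasurableAtFilter _ _) hQ.continuousAt
      have h2 := h1.cexp.mul (hξ' t ht)
      exact h2.congr_deriv (by ring))
    ((hE.continuousOn.mul hg).neg.intervalIntegrable_of_Icc hcx)
  rw [intervalIntegral.integral_neg] at h
  rw [h]
  simp

/-- One step of the bootstrap: a bound for `ξ` and `η` yields a better one. -/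
theorem transport_step (hτ : 0 ≤ τ) (hκ : 0 ≤ κ) (hQ : Continuous Q)
    (hσ₁ : ContinuousOn σ₁ (Set.Icc c d)) (hσ₂ : ContinuousOn σ₂ (Set.Icc c d))
    (hξ : ContinuousOn ξ (Set.Icc c d)) (hη : ContinuousOn η (Set.Icc c d))
    (hξ' : ∀ x ∈ Set.Ioo c d, HasDerivAt ξ (Q x * ξ x - σ₁ x * (ξ x - η x)) x)
    (hη' : ∀ x ∈ Set.Ioo c d, HasDerivAt η (-(σ₂ x * (ξ x - η x))) x)
    (hb₁ : ∀ x ∈ Set.Icc c d, ‖σ₁ x‖ ≤ κ) (hb₂ : ∀ x ∈ Set.Icc c d, ‖σ₂ x‖ ≤ κ)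
    (hexp : ∀ y x, c ≤ y → y ≤ x → x ≤ d →
      ‖Complex.exp (∫ t in y..x, Q t)‖ ≤ 2 * Real.exp (2 * τ * (x - y)))
    {A B : ℝ} (hA : 0 ≤ A) (hB : 0 ≤ B)
    (hAB : ∀ t ∈ Set.Icc c d, ‖ξ t‖ + ‖η t‖ ≤ A * Real.exp (2 * τ * (t - c)) + B)
    {x : ℝ} (hx : x ∈ Set.Icc c d) :
    ‖ξ x - Complex.exp (∫ t in c..x, Q t) * ξ c‖ ≤
      2 * κ * (A * (d - c) + B * ((1 + (d - c)) / (1 + 2 * τ))) * Real.exp (2 * τ * (x - c)) ∧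
    ‖η x - η c‖ ≤ κ * (A * ((1 + (d - c)) / (1 + 2 * τ)) * Real.exp (2 * τ * (x - c))
      + B * (d - c)) ∧
    ‖η x - η c‖ ≤ κ * (A * (d - c) * Real.exp (2 * τ * (x - c)) + B * (d - c)) := by
  obtain ⟨i1, i2, i3⟩ := integral_exp_le hτ hx.1 hx.2
  have hsub : Set.Icc c x ⊆ Set.Icc c d := Set.Icc_subset_Icc_right hx.2
  have hxc : x - c ≤ d - c := by linarith [hx.2]
  have hG : 0 < Real.exp (2 * τ * (x - c)) := Real.exp_pos _
  have hdiff : ∀ t ∈ Set.Icc c d, ‖ξ t - η t‖ ≤ A * Real.exp (2 * τ * (t - c)) + B :=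
    fun t ht => (norm_sub_le _ _).trans (hAB t ht)
  have hηint : ‖η x - η c‖ ≤ κ * (A * (∫ t in c..x, Real.exp (2 * τ * (t - c))) + B * (x - c)) := by
    have h := intervalIntegral.integral_eq_sub_of_hasDerivAt_of_le hx.1 (hη.mono hsub)
      (fun t ht => hη' t ⟨ht.1, ht.2.trans_le hx.2⟩)
      (((hσ₂.mono hsub).mul ((hξ.mono hsub).sub (hη.mono hsub))).neg.intervalIntegrable_of_Icc hx.1)
    rw [← h]
    have h2 := intervalIntegral.norm_integral_le_of_norm_le (μ := volume) hx.1
      (f := fun t => -(σ₂ t * (ξ t - η t)))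
      (g := fun t => κ * (A * Real.exp (2 * τ * (t - c)) + B))
      (ae_of_all _ fun t ht => by
        have ht' := hsub ⟨ht.1.le, ht.2⟩
        rw [norm_neg, norm_mul]
        exact mul_le_mul (hb₂ t ht') (hdiff t ht') (norm_nonneg _) hκ)
      ((by fun_prop : Continuous _).intervalIntegrable _ _)
    refine h2.trans (le_of_eq ?_)
    rw [intervalIntegral.integral_const_mul, intervalIntegral.integral_add
      ((by fun_prop : Continuous _).intervalIntegrable _ _) (by simp),
      intervalIntegral.integral_const_mul, intervalIntegral.integral_const, smul_eq_mul,
      mul_comm (x - c)]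
  refine ⟨?_, hηint.trans ?_, hηint.trans ?_⟩
  · rw [duhamel hQ hx.1 (g := fun t => σ₁ t * (ξ t - η t))
      ((hσ₁.mono hsub).mul ((hξ.mono hsub).sub (hη.mono hsub))) (hξ.mono hsub)
      (fun t ht => hξ' t ⟨ht.1, ht.2.trans_le hx.2⟩), norm_neg]
    have h2 := intervalIntegral.norm_integral_le_of_norm_le (μ := volume) hx.1
      (f := fun t => Complex.exp (∫ r in t..x, Q r) * (σ₁ t * (ξ t - η t)))
      (g := fun t => 2 * κ * (A * Real.exp (2 * τ * (x - c)) + B * Real.exp (2 * τ * (x - t))))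
      (ae_of_all _ fun t ht => by
        have ht' := hsub ⟨ht.1.le, ht.2⟩
        rw [norm_mul, norm_mul]
        calc _ ≤ 2 * Real.exp (2 * τ * (x - t)) * (κ * (A * Real.exp (2 * τ * (t - c)) + B)) :=
              mul_le_mul (hexp t x ht.1.le ht.2 hx.2)
                (mul_le_mul (hb₁ t ht') (hdiff t ht') (norm_nonneg _) hκ) (by positivity)
                (by positivity)
          _ = _ := by
            have : Real.exp (2 * τ * (x - c)) =
                Real.exp (2 * τ * (x - t)) * Real.exp (2 * τ * (t - c)) := by
              rw [← Real.exp_add]; ring_nf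
            rw [this]
            ring)
      ((by fun_prop : Continuous _).intervalIntegrable _ _)
    refine h2.trans ?_
    rw [intervalIntegral.integral_const_mul, intervalIntegral.integral_add
      (by simp) ((by fun_prop : Continuous _).intervalIntegrable _ _),
      intervalIntegral.integral_const, smul_eq_mul]
    have j1 : (x - c) * (A * Real.exp (2 * τ * (x - c))) ≤
        A * (d - c) * Real.exp (2 * τ * (x - c)) := by
      have := mul_le_mul_of_nonneg_right hxc (mul_nonneg hA hG.le)
      linarith
    have j2 := mul_le_mul_of_nonneg_left i3 hB
    calc _ ≤ 2 * κ * (A * (d - c) * Real.exp (2 * τ * (x - c)) +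
          B * ((1 + (d - c)) / (1 + 2 * τ) * Real.exp (2 * τ * (x - c)))) := by
            rw [intervalIntegral.integral_const_mul]
            exact mul_le_mul_of_nonneg_left (add_le_add j1 j2) (by positivity)
      _ = _ := by ring
  · rw [mul_assoc A]
    gcongr
  · rw [mul_assoc A]
    gcongr

/-- The transport estimate: `η` is nearly constant and `ξ` nearly follows its free evolution, up to
errors that gain a factor `1 / τ` over the trivial bound. -/
theorem transport_estimate (hcd : c ≤ d) (hτ : 0 ≤ τ) (hκ : 0 ≤ κ) (hκℓ : κ * (d - c) ≤ 1 / 6)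
    (hQ : Continuous Q)
    (hσ₁ : ContinuousOn σ₁ (Set.Icc c d)) (hσ₂ : ContinuousOn σ₂ (Set.Icc c d))
    (hξ : ContinuousOn ξ (Set.Icc c d)) (hη : ContinuousOn η (Set.Icc c d))
    (hξ' : ∀ x ∈ Set.Ioo c d, HasDerivAt ξ (Q x * ξ x - σ₁ x * (ξ x - η x)) x)
    (hη' : ∀ x ∈ Set.Ioo c d, HasDerivAt η (-(σ₂ x * (ξ x - η x))) x)
    (hb₁ : ∀ x ∈ Set.Icc c d, ‖σ₁ x‖ ≤ κ) (hb₂ : ∀ x ∈ Set.Icc c d, ‖σ₂ x‖ ≤ κ)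
    (hexp : ∀ y x, c ≤ y → y ≤ x → x ≤ d →
      ‖Complex.exp (∫ t in y..x, Q t)‖ ≤ 2 * Real.exp (2 * τ * (x - y)))
    (hc : ‖ξ c‖ ≤ ‖η c‖) :
    ‖ξ d - Complex.exp (∫ t in c..d, Q t) * ξ c‖ ≤
      κ * Real.exp (2 * τ * (d - c)) *
        (6 * (d - c) * ‖ξ c‖ + 6 * ((1 + (d - c)) / (1 + 2 * τ)) * ‖η c‖) ∧
    ‖η d - η c‖ ≤ κ * (d - c) * ‖η c‖ + κ * ((1 + (d - c)) / (1 + 2 * τ)) *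
      Real.exp (2 * τ * (d - c)) *
        (3 * ‖ξ c‖ + 12 * κ * ((1 + (d - c)) / (1 + 2 * τ)) * ‖η c‖) := by
  set ℓ := d - c with hℓ
  have hℓ0 : 0 ≤ ℓ := by linarith
  set θ := (1 + ℓ) / (1 + 2 * τ) with hθ
  have hθ0 : 0 ≤ θ := by positivity
  have step := fun {A B : ℝ} (hA : 0 ≤ A) (hB : 0 ≤ B) hAB {x : ℝ} (hx : x ∈ Set.Icc c d) =>
    transport_step hτ hκ hQ hσ₁ hσ₂ hξ hη hξ' hη' hb₁ hb₂ hexp hA hB hAB hx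
  have hne : (Set.Icc c d).Nonempty := ⟨c, le_rfl, hcd⟩
  have hsup : ∀ h : ℝ → ℝ, ContinuousOn h (Set.Icc c d) → (∀ t ∈ Set.Icc c d, 0 ≤ h t) →
      ∃ x ∈ Set.Icc c d, ∃ M, 0 ≤ M ∧ h x = M * Real.exp (2 * τ * (x - c)) ∧
        ∀ t ∈ Set.Icc c d, h t ≤ M * Real.exp (2 * τ * (t - c)) := by
    intro h hh h0
    obtain ⟨x, hx, hmax⟩ := isCompact_Icc.exists_isMaxOn hne
      (hh.mul (by fun_prop : Continuous fun t => Real.exp (-(2 * τ * (t - c)))).continuousOn)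
    refine ⟨x, hx, h x * Real.exp (-(2 * τ * (x - c))), mul_nonneg (h0 x hx) (Real.exp_pos _).le,
      ?_, fun t ht => ?_⟩
    · rw [mul_assoc, ← Real.exp_add, neg_add_cancel, Real.exp_zero, mul_one]
    · have h1 : h t * Real.exp (-(2 * τ * (t - c))) ≤ h x * Real.exp (-(2 * τ * (x - c))) := hmax ht
      have h2 := mul_le_mul_of_nonneg_right h1 (Real.exp_pos (2 * τ * (t - c))).le
      rwa [mul_assoc, ← Real.exp_add, neg_add_cancel, Real.exp_zero, mul_one] at h2
  have hfree : ∀ x ∈ Set.Icc c d, ‖Complex.exp (∫ t in c..x, Q t) * ξ c‖ ≤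
      2 * Real.exp (2 * τ * (x - c)) * ‖ξ c‖ := fun x hx => by
    rw [norm_mul]
    gcongr
    exact hexp c x le_rfl hx.1 hx.2
  have hξle : ∀ x ∈ Set.Icc c d, ∀ E, ‖ξ x - Complex.exp (∫ t in c..x, Q t) * ξ c‖ ≤ E →
      ‖ξ x‖ ≤ 2 * Real.exp (2 * τ * (x - c)) * ‖ξ c‖ + E := fun x hx E hE => by
    have h1 := norm_add_le (Complex.exp (∫ t in c..x, Q t) * ξ c)
      (ξ x - Complex.exp (∫ t in c..x, Q t) * ξ c)
    rw [add_sub_cancel] at h1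
    linarith [hfree x hx]
  have hηle : ∀ x, ∀ E, ‖η x - η c‖ ≤ E → ‖η x‖ ≤ ‖η c‖ + E := fun x E hE => by
    have h1 := norm_add_le (η c) (η x - η c)
    rw [add_sub_cancel] at h1
    linarith
  set p := ‖ξ c‖
  set y := ‖η c‖
  have hp : 0 ≤ p := norm_nonneg _
  have hy : 0 ≤ y := norm_nonneg _
  have hG1 : ∀ x ∈ Set.Icc c d, 1 ≤ Real.exp (2 * τ * (x - c)) := fun x hx => by
    rw [Real.one_le_exp_iff]
    have := hx.1
    exact mul_nonneg (by positivity) (by linarith)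
  obtain ⟨x₁, hx₁, M, hM0, hxM, hM⟩ := hsup (fun t => ‖ξ t‖ + ‖η t‖) (hξ.norm.add hη.norm)
    fun t _ => by positivity
  have hM' : ∀ t ∈ Set.Icc c d, ‖ξ t‖ + ‖η t‖ ≤ M * Real.exp (2 * τ * (t - c)) + 0 := by
    simpa using hM
  have hMy : M ≤ 6 * y := by
    obtain ⟨s1, -, s3⟩ := step hM0 le_rfl hM' hx₁
    have a1 := hξle x₁ hx₁ _ s1
    have a2 := hηle x₁ _ s3
    have hG := hG1 x₁ hx₁
    set G := Real.exp (2 * τ * (x₁ - c))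
    simp only [zero_mul, add_zero] at a1 a2
    have a3 : M * G ≤ (2 * p + y + 3 * (κ * ℓ) * M) * G := by
      have : y ≤ y * G := le_mul_of_one_le_right hy hG
      rw [← hxM]
      nlinarith
    have a4 := le_of_mul_le_mul_right a3 (by linarith)
    nlinarith
  have hηM : ∀ x ∈ Set.Icc c d, ‖η x‖ ≤ y + κ * (M * θ) * Real.exp (2 * τ * (x - c)) := by
    intro x hx
    obtain ⟨-, s2, -⟩ := step hM0 le_rfl hM' hx
    have := hηle x _ s2
    rw [zero_mul, add_zero, ← mul_assoc] at this
    exact this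
  obtain ⟨x₂, hx₂, P, hP0, hxP, hP⟩ := hsup (fun t => ‖ξ t‖) hξ.norm fun t _ => norm_nonneg _
  have hA0 : 0 ≤ P + κ * (M * θ) := by positivity
  have hP' : ∀ t ∈ Set.Icc c d, ‖ξ t‖ + ‖η t‖ ≤
      (P + κ * (M * θ)) * Real.exp (2 * τ * (t - c)) + y := fun t ht => by
    nlinarith [hP t ht, hηM t ht]
  have hκM : κ * ℓ * M ≤ y := by nlinarith [mul_nonneg hκ hℓ0]
  have hκMθ : κ * ℓ * M * θ ≤ y * θ := mul_le_mul_of_nonneg_right hκM hθ0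
  have hPp : P ≤ 3 * p + 6 * (κ * (θ * y)) := by
    obtain ⟨s1, -, -⟩ := step hA0 hy hP' hx₂
    have a1 := hξle x₂ hx₂ _ s1
    have hG := hG1 x₂ hx₂
    set G := Real.exp (2 * τ * (x₂ - c))
    rw [hxP] at a1
    have a3 : P * G ≤ (2 * p + 2 * κ * ((P + κ * (M * θ)) * ℓ + y * θ)) * G := by
      rw [add_mul]
      linarith
    have a4 := le_of_mul_le_mul_right a3 (by linarith)
    have a5 := mul_le_mul_of_nonneg_left hκMθ hκ
    have a6 := mul_le_mul_of_nonneg_right hκℓ hP0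
    nlinarith
  obtain ⟨s1, s2, -⟩ := step hA0 hy hP' (x := d) ⟨hcd, le_rfl⟩
  have hG := Real.exp_pos (2 * τ * ℓ)
  have hℓP : ℓ * P ≤ 3 * (ℓ * p) + θ * y := by
    have a1 := mul_le_mul_of_nonneg_left hPp hℓ0
    have a2 := mul_le_mul_of_nonneg_right hκℓ (mul_nonneg hθ0 hy)
    nlinarith
  constructor
  · refine s1.trans ?_
    rw [show 2 * κ * ((P + κ * (M * θ)) * ℓ + y * θ) * Real.exp (2 * τ * (d - c)) =
      κ * Real.exp (2 * τ * (d - c)) * (2 * ((P + κ * (M * θ)) * ℓ + y * θ)) by ring]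
    gcongr
    nlinarith
  · refine s2.trans ?_
    have b1 : (P + κ * (M * θ)) ≤ 3 * p + 12 * κ * θ * y := by
      have := mul_le_mul_of_nonneg_left hMy (mul_nonneg hκ hθ0)
      nlinarith
    have b2 := mul_le_mul_of_nonneg_right b1 (show 0 ≤ κ * θ * Real.exp (2 * τ * ℓ) by positivity)
    change κ * ((P + κ * (M * θ)) * θ * Real.exp (2 * τ * ℓ) + y * ℓ) ≤ _
    linarith

end transport

/-! ### Solutions of the stationary equation -/

/-- `U` is bounded, measurable, and continuous off the finite set `S`. -/
structure IsPotential (U : ℝ → ℂ) (S : Set ℝ) : Prop where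
  finite : S.Finite
  measurable : Measurable U
  bounded : ∃ B, ∀ x, ‖U x‖ ≤ B
  continuousAt : ∀ x ∉ S, ContinuousAt U x

/-- `u` is a `C¹` solution, with derivative `u'`, of `-u'' + U u = z² u` off the exceptional
set `S`. -/
structure IsSol (U : ℝ → ℂ) (S : Set ℝ) (z : ℂ) (u u' : ℝ → ℂ) : Prop where
  hasDerivAt : ∀ x, HasDerivAt u (u' x) x
  continuous' : Continuous u'
  hasDerivAt' : ∀ x ∉ S, HasDerivAt u' ((U x - z ^ 2) * u x) x

namespace IsSol
variable {U V : ℝ → ℂ} {S S' : Set ℝ} {z : ℂ} {u u' v v' : ℝ → ℂ}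

theorem continuous (h : IsSol U S z u u') : Continuous u :=
  continuous_iff_continuousAt.2 fun x => (h.hasDerivAt x).continuousAt

theorem sub (hu : IsSol U S z u u') (hv : IsSol U S z v v') : IsSol U S z (u - v) (u' - v') where
  hasDerivAt x := (hu.hasDerivAt x).sub (hv.hasDerivAt x)
  continuous' := hu.continuous'.sub hv.continuous'
  hasDerivAt' x hx := ((hu.hasDerivAt' x hx).sub (hv.hasDerivAt' x hx)).congr_deriv
    (by simp only [Pi.sub_apply]; ring)

theorem const_mul (hu : IsSol U S z u u') (c : ℂ) :
    IsSol U S z (fun x => c * u x) (fun x => c * u' x) where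
  hasDerivAt x := (hu.hasDerivAt x).const_mul c
  continuous' := hu.continuous'.const_mul c
  hasDerivAt' x hx := ((hu.hasDerivAt' x hx).const_mul c).congr_deriv (by ring)

theorem comp_neg (hu : IsSol U S z u u') :
    IsSol (fun x => U (-x)) (Neg.neg ⁻¹' S) z (fun x => u (-x)) (fun x => -u' (-x)) where
  hasDerivAt x := by
    have h := (hu.hasDerivAt (-x)).scomp x (hasDerivAt_neg x)
    exact h.congr_deriv (by simp)
  continuous' := (hu.continuous'.comp continuous_neg).neg
  hasDerivAt' x hx := by
    have h := ((hu.hasDerivAt' (-x) hx).scomp x (hasDerivAt_neg x)).fun_neg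
    exact h.congr_deriv (by simp)

/-- The Wronskian is constant on intervals on which the potentials agree. -/
theorem wronskian_eq (hu : IsSol U S z u u') (hv : IsSol V S' z v v') (hS : S.Finite)
    (hS' : S'.Finite) {c d : ℝ} (hcd : c ≤ d) (hUV : ∀ x ∈ Set.Ioo c d, U x = V x) :
    u c * v' c - u' c * v c = u d * v' d - u' d * v d := by
  have hc : Continuous fun x => u x * v' x - u' x * v x :=
    (hu.continuous.mul hv.continuous').sub (hu.continuous'.mul hv.continuous)
  have h := integral_eq_of_hasDerivAt_off_countable_of_le (fun x => u x * v' x - u' x * v x)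
    (fun _ => 0) hcd (hS.union hS').countable hc.continuousOn (fun x hx => by
      have hxS : x ∉ S := fun h => hx.2 (Or.inl h)
      have hxS' : x ∉ S' := fun h => hx.2 (Or.inr h)
      exact (((hu.hasDerivAt x).mul (hv.hasDerivAt' x hxS')).sub
        ((hu.hasDerivAt' x hxS).mul (hv.hasDerivAt x))).congr_deriv
          (by rw [hUV x hx.1]; ring)) (by simp)
  simp only [intervalIntegral.integral_zero] at h
  exact (sub_eq_zero.1 h.symm).symm

theorem wronskian_const (hu : IsSol U S z u u') (hv : IsSol U S z v v') (hS : S.Finite)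
    (c d : ℝ) : u c * v' c - u' c * v c = u d * v' d - u' d * v d := by
  rcases le_total c d with h | h
  · exact hu.wronskian_eq hv hS hS h fun _ _ => rfl
  · exact (hu.wronskian_eq hv hS hS h fun _ _ => rfl).symm

end IsSol

theorem isSol_exp (z μ : ℂ) (hμ : μ ^ 2 = -z ^ 2) :
    IsSol 0 ∅ z (fun x => Complex.exp (μ * x)) (fun x => μ * Complex.exp (μ * x)) := by
  have h : ∀ x : ℝ, HasDerivAt (fun x : ℝ => Complex.exp (μ * x)) (μ * Complex.exp (μ * x)) x :=
    fun x => by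
      have := ((hasDerivAt_id (x : ℂ)).const_mul μ).cexp.comp_ofReal
      exact this.congr_deriv (by simp; ring)
  refine ⟨h, by fun_prop, fun x _ => ((h x).const_mul μ).congr_deriv ?_⟩
  simp only [Pi.zero_apply]
  linear_combination Complex.exp (μ * x) * hμ

/-! ### The Volterra operator -/

theorem norm_integral_exp_abs_le {κ : ℝ} (hκ : 0 < κ) (x₀ x : ℝ) :
    |∫ t in x₀..x, Real.exp (κ * |t - x₀|)| ≤ Real.exp (κ * |x - x₀|) / κ := by
  rw [intervalIntegral.integral_comp_sub_right (fun t => Real.exp (κ * |t|)) x₀, sub_self]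
  generalize x - x₀ = X
  have hpos : ∀ Y : ℝ, 0 ≤ Y → ∫ t in (0 : ℝ)..Y, Real.exp (κ * |t|) = (Real.exp (κ * Y) - 1) / κ := by
    intro Y hY
    have h1 : ∫ t in (0 : ℝ)..Y, Real.exp (κ * |t|) = ∫ t in (0 : ℝ)..Y, Real.exp (κ * t) := by
      refine intervalIntegral.integral_congr fun t ht => ?_
      rw [Set.uIcc_of_le hY] at ht
      simp only [abs_of_nonneg ht.1]
    rw [h1, intervalIntegral.integral_comp_mul_left (fun t => Real.exp t) hκ.ne', integral_exp]
    simp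
    field_simp
  have hle : ∀ Y : ℝ, 0 ≤ Y → |∫ t in (0 : ℝ)..Y, Real.exp (κ * |t|)| ≤ Real.exp (κ * Y) / κ := by
    intro Y hY
    rw [hpos Y hY, abs_of_nonneg (div_nonneg (sub_nonneg.2 (Real.one_le_exp (by positivity))) hκ.le)]
    gcongr
    linarith
  rcases le_total 0 X with hX | hX
  · rw [abs_of_nonneg hX]
    exact hle X hX
  · have h2 := intervalIntegral.integral_comp_neg (a := 0) (b := X) (fun t => Real.exp (κ * |t|))
    simp only [abs_neg, neg_zero] at h2
    rw [h2, intervalIntegral.integral_symm, abs_neg, abs_of_nonpos hX]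
    exact hle (-X) (by linarith)

theorem intervalIntegrable_of_bounded {f : ℝ → ℂ} (hf : Measurable f) {B : ℝ}
    (hB : ∀ x, ‖f x‖ ≤ B) (a b : ℝ) : IntervalIntegrable f volume a b := by
  rw [intervalIntegrable_iff]
  exact Measure.integrableOn_of_bounded (by simp) hf.aestronglyMeasurable
    (ae_of_all _ hB)

section volterra
variable {f : ℝ → ℂ} (hf : Measurable f) {B : ℝ} (hB : ∀ x, ‖f x‖ ≤ B) {κ : ℝ} (hκ : 0 < κ) (x₀ : ℝ)

theorem intervalIntegrable_volterra (hf : Measurable f) (hB : ∀ x, ‖f x‖ ≤ B) (κ x₀ : ℝ)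
    (v : ℝ →ᵇ ℂ) (a b : ℝ) :
    IntervalIntegrable (fun t => f t * (Real.exp (κ * |t - x₀|) * v t)) volume a b :=
  (intervalIntegrable_of_bounded hf hB a b).mul_continuousOn
    (by fun_prop : Continuous fun t => ((Real.exp (κ * |t - x₀|) : ℝ) : ℂ) * v t).continuousOn

theorem norm_volterra_le (hB : ∀ x, ‖f x‖ ≤ B) (hκ : 0 < κ) (x₀ : ℝ) (v : ℝ →ᵇ ℂ) (x : ℝ) :
    ‖(Real.exp (-(κ * |x - x₀|)) : ℂ) *
      ∫ t in x₀..x, f t * (Real.exp (κ * |t - x₀|) * v t)‖ ≤ B / κ * ‖v‖ := by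
  have hB0 : 0 ≤ B := (norm_nonneg _).trans (hB 0)
  have h1 : ‖∫ t in x₀..x, f t * (Real.exp (κ * |t - x₀|) * v t)‖ ≤
      |∫ t in x₀..x, B * ‖v‖ * Real.exp (κ * |t - x₀|)| := by
    refine intervalIntegral.norm_integral_le_abs_of_norm_le (ae_of_all _ fun t => ?_)
      ((by fun_prop : Continuous _).intervalIntegrable _ _)
    rw [norm_mul, norm_mul, Complex.norm_real, Real.norm_of_nonneg (Real.exp_pos _).le,
      mul_assoc, mul_comm ‖v‖]
    have := v.norm_coe_le_norm t
    have := hB t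
    gcongr
  rw [intervalIntegral.integral_const_mul, abs_mul, abs_of_nonneg (by positivity)] at h1
  rw [norm_mul, Complex.norm_real, Real.norm_of_nonneg (Real.exp_pos _).le]
  calc _ ≤ Real.exp (-(κ * |x - x₀|)) * (B * ‖v‖ * (Real.exp (κ * |x - x₀|) / κ)) := by
        gcongr
        exact h1.trans (by gcongr; exact norm_integral_exp_abs_le hκ x₀ x)
    _ = _ := by
        have : Real.exp (-(κ * |x - x₀|)) * Real.exp (κ * |x - x₀|) = 1 := by
          rw [← Real.exp_add, neg_add_cancel, Real.exp_zero]
        linear_combination (B * ‖v‖ / κ) * this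

/-- The primitive `v ↦ ∫_{x₀}^x f v` conjugated with the weight `e^{κ |x - x₀|}`, on bounded
continuous functions. The weight makes its norm at most `B / κ`. -/
def volterra : (ℝ →ᵇ ℂ) →L[ℂ] (ℝ →ᵇ ℂ) :=
  LinearMap.mkContinuous
    { toFun := fun v => BoundedContinuousFunction.ofNormedAddCommGroup
        (fun x => (Real.exp (-(κ * |x - x₀|)) : ℂ) *
          ∫ t in x₀..x, f t * (Real.exp (κ * |t - x₀|) * v t))
        (by
          have := intervalIntegral.continuous_primitive
            (intervalIntegrable_volterra hf hB κ x₀ v) x₀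
          fun_prop)
        (B / κ * ‖v‖) (norm_volterra_le hB hκ x₀ v)
      map_add' := by
        intro v w
        ext x
        simp only [BoundedContinuousFunction.coe_ofNormedAddCommGroup,
          BoundedContinuousFunction.coe_add, Pi.add_apply]
        rw [← mul_add, ← intervalIntegral.integral_add (intervalIntegrable_volterra hf hB κ x₀ v _ _)
          (intervalIntegrable_volterra hf hB κ x₀ w _ _)]
        congr 2
        funext t
        ring
      map_smul' := by
        intro c v
        ext x
        simp only [BoundedContinuousFunction.coe_ofNormedAddCommGroup,
          BoundedContinuousFunction.coe_smul, smul_eq_mul, RingHom.id_apply]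
        have : ∫ t in x₀..x, f t * (Real.exp (κ * |t - x₀|) * (c * v t)) =
            c * ∫ t in x₀..x, f t * (Real.exp (κ * |t - x₀|) * v t) := by
          rw [← intervalIntegral.integral_const_mul]
          congr 1
          funext t
          ring
        rw [this, mul_left_comm] }
    (B / κ) fun v => BoundedContinuousFunction.norm_ofNormedAddCommGroup_le _
      (mul_nonneg (div_nonneg ((norm_nonneg _).trans (hB 0)) hκ.le) (norm_nonneg _))
      (norm_volterra_le hB hκ x₀ v)

theorem norm_volterra_op_le : ‖volterra hf hB hκ x₀‖ ≤ B / κ :=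
  LinearMap.mkContinuous_norm_le _ (div_nonneg ((norm_nonneg _).trans (hB 0)) hκ.le) _

end volterra

/-- The family `u z` depends holomorphically on `z`: on each disc it is a fixed weight times a
holomorphic function with values in the bounded continuous functions. -/
def IsHolomorphicFamily (u : ℂ → ℝ → ℂ) : Prop :=
  ∀ Z : ℝ, ∃ (κ : ℝ) (v : ℂ → (ℝ →ᵇ ℂ)), DifferentiableOn ℂ v (Metric.ball 0 Z) ∧
    ∀ z ∈ Metric.ball (0 : ℂ) Z, ∀ x, u z x = (Real.exp (κ * |x|) : ℂ) * v z x

theorem IsHolomorphicFamily.differentiable {u : ℂ → ℝ → ℂ} (h : IsHolomorphicFamily u) (x : ℝ) :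
    Differentiable ℂ fun z => u z x := by
  intro z
  obtain ⟨κ, v, hv, huv⟩ := h (‖z‖ + 1)
  have hz : Metric.ball (0 : ℂ) (‖z‖ + 1) ∈ 𝓝 z := Metric.isOpen_ball.mem_nhds (by simp)
  have h1 : DifferentiableAt ℂ (fun w => (Real.exp (κ * |x|) : ℂ) *
      BoundedContinuousFunction.evalCLM ℂ x (v w)) z :=
    ((BoundedContinuousFunction.evalCLM ℂ x).differentiableAt.comp z
      (hv.differentiableAt hz)).const_mul _
  refine h1.congr_of_eventuallyEq ?_
  filter_upwards [hz] with w hw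
  exact huv w hw x

/-- The bounded continuous function `x ↦ c e^{-κ |x - x₀|}`. -/
def decayBCF {κ : ℝ} (hκ : 0 < κ) (x₀ : ℝ) : ℝ →ᵇ ℂ :=
  BoundedContinuousFunction.ofNormedAddCommGroup (fun x => (Real.exp (-(κ * |x - x₀|)) : ℂ))
    (by fun_prop) 1 fun x => by
      rw [Complex.norm_real, Real.norm_of_nonneg (Real.exp_pos _).le, Real.exp_le_one_iff]
      exact neg_nonpos.2 (by positivity)

/-- The bounded continuous function `x ↦ e^{κ (|x - x₀| - |x|)}`. -/
def shiftBCF {κ : ℝ} (hκ : 0 < κ) (x₀ : ℝ) : ℝ →ᵇ ℂ :=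
  BoundedContinuousFunction.ofNormedAddCommGroup (fun x => (Real.exp (κ * (|x - x₀| - |x|)) : ℂ))
    (by fun_prop) (Real.exp (κ * |x₀|)) fun x => by
      rw [Complex.norm_real, Real.norm_of_nonneg (Real.exp_pos _).le, Real.exp_le_exp]
      have := abs_sub_abs_le_abs_sub (x - x₀) x
      have h2 : |x - x₀ - x| = |x₀| := by rw [sub_sub_cancel_left, abs_neg]
      rw [h2] at this
      gcongr

theorem exists_differentiableOn_fixedPoint {E : Type*} [NormedAddCommGroup E] [NormedSpace ℂ E]
    [CompleteSpace E] {s : Set ℂ} {T : ℂ → E →L[ℂ] E} (hT : Differentiable ℂ T)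
    (hs : ∀ z ∈ s, ‖T z‖ < 1) {P : ℂ → E} (hP : Differentiable ℂ P) :
    ∃ w : ℂ → E, DifferentiableOn ℂ w s ∧ ∀ z ∈ s, w z = P z + T z (w z) := by
  have hunit : ∀ z ∈ s, IsUnit (1 - T z) := fun z hz => (Units.oneSub (T z) (hs z hz)).isUnit
  refine ⟨fun z => Ring.inverse (1 - T z) (P z), fun z hz => ?_, fun z hz => ?_⟩
  · have d1 := differentiableAt_inverse (𝕜 := ℂ) (hunit z hz)
    have d2 := DifferentiableAt.comp z (f := fun z => 1 - T z) d1
      ((differentiableAt_const _).fun_sub (hT z))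
    exact (d2.clm_apply (hP z)).differentiableWithinAt
  · have h1 : (1 - T z) (Ring.inverse (1 - T z) (P z)) = P z := by
      change ((1 - T z) * Ring.inverse (1 - T z)) (P z) = P z
      rw [Ring.mul_inverse_cancel _ (hunit z hz)]
      rfl
    conv_rhs => rw [← h1]
    simp

/-- Solutions on a disc of spectral parameters, with holomorphic Cauchy data at `x₀`. -/
theorem exists_sol_on_ball {U : ℝ → ℂ} {S : Set ℝ} (hU : IsPotential U S) (x₀ : ℝ) {p q : ℂ → ℂ}
    (hp : Differentiable ℂ p) (hq : Differentiable ℂ q) (Z : ℝ) :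
    ∃ (κ : ℝ) (v v' : ℂ → (ℝ →ᵇ ℂ)), DifferentiableOn ℂ v (Metric.ball 0 Z) ∧
      DifferentiableOn ℂ v' (Metric.ball 0 Z) ∧ ∀ z ∈ Metric.ball (0 : ℂ) Z,
        IsSol U S z (fun x => (Real.exp (κ * |x|) : ℂ) * v z x)
          (fun x => (Real.exp (κ * |x|) : ℂ) * v' z x) ∧
        (Real.exp (κ * |x₀|) : ℂ) * v z x₀ = p z ∧ (Real.exp (κ * |x₀|) : ℂ) * v' z x₀ = q z := by
  obtain ⟨B, hB⟩ := hU.bounded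
  have hB0 : 0 ≤ B := (norm_nonneg _).trans (hB 0)
  set κ := 1 + B + Z ^ 2 + 1 with hκdef
  have hκ : 0 < κ := by positivity
  have h1m : Measurable fun _ : ℝ => (1 : ℂ) := measurable_const
  have h1B : ∀ x : ℝ, ‖(fun _ : ℝ => (1 : ℂ)) x‖ ≤ 1 := by simp
  set I₁ := volterra h1m h1B hκ x₀ with hI₁
  set IU := volterra hU.measurable hB hκ x₀ with hIU
  have nI₁ : ‖I₁‖ ≤ 1 / κ := norm_volterra_op_le _ _ _ _
  have nIU : ‖IU‖ ≤ B / κ := norm_volterra_op_le _ _ _ _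
  let T : ℂ → ((ℝ →ᵇ ℂ) × (ℝ →ᵇ ℂ)) →L[ℂ] ((ℝ →ᵇ ℂ) × (ℝ →ᵇ ℂ)) := fun z =>
    (ContinuousLinearMap.inl ℂ _ _).comp (I₁.comp (ContinuousLinearMap.snd ℂ _ _)) +
      (ContinuousLinearMap.inr ℂ _ _).comp (IU.comp (ContinuousLinearMap.fst ℂ _ _)) -
      z ^ 2 • (ContinuousLinearMap.inr ℂ _ _).comp (I₁.comp (ContinuousLinearMap.fst ℂ _ _))
  have hTapply : ∀ z w, T z w = (I₁ w.2, IU w.1 - z ^ 2 • I₁ w.1) := by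
    intro z w
    simp [T]
  have hTdiff : Differentiable ℂ T := by
    intro z
    have h2 : DifferentiableAt ℂ (fun z : ℂ => z ^ 2) z := by fun_prop
    have h3 := h2.smul_const ((ContinuousLinearMap.inr ℂ (ℝ →ᵇ ℂ) (ℝ →ᵇ ℂ)).comp
      (I₁.comp (ContinuousLinearMap.fst ℂ (ℝ →ᵇ ℂ) (ℝ →ᵇ ℂ))))
    exact (differentiableAt_const _).fun_sub h3
  have hTnorm : ∀ z ∈ Metric.ball (0 : ℂ) Z, ‖T z‖ < 1 := by
    intro z hz
    have hz' : ‖z‖ < Z := by simpa using hz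
    have hz2 : ‖z‖ ^ 2 ≤ Z ^ 2 := by gcongr
    refine lt_of_le_of_lt (ContinuousLinearMap.opNorm_le_bound _
      (show 0 ≤ (1 + B + Z ^ 2) / κ by positivity) fun w => ?_) ((div_lt_one hκ).2 (by linarith))
    rw [hTapply, Prod.norm_def]
    have hw1 : ‖w.1‖ ≤ ‖w‖ := norm_fst_le w
    have hw2 : ‖w.2‖ ≤ ‖w‖ := norm_snd_le w
    refine max_le ?_ ?_
    · refine (I₁.le_of_opNorm_le nI₁ _).trans ?_
      gcongr
      nlinarith [sq_nonneg Z]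
    · refine (norm_sub_le _ _).trans ?_
      rw [norm_smul, norm_pow]
      have a1 := IU.le_of_opNorm_le nIU w.1
      have a2 := I₁.le_of_opNorm_le nI₁ w.1
      have a3 : B / κ * ‖w.1‖ ≤ B / κ * ‖w‖ := by gcongr
      have a4 : ‖z‖ ^ 2 * ‖I₁ w.1‖ ≤ Z ^ 2 * (1 / κ * ‖w‖) := by
        have : 1 / κ * ‖w.1‖ ≤ 1 / κ * ‖w‖ := by gcongr
        have a5 := a2.trans this
        gcongr
      have a6 : (1 + B + Z ^ 2) / κ * ‖w‖ = 1 / κ * ‖w‖ + B / κ * ‖w‖ + Z ^ 2 * (1 / κ * ‖w‖) := by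
        ring
      have a7 : 0 ≤ 1 / κ * ‖w‖ := by positivity
      linarith
  let P : ℂ → (ℝ →ᵇ ℂ) × (ℝ →ᵇ ℂ) := fun z => (p z • decayBCF hκ x₀, q z • decayBCF hκ x₀)
  have hPdiff : Differentiable ℂ P := fun z =>
    ((hp z).smul_const _).prodMk ((hq z).smul_const _)
  obtain ⟨w, hwdiff, hweq⟩ := exists_differentiableOn_fixedPoint hTdiff hTnorm hPdiff
  refine ⟨κ, fun z => shiftBCF hκ x₀ * (w z).1, fun z => shiftBCF hκ x₀ * (w z).2, ?_, ?_, ?_⟩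
  · exact (hwdiff.fst).const_mul _
  · exact (hwdiff.snd).const_mul _
  intro z hz
  set u : ℝ → ℂ := fun x => (Real.exp (κ * |x - x₀|) : ℂ) * (w z).1 x with hu
  set u' : ℝ → ℂ := fun x => (Real.exp (κ * |x - x₀|) : ℂ) * (w z).2 x with hu'
  have hcancel : ∀ x : ℝ, (Real.exp (κ * |x - x₀|) : ℂ) * (Real.exp (-(κ * |x - x₀|)) : ℂ) = 1 := by
    intro x
    rw [← Complex.ofReal_mul, ← Real.exp_add, add_neg_cancel, Real.exp_zero, Complex.ofReal_one]
  have hshift : ∀ (g : ℝ →ᵇ ℂ) (x : ℝ), (Real.exp (κ * |x|) : ℂ) * (shiftBCF hκ x₀ * g) x =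
      (Real.exp (κ * |x - x₀|) : ℂ) * g x := by
    intro g x
    have : (shiftBCF hκ x₀ * g) x = (Real.exp (κ * (|x - x₀| - |x|)) : ℂ) * g x := rfl
    rw [this, ← mul_assoc, ← Complex.ofReal_mul, ← Real.exp_add]
    congr 4
    ring
  simp only [hshift]
  have hz2 := hweq z hz
  rw [hTapply] at hz2
  have e1 : ∀ x, u x = p z + ∫ t in x₀..x, u' t := by
    intro x
    have h1 := congrArg (fun y : (ℝ →ᵇ ℂ) × (ℝ →ᵇ ℂ) => y.1 x) hz2
    have h2 : (w z).1 x = p z * (Real.exp (-(κ * |x - x₀|)) : ℂ) +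
        (Real.exp (-(κ * |x - x₀|)) : ℂ) *
          ∫ t in x₀..x, (1 : ℂ) * (Real.exp (κ * |t - x₀|) * (w z).2 t) := h1
    simp only [one_mul] at h2
    simp only [hu, h2, hu']
    linear_combination (p z + ∫ t in x₀..x, (Real.exp (κ * |t - x₀|) : ℂ) * (w z).2 t) * hcancel x
  have e2 : ∀ x, u' x = q z + ∫ t in x₀..x, (U t - z ^ 2) * u t := by
    intro x
    have h1 := congrArg (fun y : (ℝ →ᵇ ℂ) × (ℝ →ᵇ ℂ) => y.2 x) hz2
    have h2 : (w z).2 x = q z * (Real.exp (-(κ * |x - x₀|)) : ℂ) +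
        ((Real.exp (-(κ * |x - x₀|)) : ℂ) *
          (∫ t in x₀..x, U t * (Real.exp (κ * |t - x₀|) * (w z).1 t)) - z ^ 2 *
          ((Real.exp (-(κ * |x - x₀|)) : ℂ) *
            ∫ t in x₀..x, (1 : ℂ) * (Real.exp (κ * |t - x₀|) * (w z).1 t))) := h1
    have h3 : ∫ t in x₀..x, (U t - z ^ 2) * u t =
        (∫ t in x₀..x, U t * (Real.exp (κ * |t - x₀|) * (w z).1 t)) - z ^ 2 *
            ∫ t in x₀..x, (1 : ℂ) * (Real.exp (κ * |t - x₀|) * (w z).1 t) := by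
      rw [← intervalIntegral.integral_const_mul, ← intervalIntegral.integral_sub
        (intervalIntegrable_volterra hU.measurable hB κ x₀ _ _ _)
        ((intervalIntegrable_volterra h1m h1B κ x₀ _ _ _).const_mul _)]
      congr 1
      funext t
      simp only [hu]
      ring
    rw [h3]
    simp only [hu', h2]
    linear_combination (q z + ((∫ t in x₀..x, U t * (Real.exp (κ * |t - x₀|) * (w z).1 t)) - z ^ 2 *
            ∫ t in x₀..x, (1 : ℂ) * (Real.exp (κ * |t - x₀|) * (w z).1 t))) * hcancel x
  have huc : Continuous u := by fun_prop
  have huc' : Continuous u' := by fun_prop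
  refine ⟨⟨fun x => ?_, huc', fun x hx => ?_⟩, ?_, ?_⟩
  · have h1 := (intervalIntegral.integral_hasDerivAt_right (huc'.intervalIntegrable x₀ x)
      (huc'.stronglyMeasurableAtFilter volume (𝓝 x)) huc'.continuousAt).const_add (p z)
    exact h1.congr_of_eventuallyEq (Eventually.of_forall e1)
  · have hm : Measurable fun t => (U t - z ^ 2) * u t :=
      (hU.measurable.sub_const _).mul huc.measurable
    have hint : IntervalIntegrable (fun t => (U t - z ^ 2) * u t) volume x₀ x :=
      (intervalIntegrable_of_bounded (B := B + ‖z ^ 2‖) (hU.measurable.sub_const _)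
        (fun y => (norm_sub_le _ _).trans (by gcongr; exact hB y)) _ _).mul_continuousOn
        huc.continuousOn
    have h1 := (intervalIntegral.integral_hasDerivAt_right hint
      (hm.stronglyMeasurable.stronglyMeasurableAtFilter)
      (((hU.continuousAt x hx).sub continuousAt_const).mul huc.continuousAt)).const_add (q z)
    exact h1.congr_of_eventuallyEq (Eventually.of_forall e2)
  · exact (e1 x₀).trans (by simp)
  · exact (e2 x₀).trans (by simp)

section unique
variable {U : ℝ → ℂ} {S : Set ℝ} {z : ℂ} {u u' v v' : ℝ → ℂ}

theorem exists_sol_at (hU : IsPotential U S) (x₀ : ℝ) (z p q : ℂ) :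
    ∃ u u', IsSol U S z u u' ∧ u x₀ = p ∧ u' x₀ = q := by
  obtain ⟨κ, v, v', -, -, h⟩ := exists_sol_on_ball hU x₀ (differentiable_const p)
    (differentiable_const q) (‖z‖ + 1)
  exact ⟨_, _, h z (by simp)⟩

/-- Uniqueness for the Cauchy problem. -/
theorem IsSol.eq_of_eq_at (hU : IsPotential U S) (hu : IsSol U S z u u') (hv : IsSol U S z v v')
    {x₀ : ℝ} (h : u x₀ = v x₀) (h' : u' x₀ = v' x₀) : u = v ∧ u' = v' := by
  -- The Wronskians of the difference with a basis of solutions vanish.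
  obtain ⟨c, c', hc, hc0, hc0'⟩ := exists_sol_at hU x₀ z 1 0
  obtain ⟨s, s', hs, hs0, hs0'⟩ := exists_sol_at hU x₀ z 0 1
  have hd := hu.sub hv
  have key : ∀ x, (u - v) x = 0 ∧ (u' - v') x = 0 := by
    intro x
    have w1 := hd.wronskian_const hc hU.finite x₀ x
    have w2 := hd.wronskian_const hs hU.finite x₀ x
    have w3 := hc.wronskian_const hs hU.finite x₀ x
    have d0 : (u - v) x₀ = 0 := sub_eq_zero.2 h
    have d0' : (u' - v') x₀ = 0 := sub_eq_zero.2 h'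
    rw [d0, d0'] at w1 w2
    rw [hc0, hc0', hs0, hs0'] at w3
    constructor
    · linear_combination (u - v) x * w3 + s x * w1 - c x * w2
    · linear_combination (u' - v') x * w3 + s' x * w1 - c' x * w2
  exact ⟨funext fun x => sub_eq_zero.1 (key x).1, funext fun x => sub_eq_zero.1 (key x).2⟩

/-- A solution with holomorphic Cauchy data at `x₀` is a holomorphic family. -/
theorem exists_holomorphic_sol (hU : IsPotential U S) (x₀ : ℝ) {p q : ℂ → ℂ}
    (hp : Differentiable ℂ p) (hq : Differentiable ℂ q) :
    ∃ u u' : ℂ → ℝ → ℂ, (∀ z, IsSol U S z (u z) (u' z)) ∧ (∀ z, u z x₀ = p z) ∧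
      (∀ z, u' z x₀ = q z) ∧ IsHolomorphicFamily u ∧ IsHolomorphicFamily u' := by
  choose u u' hu hup huq using fun z => exists_sol_at hU x₀ z (p z) (q z)
  have key : ∀ Z : ℝ, ∃ (κ : ℝ) (v v' : ℂ → (ℝ →ᵇ ℂ)), DifferentiableOn ℂ v (Metric.ball 0 Z) ∧
      DifferentiableOn ℂ v' (Metric.ball 0 Z) ∧ ∀ z ∈ Metric.ball (0 : ℂ) Z,
        (∀ x, u z x = (Real.exp (κ * |x|) : ℂ) * v z x) ∧
        ∀ x, u' z x = (Real.exp (κ * |x|) : ℂ) * v' z x := by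
    intro Z
    obtain ⟨κ, v, v', hv, hv', h⟩ := exists_sol_on_ball hU x₀ hp hq Z
    refine ⟨κ, v, v', hv, hv', fun z hz => ?_⟩
    obtain ⟨h1, h2, h3⟩ := h z hz
    have := (hu z).eq_of_eq_at hU h1 ((hup z).trans h2.symm) ((huq z).trans h3.symm)
    exact ⟨fun x => congrFun this.1 x, fun x => congrFun this.2 x⟩
  refine ⟨u, u', hu, hup, huq, fun Z => ?_, fun Z => ?_⟩
  · obtain ⟨κ, v, v', hv, hv', h⟩ := key Z
    exact ⟨κ, v, hv, fun z hz => (h z hz).1⟩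
  · obtain ⟨κ, v, v', hv, hv', h⟩ := key Z
    exact ⟨κ, v', hv', fun z hz => (h z hz).2⟩

end unique

/-! ### Transport of solutions in terms of approximate solutions -/

/-- The semiclassical parameter `1 / (2 i z)`. -/
def eps (z : ℂ) : ℂ := 1 / (2 * Complex.I * z)

/-- The exponential rate `max 0 (-Im z)` at which `e^{i z x}` grows. -/
def growth (z : ℂ) : ℝ := max 0 (-z.im)

/-- The logarithmic derivative of the approximate solution resembling `e^{i z x}`. -/
def qplus (U : ℝ → ℂ) (n : ℕ) (z : ℂ) (x : ℝ) : ℂ := Complex.I * z + wkb U n (x, eps z)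

/-- The logarithmic derivative of the approximate solution resembling `e^{-i z x}`. -/
def qminus (U : ℝ → ℂ) (n : ℕ) (z : ℂ) (x : ℝ) : ℂ := -(Complex.I * z) + wkb U n (x, -eps z)

/-- The difference of the two approximate logarithmic derivatives. -/
def qdiff (U : ℝ → ℂ) (n : ℕ) (z : ℂ) (x : ℝ) : ℂ := qplus U n z x - qminus U n z x

/-- The approximate solution resembling `e^{i z (d - c)}`, from `c` to `d`. -/
def eplus (U : ℝ → ℂ) (n : ℕ) (c d : ℝ) (z : ℂ) : ℂ := Complex.exp (∫ x in c..d, qplus U n z x)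

/-- The quotient of the two approximate solutions, resembling `e^{2 i z (d - c)}`. -/
def ediff (U : ℝ → ℂ) (n : ℕ) (c d : ℝ) (z : ℂ) : ℂ := Complex.exp (∫ x in c..d, qdiff U n z x)

theorem eps_ne_zero {z : ℂ} (hz : z ≠ 0) : eps z ≠ 0 := by
  simp [eps, hz]

theorem one_div_eps (z : ℂ) : 1 / eps z = 2 * Complex.I * z := by
  simp [eps]

theorem norm_eps (z : ℂ) : ‖eps z‖ = 1 / (2 * ‖z‖) := by
  simp [eps]

theorem eventually_ne_zero_cobounded : ∀ᶠ z : ℂ in Bornology.cobounded ℂ, z ≠ 0 :=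
  (tendsto_norm_cobounded_atTop.eventually_gt_atTop 0).mono fun _ hz => norm_pos_iff.1 hz

theorem tendsto_eps : Tendsto eps (Bornology.cobounded ℂ) (𝓝[≠] 0) := by
  refine tendsto_nhdsWithin_of_tendsto_nhds_of_eventually_within _ ?_ ?_
  · have : Tendsto (fun z : ℂ => (1 / (2 * Complex.I)) * z⁻¹) (Bornology.cobounded ℂ) (𝓝 0) := by
      simpa using (tendsto_inv₀_cobounded (α := ℂ)).const_mul (1 / (2 * Complex.I))
    refine this.congr fun z => ?_
    rw [eps, one_div, one_div, mul_inv (2 * Complex.I) z]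
  · filter_upwards [eventually_ne_zero_cobounded] with z hz
    exact eps_ne_zero hz

theorem tendsto_norm_eps : Tendsto (fun z => ‖eps z‖) (Bornology.cobounded ℂ) (𝓝 0) := by
  simpa using (tendsto_nhdsWithin_iff.1 tendsto_eps).1.norm

section core
variable {U : ℝ → ℂ} {m : ℕ}

theorem continuous_wkb_slice (hU : ContDiff ℝ m U) (n : ℕ) (h : n ≤ m + 1) (ε : ℂ) :
    Continuous fun x => wkb U n (x, ε) :=
  (contDiff_slice (contDiff_wkb hU n 0 (by omega)) ε).continuous

theorem continuous_qplus (hU : ContDiff ℝ m U) (n : ℕ) (h : n ≤ m + 1) (z : ℂ) :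
    Continuous (qplus U n z) := continuous_const.add (continuous_wkb_slice hU n h _)

theorem continuous_qminus (hU : ContDiff ℝ m U) (n : ℕ) (h : n ≤ m + 1) (z : ℂ) :
    Continuous (qminus U n z) := continuous_const.add (continuous_wkb_slice hU n h _)

theorem continuous_qdiff (hU : ContDiff ℝ m U) (n : ℕ) (h : n ≤ m + 1) (z : ℂ) :
    Continuous (qdiff U n z) := (continuous_qplus hU n h z).sub (continuous_qminus hU n h z)

/-- The difference of the logarithmic derivatives is `2 i z` up to `O(1 / z)`. -/
theorem exists_bound_qdiff (hU : ContDiff ℝ m U) (n : ℕ) (h : n ≤ m + 1) (c d : ℝ) :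
    ∃ B, 0 ≤ B ∧ ∀ᶠ z in Bornology.cobounded ℂ, ∀ x ∈ Set.Icc c d,
      ‖qplus U n z x - Complex.I * z‖ ≤ B * ‖eps z‖ ∧
      ‖qdiff U n z x - 2 * Complex.I * z‖ ≤ B * ‖eps z‖ ∧ ‖z‖ ≤ ‖qdiff U n z x‖ := by
  obtain ⟨B, hB0, hB⟩ := exists_bound_wkb hU n h c d
  refine ⟨2 * B, by positivity, ?_⟩
  have h1 : ∀ᶠ z in Bornology.cobounded ℂ, ‖eps z‖ ≤ 1 :=
    (tendsto_norm_eps.eventually (gt_mem_nhds one_pos)).mono fun z hz => le_of_lt hz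
  have h2 : ∀ᶠ z : ℂ in Bornology.cobounded ℂ, 2 * B ≤ ‖z‖ :=
    tendsto_norm_cobounded_atTop.eventually_ge_atTop _
  filter_upwards [h1, h2] with z hz1 hz2 x hx
  have b1 := hB x hx (eps z) hz1
  have b2 := hB x hx (-eps z) (by rwa [norm_neg])
  rw [norm_neg] at b2
  have e : qdiff U n z x - 2 * Complex.I * z = wkb U n (x, eps z) - wkb U n (x, -eps z) := by
    simp only [qdiff, qplus, qminus]; ring
  have b3 : ‖qdiff U n z x - 2 * Complex.I * z‖ ≤ 2 * B * ‖eps z‖ := by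
    rw [e]
    exact (norm_sub_le _ _).trans (by linarith)
  refine ⟨?_, b3, ?_⟩
  · simp only [qplus, add_sub_cancel_left]
    have := mul_nonneg hB0 (norm_nonneg (eps z))
    linarith
  · have h3 : ‖2 * Complex.I * z‖ = 2 * ‖z‖ := by simp
    have h4 := norm_sub_norm_le (2 * Complex.I * z) (qdiff U n z x)
    rw [norm_sub_rev] at h4
    have h5 : 2 * B * ‖eps z‖ ≤ 2 * B := mul_le_of_le_one_right (by positivity) hz1
    linarith

/-- The exponential of an integral which is `O(1 / z)` tends to `1`. -/
theorem tendsto_exp_integral_of_bound {q : ℂ → ℝ → ℂ} {μ : ℂ → ℂ} {c d B : ℝ} (hcd : c ≤ d)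
    (hq : ∀ z, Continuous (q z))
    (hB : ∀ᶠ z in Bornology.cobounded ℂ, ∀ x ∈ Set.Icc c d, ‖q z x - μ z‖ ≤ B * ‖eps z‖) :
    Tendsto (fun z => Complex.exp (∫ x in c..d, q z x) * Complex.exp (-(μ z * (d - c))))
      (Bornology.cobounded ℂ) (𝓝 1) := by
  have h1 : Tendsto (fun z => ∫ x in c..d, (q z x - μ z)) (Bornology.cobounded ℂ) (𝓝 0) := by
    refine squeeze_zero_norm' (a := fun z => B * ‖eps z‖ * |d - c|) ?_ ?_
    · filter_upwards [hB] with z hz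
      refine intervalIntegral.norm_integral_le_of_norm_le_const fun x hx => ?_
      rw [Set.uIoc_of_le hcd] at hx
      exact hz x ⟨hx.1.le, hx.2⟩
    · simpa using (tendsto_norm_eps.const_mul B).mul_const |d - c|
  have h2 := (Complex.continuous_exp.tendsto 0).comp h1
  rw [Complex.exp_zero] at h2
  refine h2.congr fun z => ?_
  rw [Function.comp_apply, ← Complex.exp_add, intervalIntegral.integral_sub
    ((hq z).intervalIntegrable _ _) (by simp), intervalIntegral.integral_const]
  congr 1
  rw [Complex.real_smul]
  push_cast
  ring

theorem tendsto_eplus (hU : ContDiff ℝ m U) (n : ℕ) (h : n ≤ m + 1) {c d : ℝ} (hcd : c ≤ d) :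
    Tendsto (fun z => eplus U n c d z * Complex.exp (-(Complex.I * z * (d - c))))
      (Bornology.cobounded ℂ) (𝓝 1) := by
  obtain ⟨B, -, hB⟩ := exists_bound_qdiff hU n h c d
  exact tendsto_exp_integral_of_bound hcd (continuous_qplus hU n h)
    (hB.mono fun z hz x hx => (hz x hx).1)

theorem tendsto_ediff (hU : ContDiff ℝ m U) (n : ℕ) (h : n ≤ m + 1) {c d : ℝ} (hcd : c ≤ d) :
    Tendsto (fun z => ediff U n c d z * Complex.exp (-(2 * Complex.I * z * (d - c))))
      (Bornology.cobounded ℂ) (𝓝 1) := by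
  obtain ⟨B, -, hB⟩ := exists_bound_qdiff hU n h c d
  exact tendsto_exp_integral_of_bound hcd (continuous_qdiff hU n h)
    (hB.mono fun z hz x hx => (hz x hx).2.1)

theorem tendsto_qdiff (hU : ContDiff ℝ m U) (n : ℕ) (h : n ≤ m + 1) (x : ℝ) :
    Tendsto (fun z => eps z * qdiff U n z x) (Bornology.cobounded ℂ) (𝓝 1) := by
  obtain ⟨B, -, hB⟩ := exists_bound_qdiff hU n h x x
  have h1 : Tendsto (fun z => eps z * (qdiff U n z x - 2 * Complex.I * z)) (Bornology.cobounded ℂ)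
      (𝓝 0) := by
    refine squeeze_zero_norm' (a := fun z => ‖eps z‖ * (B * ‖eps z‖)) ?_ ?_
    · filter_upwards [hB] with z hz
      rw [norm_mul]
      have := (hz x ⟨le_rfl, le_rfl⟩).2.1
      gcongr
    · simpa using tendsto_norm_eps.mul (tendsto_norm_eps.const_mul B)
  have h2 := h1.add_const 1
  rw [zero_add] at h2
  refine h2.congr' ?_
  filter_upwards [eventually_ne_zero_cobounded] with z hz
  rw [eps]
  field_simp
  ring

/-- The transport estimate for `X = u' - q₋ u` and `Y = u' - q₊ u`, where `u` is a solution. -/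
theorem exists_transport_bound (hU : ContDiff ℝ m U) (n : ℕ) (hn : 1 ≤ n) (h : n ≤ m) {c d : ℝ}
    (hcd : c ≤ d) :
    ∃ B, 0 ≤ B ∧ ∀ᶠ z in Bornology.cobounded ℂ, ∀ (P : ℝ → ℂ) (S : Set ℝ) (u u' : ℝ → ℂ),
      IsSol P S z u u' → (∀ x ∈ Set.Ioo c d, P x = U x ∧ x ∉ S) →
      ‖u' c - qminus U n z c * u c‖ ≤ ‖u' c - qplus U n z c * u c‖ →
      ‖(u' d - qminus U n z d * u d) * eplus U n c d z -
          ediff U n c d z * (u' c - qminus U n z c * u c)‖ ≤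
        B * ‖eps z‖ ^ (n + 1) * Real.exp (2 * growth z * (d - c)) *
          (6 * (d - c) * ‖u' c - qminus U n z c * u c‖ +
            6 * ((1 + (d - c)) / (1 + 2 * growth z)) * ‖u' c - qplus U n z c * u c‖) ∧
      ‖(u' d - qplus U n z d * u d) * eplus U n c d z - (u' c - qplus U n z c * u c)‖ ≤
        B * ‖eps z‖ ^ (n + 1) * (d - c) * ‖u' c - qplus U n z c * u c‖ +
        B * ‖eps z‖ ^ (n + 1) * ((1 + (d - c)) / (1 + 2 * growth z)) *
          Real.exp (2 * growth z * (d - c)) *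
          (3 * ‖u' c - qminus U n z c * u c‖ + 12 * (B * ‖eps z‖ ^ (n + 1)) *
            ((1 + (d - c)) / (1 + 2 * growth z)) * ‖u' c - qplus U n z c * u c‖) := by
  obtain ⟨A, hA0, hA⟩ := exists_bound_qdiff hU n (by omega) c d
  obtain ⟨G, hG0, hG⟩ := exists_bound_wkbDefect hU n h c d
  have hg : Continuous (wkbDefect U n) := (contDiff_wkbDefect hU n 0 (by omega)).continuous
  have hs1 : ContDiff ℝ 1 (wkb U n) := by exact_mod_cast contDiff_wkb hU n 1 (by omega)
  refine ⟨2 * G, by positivity, ?_⟩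
  have f1 : ∀ᶠ z in Bornology.cobounded ℂ, ‖eps z‖ ≤ 1 :=
    (tendsto_norm_eps.eventually (gt_mem_nhds one_pos)).mono fun z hz => le_of_lt hz
  have f2 : ∀ᶠ z in Bornology.cobounded ℂ, 2 * G * ‖eps z‖ ^ (n + 1) * (d - c) ≤ 1 / 6 := by
    have : Tendsto (fun z => 2 * G * ‖eps z‖ ^ (n + 1) * (d - c)) (Bornology.cobounded ℂ)
        (𝓝 (2 * G * 0 ^ (n + 1) * (d - c))) :=
      ((tendsto_norm_eps.pow (n + 1)).const_mul _).mul_const _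
    rw [zero_pow (by omega), mul_zero, zero_mul] at this
    exact (this.eventually (gt_mem_nhds (by norm_num : (0 : ℝ) < 1 / 6))).mono fun z hz => le_of_lt hz
  have f3 : ∀ᶠ z in Bornology.cobounded ℂ, A * ‖eps z‖ * (d - c) ≤ Real.log 2 := by
    have : Tendsto (fun z => A * ‖eps z‖ * (d - c)) (Bornology.cobounded ℂ)
        (𝓝 (A * 0 * (d - c))) := (tendsto_norm_eps.const_mul _).mul_const _
    rw [mul_zero, zero_mul] at this
    exact (this.eventually (gt_mem_nhds (Real.log_pos one_lt_two))).mono fun z hz => le_of_lt hz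
  filter_upwards [hA, f1, f2, f3, eventually_ne_zero_cobounded] with z hzA hz1 hz2 hz3 hz0
    P S u u' hu hPU hXY
  have hε := eps_ne_zero hz0
  have hzn : 0 < ‖z‖ := norm_pos_iff.2 hz0
  have cqp := continuous_qplus hU n (by omega) z
  have cqm := continuous_qminus hU n (by omega) z
  have cqd := continuous_qdiff hU n (by omega) z
  have hQ0 : ∀ x ∈ Set.Icc c d, qdiff U n z x ≠ 0 := fun x hx =>
    norm_pos_iff.1 (hzn.trans_le (hzA x hx).2.2)
  have hE : ∀ x, HasDerivAt (fun x => eplus U n c x z) (qplus U n z x * eplus U n c x z) x := by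
    intro x
    have h1 : HasDerivAt (fun x => ∫ t in c..x, qplus U n z t) (qplus U n z x) x :=
      intervalIntegral.integral_hasDerivAt_right (cqp.intervalIntegrable _ _)
        (cqp.stronglyMeasurableAtFilter _ _) cqp.continuousAt
    exact h1.cexp.congr_deriv (mul_comm _ _)
  have cE : Continuous fun x => eplus U n c x z :=
    continuous_iff_continuousAt.2 fun x => (hE x).continuousAt
  have hEc : eplus U n c c z = 1 := by simp [eplus]
  -- the logarithmic derivatives satisfy the Riccati equation up to `ρ`
  let ρp : ℝ → ℂ := fun x => eps z ^ n * wkbDefect U n (x, eps z)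
  let ρm : ℝ → ℂ := fun x => (-eps z) ^ n * wkbDefect U n (x, -eps z)
  have dqp : ∀ x, HasDerivAt (qplus U n z) (U x - z ^ 2 + ρp x - qplus U n z x ^ 2) x := by
    intro x
    refine ((hasDerivAt_slice hs1 x (eps z)).const_add (Complex.I * z)).congr_deriv ?_
    have h1 := wkb_riccati hU n h x hε
    have h2 : wkb U n (x, eps z) / eps z = 2 * Complex.I * z * wkb U n (x, eps z) := by
      rw [← one_div_eps]; ring
    rw [h2] at h1
    simp only [ρp, qplus]
    linear_combination h1 + z ^ 2 * Complex.I_sq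
  have dqm : ∀ x, HasDerivAt (qminus U n z) (U x - z ^ 2 + ρm x - qminus U n z x ^ 2) x := by
    intro x
    refine ((hasDerivAt_slice hs1 x (-eps z)).const_add (-(Complex.I * z))).congr_deriv ?_
    have h1 := wkb_riccati hU n h x (neg_ne_zero.2 hε)
    have h2 : wkb U n (x, -eps z) / -eps z = -(2 * Complex.I * z) * wkb U n (x, -eps z) := by
      rw [← one_div_eps]; ring
    rw [h2] at h1
    simp only [ρm, qminus]
    linear_combination h1 + z ^ 2 * Complex.I_sq
  have cρp : Continuous ρp := continuous_const.mul (hg.comp (by fun_prop))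
  have cρm : Continuous ρm := continuous_const.mul (hg.comp (by fun_prop))
  have bρ : ∀ x ∈ Set.Icc c d, ∀ ε' : ℂ, ‖ε'‖ = ‖eps z‖ →
      ‖ε' ^ n * wkbDefect U n (x, ε') / qdiff U n z x‖ ≤ 2 * G * ‖eps z‖ ^ (n + 1) := by
    intro x hx ε' hε'
    rw [norm_div, norm_mul, norm_pow, hε', div_le_iff₀ (norm_pos_iff.2 (hQ0 x hx))]
    have h1 := hG x hx ε' (by rwa [hε'])
    have h2 := (hzA x hx).2.2
    have h3 : 2 * ‖eps z‖ * ‖z‖ = 1 := by rw [norm_eps]; field_simp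
    calc ‖eps z‖ ^ n * ‖wkbDefect U n (x, ε')‖ ≤ ‖eps z‖ ^ n * G := by gcongr
      _ = 2 * G * ‖eps z‖ ^ (n + 1) * ‖z‖ := by
        rw [pow_succ]; linear_combination -(‖eps z‖ ^ n * G) * h3
      _ ≤ _ := by gcongr
  have hu_eq : ∀ x ∈ Set.Icc c d, (u' x - qminus U n z x * u x) - (u' x - qplus U n z x * u x) =
      qdiff U n z x * u x := fun x _ => by simp only [qdiff]; ring
  have key := transport_estimate (c := c) (d := d) (κ := 2 * G * ‖eps z‖ ^ (n + 1)) (τ := growth z)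
    (Q := qdiff U n z) (σ₁ := fun x => ρm x / qdiff U n z x) (σ₂ := fun x => ρp x / qdiff U n z x)
    (ξ := fun x => (u' x - qminus U n z x * u x) * eplus U n c x z)
    (η := fun x => (u' x - qplus U n z x * u x) * eplus U n c x z)
    hcd (le_max_left _ _) (by positivity) hz2 cqd
    (cρm.continuousOn.div cqd.continuousOn hQ0) (cρp.continuousOn.div cqd.continuousOn hQ0)
    (((hu.continuous'.sub (cqm.mul hu.continuous)).mul cE).continuousOn)
    (((hu.continuous'.sub (cqp.mul hu.continuous)).mul cE).continuousOn)
    (fun x hx => by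
      obtain ⟨hPx, hxS⟩ := hPU x hx
      have hx' : x ∈ Set.Icc c d := ⟨hx.1.le, hx.2.le⟩
      refine (((hu.hasDerivAt' x hxS).sub ((dqm x).mul (hu.hasDerivAt x))).mul (hE x)).congr_deriv ?_
      rw [← sub_mul, hu_eq x hx', mul_assoc (qdiff U n z x), ← mul_assoc _ (qdiff U n z x),
        div_mul_cancel₀ _ (hQ0 x hx'), hPx]
      simp only [qdiff, Pi.sub_apply, Pi.mul_apply]
      ring)
    (fun x hx => by
      obtain ⟨hPx, hxS⟩ := hPU x hx
      have hx' : x ∈ Set.Icc c d := ⟨hx.1.le, hx.2.le⟩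
      refine (((hu.hasDerivAt' x hxS).sub ((dqp x).mul (hu.hasDerivAt x))).mul (hE x)).congr_deriv ?_
      rw [← sub_mul, hu_eq x hx', mul_assoc (qdiff U n z x), ← mul_assoc _ (qdiff U n z x),
        div_mul_cancel₀ _ (hQ0 x hx'), hPx]
      simp only [Pi.sub_apply, Pi.mul_apply]
      ring)
    (fun x hx => bρ x hx (-eps z) (norm_neg _)) (fun x hx => bρ x hx (eps z) rfl)
    (fun y x hy hyx hx => by
      have h1 : ‖∫ t in y..x, (qdiff U n z t - 2 * Complex.I * z)‖ ≤ Real.log 2 := by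
        refine (intervalIntegral.norm_integral_le_of_norm_le_const (C := A * ‖eps z‖)
          fun t ht => ?_).trans ?_
        · rw [Set.uIoc_of_le hyx] at ht
          exact (hzA t ⟨hy.trans ht.1.le, ht.2.trans hx⟩).2.1
        · rw [abs_of_nonneg (by linarith)]
          refine le_trans ?_ hz3
          gcongr
      have h2 : ∫ t in y..x, qdiff U n z t =
          (∫ t in y..x, (qdiff U n z t - 2 * Complex.I * z)) + 2 * Complex.I * z * (x - y) := by
        rw [intervalIntegral.integral_sub (cqd.intervalIntegrable _ _) (by simp),
          intervalIntegral.integral_const, Complex.real_smul]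
        push_cast
        ring
      rw [h2, Complex.exp_add, norm_mul]
      refine mul_le_mul ?_ ?_ (norm_nonneg _) (by norm_num)
      · rw [Complex.norm_exp]
        calc _ ≤ Real.exp (Real.log 2) := Real.exp_le_exp.2 ((Complex.re_le_norm _).trans h1)
          _ = 2 := Real.exp_log two_pos
      · rw [Complex.norm_exp, Real.exp_le_exp]
        have h3 : (2 * Complex.I * z * (x - y)).re = 2 * (-z.im) * (x - y) := by
          simp
        rw [h3]
        have h4 : -z.im ≤ growth z := le_max_right _ _
        have h5 : 0 ≤ x - y := by linarith
        gcongr)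
    (by simpa only [hEc, mul_one] using hXY)
  simp only [hEc, mul_one] at key
  exact key

end core

/-! ### Asymptotics of outgoing solutions outside `[a, b]` -/

/-- The filter of spectral parameters tending to infinity in the logarithmic region. -/
def logFilter (M : ℝ) : Filter ℂ := Bornology.cobounded ℂ ⊓ 𝓟 (logRegion M)

theorem logFilter_le (M : ℝ) : logFilter M ≤ Bornology.cobounded ℂ := inf_le_left

theorem growth_nonneg (z : ℂ) : 0 ≤ growth z := le_max_left _ _

/-- In the logarithmic region exponentials grow at most polynomially. -/
theorem exists_exp_growth_le {M : ℝ} (hM : 0 < M) {ℓ : ℝ} (hℓ : 0 ≤ ℓ) :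
    ∃ n : ℕ, ∀ᶠ z in logFilter M, Real.exp (2 * growth z * ℓ) * ‖eps z‖ ^ n ≤ 1 := by
  obtain ⟨n, hn⟩ := exists_nat_ge (2 * M * ℓ)
  refine ⟨n, ?_⟩
  have h1 : ∀ᶠ z : ℂ in logFilter M, 1 ≤ ‖z‖ :=
    (tendsto_norm_cobounded_atTop.eventually_ge_atTop 1).filter_mono (logFilter_le M)
  have h2 : ∀ᶠ z : ℂ in logFilter M, z ∈ logRegion M :=
    mem_inf_of_right (mem_principal_self _)
  filter_upwards [h1, h2] with z hz1 hz2
  have hz2' : -z.im ≤ M * Real.log (1 + ‖z‖) := by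
    have : z.im > -M * Real.log (1 + ‖z‖) := hz2
    linarith
  have hlog : 0 ≤ Real.log (1 + ‖z‖) := Real.log_nonneg (by linarith)
  have hg : growth z ≤ M * Real.log (1 + ‖z‖) := max_le (by positivity) hz2'
  have h3 : Real.exp (2 * growth z * ℓ) ≤ (1 + ‖z‖) ^ n := by
    rw [← Real.exp_log (show (0 : ℝ) < 1 + ‖z‖ by linarith), ← Real.exp_nat_mul,
      Real.exp_le_exp]
    calc 2 * growth z * ℓ ≤ 2 * (M * Real.log (1 + ‖z‖)) * ℓ := by gcongr
      _ = 2 * M * ℓ * Real.log (1 + ‖z‖) := by ring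
      _ ≤ n * Real.log (1 + ‖z‖) := by gcongr
  calc _ ≤ (1 + ‖z‖) ^ n * ‖eps z‖ ^ n := by gcongr
    _ = ((1 + ‖z‖) / (2 * ‖z‖)) ^ n := by rw [norm_eps, ← mul_pow, mul_one_div]
    _ ≤ 1 := by
      refine pow_le_one₀ (by positivity) ?_
      rw [div_le_one (by linarith)]
      linarith

theorem theta_le {z : ℂ} {ℓ : ℝ} (hℓ : 0 ≤ ℓ) : (1 + ℓ) / (1 + 2 * growth z) ≤ 1 + ℓ :=
  div_le_self (by linarith) (by linarith [growth_nonneg z])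

theorem eventually_norm_eps_le_one : ∀ᶠ z in Bornology.cobounded ℂ, ‖eps z‖ ≤ 1 :=
  (tendsto_norm_eps.eventually (gt_mem_nhds one_pos)).mono fun _ hz => le_of_lt hz

/-- The solution equal to `e^{-i z x}` to the left of the support stays close to its approximation
throughout the region in which the potential is smooth, to any order in `1 / z`. -/
theorem outer_asymptotics {W P : ℝ → ℂ} (hW : ContDiff ℝ ∞ W) {c d : ℝ} (hcd : c ≤ d)
    {O : Set ℝ} (hO : IsOpen O) (hcO : c ∈ O) (hWO : ∀ x ∈ O, W x = 0) {S : Set ℝ}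
    {u u' : ℂ → ℝ → ℂ} (hu : ∀ z, IsSol P S z (u z) (u' z))
    (hPW : ∀ x ∈ Set.Ioo c d, P x = W x ∧ x ∉ S)
    (huc : ∀ z, u z c = Complex.exp (-(Complex.I * z * c)))
    (huc' : ∀ z, u' z c = -(Complex.I * z) * Complex.exp (-(Complex.I * z * c)))
    {M : ℝ} (hM : 0 < M) (p : ℕ) :
    ∃ K₀ : ℕ, ∀ K ≥ K₀,
      Tendsto (fun z => u z d * Complex.exp (Complex.I * z * d)) (logFilter M) (𝓝 1) ∧
      (fun z => (u' z d - qminus W K z d * u z d) / u z d) =O[logFilter M] fun z => eps z ^ p := by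
  obtain ⟨n₀, hn₀⟩ := exists_exp_growth_le hM (sub_nonneg.2 hcd)
  refine ⟨n₀ + p + 1, fun K hK => ?_⟩
  have hWK : ContDiff ℝ K W := hW.of_le (by exact_mod_cast le_top)
  obtain ⟨B, hB0, hB⟩ := exists_transport_bound hWK K (by omega) le_rfl hcd
  set l := logFilter M with hl
  have hle : l ≤ Bornology.cobounded ℂ := logFilter_le M
  have hℓ : 0 ≤ d - c := sub_nonneg.2 hcd
  have hqmc : ∀ z, qminus W K z c = -(Complex.I * z) := fun z => by
    rw [qminus, wkb_eq_zero_of_eqOn hO hWO K hcO, add_zero]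
  have hqpc : ∀ z, qplus W K z c = Complex.I * z := fun z => by
    rw [qplus, wkb_eq_zero_of_eqOn hO hWO K hcO, add_zero]
  have hXc : ∀ z, u' z c - qminus W K z c * u z c = 0 := fun z => by
    rw [hqmc, huc, huc']; ring
  set Yc : ℂ → ℂ := fun z => u' z c - qplus W K z c * u z c with hYc
  have hYc' : ∀ z, Yc z = -(2 * Complex.I * z) * Complex.exp (-(Complex.I * z * c)) := fun z => by
    simp only [hYc]
    rw [hqpc, huc, huc']; ring
  have hne : ∀ᶠ z in l, z ≠ 0 := eventually_ne_zero_cobounded.filter_mono hle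
  have hYc0 : ∀ᶠ z in l, Yc z ≠ 0 := by
    filter_upwards [hne] with z hz
    rw [hYc' z]
    exact mul_ne_zero (by simpa using hz) (Complex.exp_ne_zero _)
  set x : ℂ → ℂ := fun z => (u' z d - qminus W K z d * u z d) * eplus W K c d z / Yc z with hx
  set y : ℂ → ℂ := fun z => (u' z d - qplus W K z d * u z d) * eplus W K c d z / Yc z with hy
  have hbounds : ∀ᶠ z in l, ‖x z‖ ≤ B * 6 * (1 + (d - c)) * ‖eps z‖ ^ (p + 1) ∧
      ‖y z - 1‖ ≤ (B * (d - c) + B * (1 + (d - c)) * (12 * B * (1 + (d - c)))) * ‖eps z‖ := by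
    filter_upwards [hB.filter_mono hle, hn₀, hYc0,
      eventually_norm_eps_le_one.filter_mono hle] with z hz hzn hzY hz1
    obtain ⟨h1, h2⟩ := hz P S (u z) (u' z) (hu z) hPW (by rw [hXc, norm_zero]; exact norm_nonneg _)
    have hYpos : 0 < ‖Yc z‖ := norm_pos_iff.2 hzY
    have hθ := theta_le (z := z) hℓ
    have hθ0 : 0 ≤ (1 + (d - c)) / (1 + 2 * growth z) :=
      div_nonneg (by linarith) (by linarith [growth_nonneg z])
    set θ := (1 + (d - c)) / (1 + 2 * growth z)
    set G := Real.exp (2 * growth z * (d - c)) with hG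
    have hGpos : 0 < G := Real.exp_pos _
    have e0 := norm_nonneg (eps z)
    have hεG : ‖eps z‖ ^ (K + 1) * G ≤ ‖eps z‖ ^ (p + 1) := by
      have : ‖eps z‖ ^ (K + 1) = ‖eps z‖ ^ n₀ * ‖eps z‖ ^ (K + 1 - n₀) := by
        rw [← pow_add]; congr 1; omega
      rw [this]
      calc _ = (G * ‖eps z‖ ^ n₀) * ‖eps z‖ ^ (K + 1 - n₀) := by ring
        _ ≤ 1 * ‖eps z‖ ^ (p + 1) :=
          mul_le_mul hzn (pow_le_pow_of_le_one e0 hz1 (by omega)) (by positivity) zero_le_one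
        _ = _ := one_mul _
    have hK1 : ‖eps z‖ ^ (K + 1) ≤ ‖eps z‖ := by
      calc _ ≤ ‖eps z‖ ^ 1 := pow_le_pow_of_le_one e0 hz1 (by omega)
        _ = _ := pow_one _
    have hp1 : ‖eps z‖ ^ (p + 1) ≤ 1 := pow_le_one₀ e0 hz1
    rw [hXc, norm_zero, mul_zero, mul_zero, sub_zero, zero_add] at h1
    rw [hXc, norm_zero, mul_zero, zero_add] at h2
    change _ ≤ _ * ‖Yc z‖ + _ * (_ * ‖Yc z‖) at h2
    change _ ≤ _ * (_ * ‖Yc z‖) at h1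
    constructor
    · rw [hx, norm_div, div_le_iff₀ hYpos]
      refine h1.trans ?_
      calc B * ‖eps z‖ ^ (K + 1) * G * (6 * θ * ‖Yc z‖)
          = B * 6 * θ * (‖eps z‖ ^ (K + 1) * G) * ‖Yc z‖ := by ring
        _ ≤ B * 6 * (1 + (d - c)) * ‖eps z‖ ^ (p + 1) * ‖Yc z‖ := by gcongr
    · have : y z - 1 = ((u' z d - qplus W K z d * u z d) * eplus W K c d z - Yc z) / Yc z := by
        rw [hy, sub_div, div_self hzY]
      rw [this, norm_div, div_le_iff₀ hYpos]
      refine h2.trans ?_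
      calc B * ‖eps z‖ ^ (K + 1) * (d - c) * ‖Yc z‖ + B * ‖eps z‖ ^ (K + 1) * θ * G *
            (12 * (B * ‖eps z‖ ^ (K + 1)) * θ * ‖Yc z‖)
          = (B * (d - c) * ‖eps z‖ ^ (K + 1) + B * θ * (‖eps z‖ ^ (K + 1) * G) *
            (12 * B * θ) * ‖eps z‖ ^ (K + 1)) * ‖Yc z‖ := by ring
        _ ≤ (B * (d - c) * ‖eps z‖ + B * (1 + (d - c)) * 1 *
            (12 * B * (1 + (d - c))) * ‖eps z‖) * ‖Yc z‖ := by
            gcongr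
            exact hεG.trans hp1
        _ = _ := by ring
  have hxO : x =O[l] fun z => eps z ^ (p + 1) := by
    refine IsBigO.of_bound (B * 6 * (1 + (d - c))) ?_
    filter_upwards [hbounds] with z hz
    rw [norm_pow]
    exact hz.1
  have hε0 : Tendsto eps l (𝓝 0) := (tendsto_nhdsWithin_iff.1 tendsto_eps).1.mono_left hle
  have hx0 : Tendsto x l (𝓝 0) := by
    refine hxO.trans_tendsto ?_
    simpa using hε0.pow (p + 1)
  have hy1 : Tendsto y l (𝓝 1) := by
    rw [tendsto_iff_norm_sub_tendsto_zero]
    refine squeeze_zero' (Eventually.of_forall fun z => norm_nonneg _)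
      (hbounds.mono fun z hz => hz.2) ?_
    simpa using (tendsto_norm_eps.mono_left hle).const_mul _
  have hxy : Tendsto (fun z => x z - y z) l (𝓝 (-1)) := by simpa using hx0.sub hy1
  have hxy0 : ∀ᶠ z in l, x z - y z ≠ 0 :=
    hxy.eventually_ne (by norm_num)
  have hQ := (tendsto_qdiff hWK K (by omega) d).mono_left hle
  have hQ0 : ∀ᶠ z in l, eps z * qdiff W K z d ≠ 0 := hQ.eventually_ne one_ne_zero
  have hE := (tendsto_eplus hWK K (by omega) hcd).mono_left hle
  have hE0 : ∀ z, eplus W K c d z ≠ 0 := fun z => Complex.exp_ne_zero _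
  have hxyu : ∀ᶠ z in l, (x z - y z) * Yc z = qdiff W K z d * u z d * eplus W K c d z := by
    filter_upwards [hYc0] with z hz
    simp only [hx, hy, qdiff]
    field_simp
    ring
  constructor
  · have hlim : Tendsto (fun z => -(x z - y z) * (eps z * qdiff W K z d)⁻¹ *
        (eplus W K c d z * Complex.exp (-(Complex.I * z * (d - c))))⁻¹) l (𝓝 1) := by
      have := (hxy.neg.mul (hQ.inv₀ one_ne_zero)).mul (hE.inv₀ one_ne_zero)
      simpa using this
    refine hlim.congr' ?_
    filter_upwards [hxyu, hQ0, hne] with z h1 h2 h3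
    have hq : qdiff W K z d ≠ 0 := right_ne_zero_of_mul h2
    have hexp1 : Complex.exp (-(Complex.I * z * (d - c))) =
        Complex.exp (-(Complex.I * z * d)) * Complex.exp (Complex.I * z * c) := by
      rw [← Complex.exp_add]; ring_nf
    rw [hYc', Complex.exp_neg] at h1
    rw [hexp1, Complex.exp_neg, eps]
    have e1 := Complex.exp_ne_zero (Complex.I * z * c)
    have e2 := Complex.exp_ne_zero (Complex.I * z * d)
    have e3 := hE0 z
    have hI := Complex.I_ne_zero
    field_simp
    field_simp at h1
    linear_combination h1
  · have hlim : Tendsto (fun z => (eps z * qdiff W K z d) * (x z - y z)⁻¹) l (𝓝 (1 * (-1)⁻¹)) :=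
      hQ.mul (hxy.inv₀ (by norm_num))
    have hO : (fun z => x z * ((eps z * qdiff W K z d) * (x z - y z)⁻¹) * (eps z)⁻¹) =O[l]
        fun z => eps z ^ (p + 1) * 1 * (eps z)⁻¹ :=
      (hxO.mul (hlim.isBigO_one ℂ)).mul (isBigO_refl _ _)
    refine hO.congr' ?_ ?_
    · filter_upwards [hxyu, hQ0, hne, hYc0, hxy0] with z h1 h2 h3 h4 h5
      have hq : qdiff W K z d ≠ 0 := right_ne_zero_of_mul h2
      have hε := eps_ne_zero h3
      have hu0 : u z d ≠ 0 := by
        intro h0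
        rw [h0, mul_zero, zero_mul] at h1
        exact mul_ne_zero h5 h4 h1
      have h6 : x z * Yc z = (u' z d - qminus W K z d * u z d) * eplus W K c d z := by
        simp only [hx]
        field_simp
      have e3 := hE0 z
      have h7 : (x z - y z)⁻¹ = Yc z / (qdiff W K z d * u z d * eplus W K c d z) := by
        rw [← h1]; field_simp
      rw [h7]
      field_simp
      linear_combination h6
    · filter_upwards [hne] with z hz
      have := eps_ne_zero hz
      field_simp
      ring

/-! ### The Jost solutions and the asymptotics of their Wronskian -/

/-- The Jost solutions of a potential supported in `[-r, r]`, with their derivatives: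
`left z` is `e^{-i z x}` to the left of the support, `right z` is `e^{i z x}` to the right. -/
structure JostPair (U : ℝ → ℂ) (S : Set ℝ) (r : ℝ) where
  left : ℂ → ℝ → ℂ
  left' : ℂ → ℝ → ℂ
  right : ℂ → ℝ → ℂ
  right' : ℂ → ℝ → ℂ
  isSol_left : ∀ z, IsSol U S z (left z) (left' z)
  isSol_right : ∀ z, IsSol U S z (right z) (right' z)
  left_at : ∀ z, left z (-r) = Complex.exp (Complex.I * z * r)
  left'_at : ∀ z, left' z (-r) = -(Complex.I * z) * Complex.exp (Complex.I * z * r)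
  right_at : ∀ z, right z r = Complex.exp (Complex.I * z * r)
  right'_at : ∀ z, right' z r = Complex.I * z * Complex.exp (Complex.I * z * r)
  holomorphic_left : IsHolomorphicFamily left
  holomorphic_left' : IsHolomorphicFamily left'
  holomorphic_right : IsHolomorphicFamily right
  holomorphic_right' : IsHolomorphicFamily right'

theorem nonempty_jostPair {U : ℝ → ℂ} {S : Set ℝ} (hU : IsPotential U S) (r : ℝ) :
    Nonempty (JostPair U S r) := by
  obtain ⟨u, u', h1, h2, h3, h4, h5⟩ := exists_holomorphic_sol hU (-r)
    (p := fun z => Complex.exp (Complex.I * z * r))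
    (q := fun z => -(Complex.I * z) * Complex.exp (Complex.I * z * r)) (by fun_prop) (by fun_prop)
  obtain ⟨v, v', k1, k2, k3, k4, k5⟩ := exists_holomorphic_sol hU r
    (p := fun z => Complex.exp (Complex.I * z * r))
    (q := fun z => Complex.I * z * Complex.exp (Complex.I * z * r)) (by fun_prop) (by fun_prop)
  exact ⟨⟨u, u', v, v', h1, k1, h2, h3, k2, k3, h4, h5, k4, k5⟩⟩

/-- The Wronskian of the Jost solutions. -/
def JostPair.det {U : ℝ → ℂ} {S : Set ℝ} {r : ℝ} (J : JostPair U S r) (z : ℂ) : ℂ :=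
  J.left z r * J.right' z r - J.left' z r * J.right z r

theorem JostPair.det_eq {U : ℝ → ℂ} {S : Set ℝ} {r : ℝ} (J : JostPair U S r) (hS : S.Finite)
    (z : ℂ) (x : ℝ) : J.det z = J.left z x * J.right' z x - J.left' z x * J.right z x :=
  (J.isSol_left z).wronskian_const (J.isSol_right z) hS r x

theorem JostPair.differentiable_det {U : ℝ → ℂ} {S : Set ℝ} {r : ℝ} (J : JostPair U S r) :
    Differentiable ℂ J.det :=
  ((J.holomorphic_left.differentiable r).mul (J.holomorphic_right'.differentiable r)).sub
    ((J.holomorphic_left'.differentiable r).mul (J.holomorphic_right.differentiable r))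

/-- The potential `V 1_{[a, b]} + W`. -/
def jumpPotential (a b : ℝ) (V W : ℝ → ℂ) : ℝ → ℂ := (Set.Icc a b).indicator V + W

/-- `V` is smooth with first nonvanishing derivatives of order `j` at `a` and `k` at `b`, and `W`
is a smooth perturbation supported inside `(-r, r)`. -/
structure IsJumpData (j k N : ℕ) (a b r : ℝ) (C₁ C₂ : ℂ) (V W : ℝ → ℂ) : Prop where
  lt : a < b
  left_lt : -r < a
  lt_right : b < r
  lt_order : j < N
  lt_order' : k < N
  smooth : ContDiff ℝ N V
  flat_left : ∀ i < j, iteratedDeriv i V a = 0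
  jump_left : iteratedDeriv j V a = j.factorial * C₁
  flat_right : ∀ i < k, iteratedDeriv i V b = 0
  jump_right : iteratedDeriv k V b = k.factorial * ((-1) ^ k * C₂)
  left_ne : C₁ ≠ 0
  right_ne : C₂ ≠ 0
  smooth' : ContDiff ℝ ∞ W
  support' : ∀ x, r - 1 < |x| → W x = 0

/-- The exponential `C e^{2 i z (b - a)} (i z)^{-p}` that governs the resonances. -/
def oscillation (C : ℂ) (L : ℝ) (p : ℕ) (z : ℂ) : ℂ :=
  C * Complex.exp (2 * Complex.I * z * L) / (Complex.I * z) ^ p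

theorem oscillation_eq (C : ℂ) (L : ℝ) (p : ℕ) (z : ℂ) :
    oscillation C L p z = C * 2 ^ p * (eps z ^ p * Complex.exp (2 * Complex.I * z * L)) := by
  have : (2 : ℂ) ^ p * eps z ^ p = ((Complex.I * z) ^ p)⁻¹ := by
    rw [← mul_pow, ← inv_pow, eps]
    congr 1
    rw [mul_one_div, mul_assoc, div_mul_eq_div_div, div_self two_ne_zero, one_div]
  rw [oscillation, div_eq_mul_inv, ← this]
  ring

theorem norm_oscillation (C : ℂ) (L : ℝ) (p : ℕ) (z : ℂ) :
    ‖oscillation C L p z‖ = ‖C‖ * 2 ^ p * (‖eps z‖ ^ p * Real.exp (2 * (-z.im) * L)) := by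
  rw [oscillation_eq]
  simp [Complex.norm_exp]

theorem exp_growth_mul_le {C : ℂ} (hC : C ≠ 0) (L : ℝ) (p : ℕ) {z : ℂ} (hz : ‖eps z‖ ≤ 1) :
    Real.exp (2 * growth z * L) * ‖eps z‖ ^ p ≤
      (1 + 1 / (‖C‖ * 2 ^ p)) * (1 + ‖oscillation C L p z‖) := by
  have hC' : 0 < ‖C‖ * 2 ^ p := mul_pos (norm_pos_iff.2 hC) (by positivity)
  have h0 : 0 ≤ 1 / (‖C‖ * 2 ^ p) := by positivity
  have h1 := norm_nonneg (oscillation C L p z)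
  rcases le_total z.im 0 with h | h
  · have hg : growth z = -z.im := max_eq_right (by linarith)
    have h2 : Real.exp (2 * growth z * L) * ‖eps z‖ ^ p =
        1 / (‖C‖ * 2 ^ p) * ‖oscillation C L p z‖ := by
      rw [norm_oscillation, hg]; field_simp
    rw [h2]
    nlinarith
  · have hg : growth z = 0 := max_eq_left (by linarith)
    rw [hg]
    have : ‖eps z‖ ^ p ≤ 1 := pow_le_one₀ (norm_nonneg _) hz
    simp only [mul_zero, zero_mul, Real.exp_zero, one_mul]
    nlinarith

/-- The error terms of the transport estimate are negligible. -/
theorem isLittleO_error {C : ℂ} (hC : C ≠ 0) {L : ℝ} (hL : 0 ≤ L) {p : ℕ} (hp : p ≠ 0) :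
    (fun z => Real.exp (2 * growth z * L) * ‖eps z‖ ^ p *
      ((1 + L) / (1 + 2 * growth z) + ‖eps z‖)) =o[Bornology.cobounded ℂ]
      fun z => 1 + ‖oscillation C L p z‖ := by
  set c := 1 + 1 / (‖C‖ * 2 ^ p) with hc
  have hc0 : 0 < c := by positivity
  rw [isLittleO_iff]
  intro δ hδ
  obtain ⟨τ₀, hτ₀0, hτ₀⟩ : ∃ τ₀ : ℝ, 0 ≤ τ₀ ∧ c * ((1 + L) / (1 + 2 * τ₀)) ≤ δ / 2 := by
    refine ⟨c * (1 + L) / δ, by positivity, ?_⟩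
    have : 0 < c * (1 + L) := by positivity
    rw [mul_div_assoc', div_le_div_iff₀ (by positivity) two_pos]
    have h : δ * (1 + 2 * (c * (1 + L) / δ)) = δ + 2 * (c * (1 + L)) := by field_simp
    rw [h]
    linarith
  have e1 : ∀ᶠ z in Bornology.cobounded ℂ, c * ‖eps z‖ ≤ δ / 2 := by
    have := tendsto_norm_eps.const_mul c
    rw [mul_zero] at this
    exact (this.eventually (gt_mem_nhds (half_pos hδ))).mono fun _ h => le_of_lt h
  have e2 : ∀ᶠ z in Bornology.cobounded ℂ,
      Real.exp (2 * τ₀ * L) * (1 + L) * ‖eps z‖ ^ p ≤ δ / 2 := by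
    have := (tendsto_norm_eps.pow p).const_mul (Real.exp (2 * τ₀ * L) * (1 + L))
    rw [zero_pow hp, mul_zero] at this
    exact (this.eventually (gt_mem_nhds (half_pos hδ))).mono fun _ h => le_of_lt h
  filter_upwards [e1, e2, eventually_norm_eps_le_one] with z h1 h2 h3
  have hg := exp_growth_mul_le hC L p h3
  rw [← hc] at hg
  have hE := norm_nonneg (oscillation C L p z)
  set g := 1 + ‖oscillation C L p z‖ with hgdef
  have hg1 : 1 ≤ g := by linarith
  have hθ := theta_le (z := z) hL
  have hτ := growth_nonneg z
  have hθ0 : 0 ≤ (1 + L) / (1 + 2 * growth z) := by positivity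
  set G := Real.exp (2 * growth z * L) with hG
  have hG0 : 0 < G := Real.exp_pos _
  have hGε : 0 ≤ G * ‖eps z‖ ^ p := by positivity
  have hthird : 0 ≤ G * ‖eps z‖ ^ p * ((1 + L) / (1 + 2 * growth z) + ‖eps z‖) := by positivity
  rw [Real.norm_of_nonneg hthird, Real.norm_of_nonneg (by linarith), mul_add]
  have a1 : G * ‖eps z‖ ^ p * ‖eps z‖ ≤ δ / 2 * g := by
    calc _ ≤ c * g * ‖eps z‖ := by gcongr
      _ = c * ‖eps z‖ * g := by ring
      _ ≤ _ := by gcongr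
  have a2 : G * ‖eps z‖ ^ p * ((1 + L) / (1 + 2 * growth z)) ≤ δ / 2 * g := by
    rcases le_total τ₀ (growth z) with h | h
    · have : (1 + L) / (1 + 2 * growth z) ≤ (1 + L) / (1 + 2 * τ₀) := by gcongr
      calc _ ≤ c * g * ((1 + L) / (1 + 2 * τ₀)) := by gcongr
        _ = c * ((1 + L) / (1 + 2 * τ₀)) * g := by ring
        _ ≤ _ := by gcongr
    · have hG' : G ≤ Real.exp (2 * τ₀ * L) := Real.exp_le_exp.2 (by gcongr)
      calc _ ≤ Real.exp (2 * τ₀ * L) * ‖eps z‖ ^ p * (1 + L) := by gcongr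
        _ = Real.exp (2 * τ₀ * L) * (1 + L) * ‖eps z‖ ^ p := by ring
        _ ≤ δ / 2 := h2
        _ ≤ _ := by nlinarith
  linarith

theorem tendsto_neg_eps : Tendsto (fun z => -eps z) (Bornology.cobounded ℂ) (𝓝[≠] 0) := by
  rw [tendsto_nhdsWithin_iff] at *
  obtain ⟨h1, h2⟩ := tendsto_nhdsWithin_iff.1 tendsto_eps
  refine ⟨by simpa using h1.neg, h2.mono fun z hz => ?_⟩
  simpa using hz

/-- A remainder of order `ε ^ (n + 2)` is negligible with respect to `ε ^ (n + 1)`. -/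
theorem tendsto_div_eps_pow {f : ℂ → ℂ} {l : Filter ℂ} (hl : l ≤ Bornology.cobounded ℂ) {n : ℕ}
    (hf : f =O[l] fun z => eps z ^ (n + 2)) :
    Tendsto (fun z => f z / eps z ^ (n + 1)) l (𝓝 0) := by
  have h1 : (fun z => f z / eps z ^ (n + 1)) =O[l] fun z => eps z := by
    have := hf.mul (isBigO_refl (fun z => (eps z ^ (n + 1))⁻¹) l)
    refine this.congr' (Eventually.of_forall fun z => (div_eq_mul_inv _ _).symm) ?_
    filter_upwards [eventually_ne_zero_cobounded.filter_mono hl] with z hz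
    have := eps_ne_zero hz
    field_simp
    ring
  exact h1.trans_tendsto ((tendsto_nhdsWithin_iff.1 tendsto_eps).1.mono_left hl)

section det
variable {j k N : ℕ} {a b r : ℝ} {C₁ C₂ : ℂ} {V W : ℝ → ℂ}

/-- The asymptotics of the Jost solutions at the end points, in terms of the approximate
solutions on `[a, b]`. -/
theorem IsJumpData.end_asymptotics (h : IsJumpData j k N a b r C₁ C₂ V W)
    (J : JostPair (jumpPotential a b V W) {a, b} r) {M : ℝ} (hM : 0 < M) :
    Tendsto (fun z => J.left z a * Complex.exp (Complex.I * z * a)) (logFilter M) (𝓝 1) ∧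
    Tendsto (fun z => J.right z b * Complex.exp (-(Complex.I * z * b))) (logFilter M) (𝓝 1) ∧
    Tendsto (fun z => (J.left' z a - qminus (V + W) N z a * J.left z a) / J.left z a /
      eps z ^ (j + 1)) (logFilter M) (𝓝 (j.factorial * C₁)) ∧
    Tendsto (fun z => (J.right' z b - qplus (V + W) N z b * J.right z b) / J.right z b /
      eps z ^ (k + 1)) (logFilter M) (𝓝 (-(k.factorial * C₂))) := by
  have hl := logFilter_le M
  have hW := h.smooth'
  have hle1 : -r ≤ a := h.left_lt.le
  have hle2 : -r ≤ -b := by linarith [h.lt_right]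
  have hO : IsOpen {x : ℝ | r - 1 < |x|} := isOpen_lt continuous_const continuous_abs
  have hrO : -r ∈ {x : ℝ | r - 1 < |x|} := by
    have : r ≤ |r| := le_abs_self r
    simp only [Set.mem_ofPred_eq, abs_neg]
    linarith
  obtain ⟨K₁, hK₁⟩ := outer_asymptotics (P := jumpPotential a b V W) (S := {a, b}) hW hle1 hO hrO
    (fun x hx => h.support' x hx)
    J.isSol_left (fun x hx => by
      have hx1 : x ∉ Set.Icc a b := fun h' => absurd h'.1 (not_le.2 hx.2)
      refine ⟨by simp [jumpPotential, hx1], ?_⟩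
      rintro (rfl | hxb)
      · exact lt_irrefl _ hx.2
      · rw [Set.mem_singleton_iff] at hxb
        have := h.lt
        linarith [hx.2])
    (fun z => by rw [J.left_at]; push_cast; ring_nf)
    (fun z => by rw [J.left'_at]; push_cast; ring_nf) hM (j + 2)
  have hWn : ContDiff ℝ ∞ fun x => W (-x) := hW.comp contDiff_neg
  obtain ⟨K₂, hK₂⟩ := outer_asymptotics (P := fun x => jumpPotential a b V W (-x))
    (S := Neg.neg ⁻¹' {a, b}) hWn hle2 hO hrO
    (fun x hx => h.support' (-x) (by simpa using hx))
    (fun z => (J.isSol_right z).comp_neg) (fun x hx => by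
      have hxb : b < -x := by linarith [hx.2]
      have hx1 : -x ∉ Set.Icc a b := fun h' => absurd h'.2 (not_le.2 hxb)
      refine ⟨by simp [jumpPotential, hx1], ?_⟩
      rintro (hxa | hxb')
      · have := h.lt
        rw [hxa] at hxb
        linarith
      · rw [Set.mem_singleton_iff] at hxb'
        linarith)
    (fun z => by rw [neg_neg, J.right_at]; push_cast; ring_nf)
    (fun z => by rw [neg_neg, J.right'_at]; push_cast; ring_nf) hM (k + 2)
  obtain ⟨a1, a2⟩ := hK₁ (max (max K₁ K₂) N) (by omega)
  obtain ⟨b1, b2⟩ := hK₂ (max (max K₁ K₂) N) (by omega)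
  set K := max (max K₁ K₂) N with hK
  have hWK : ContDiff ℝ K W := hW.of_le (by exact_mod_cast le_top)
  have hNK : N ≤ K := le_max_right _ _
  have hu0 : ∀ᶠ z in logFilter M, J.left z a ≠ 0 :=
    (a1.eventually_ne one_ne_zero).mono fun z hz => left_ne_zero_of_mul hz
  have hv0 : ∀ᶠ z in logFilter M, J.right z b ≠ 0 :=
    (b1.eventually_ne one_ne_zero).mono fun z hz => by
      have := left_ne_zero_of_mul hz
      rwa [neg_neg] at this
  have hz0 : ∀ᶠ z in logFilter M, z ≠ 0 := eventually_ne_zero_cobounded.filter_mono hl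
  refine ⟨a1, ?_, ?_, ?_⟩
  · refine b1.congr fun z => ?_
    rw [neg_neg]
    push_cast
    ring_nf
  · have t1 := tendsto_div_eps_pow hl a2
    have t2 := ((tendsto_wkb_jump h.smooth hWK h.lt_order hNK h.flat_left).comp
      tendsto_neg_eps).mono_left hl
    rw [h.jump_left] at t2
    have t3 := t1.sub (t2.mul_const ((-1) ^ (j + 1)))
    have e : (0 : ℂ) - (-1) ^ j * (j.factorial * C₁) * (-1) ^ (j + 1) = j.factorial * C₁ := by
      have : ((-1 : ℂ) ^ j) * (-1) ^ (j + 1) = -1 := by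
        rw [← pow_add, show j + (j + 1) = 2 * j + 1 by ring, pow_succ, pow_mul]
        norm_num
      linear_combination -(j.factorial * C₁) * this
    rw [e] at t3
    refine t3.congr' ?_
    filter_upwards [hu0, hz0] with z h1 h2
    have hε := eps_ne_zero h2
    simp only [Function.comp_apply, qminus, neg_pow (eps z) (j + 1)]
    have hm : ((-1 : ℂ) ^ (j + 1)) * (-1) ^ (j + 1) = 1 := by
      rw [← mul_pow]; norm_num
    have hm0 : ((-1 : ℂ) ^ (j + 1)) ≠ 0 := pow_ne_zero _ (by norm_num)
    field_simp
    ring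
  · have t1 := tendsto_div_eps_pow hl b2
    have t2 := ((tendsto_wkb_jump h.smooth hWK h.lt_order' hNK h.flat_right).comp
      tendsto_eps).mono_left hl
    rw [h.jump_right] at t2
    have t3 := t1.neg.sub t2
    have e : -(0 : ℂ) - (-1) ^ k * (k.factorial * ((-1) ^ k * C₂)) = -(k.factorial * C₂) := by
      have : ((-1 : ℂ) ^ k) * (-1) ^ k = 1 := by
        rw [← mul_pow]; norm_num
      linear_combination -(k.factorial * C₂) * this
    rw [e] at t3
    refine t3.congr' ?_
    filter_upwards [hv0, hz0] with z h1 h2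
    have hε := eps_ne_zero h2
    simp only [Function.comp_apply, qminus, qplus, neg_neg, wkb_comp_neg]
    field_simp
    ring

end det

section det
variable {j k N : ℕ} {a b r : ℝ} {C₁ C₂ C : ℂ} {V W : ℝ → ℂ}

/-- Combination of the reflections at the two ends: `t₁`, `t₂` are the errors of the transport
across `[a, b]`, `ρ` and `β` the reflection coefficients at `a` and `b`, and `F` the phase. -/
theorem reflection_asymptotics {l : Filter ℂ} (hl : l ≤ Bornology.cobounded ℂ) {L B : ℝ}
    (hL : 0 ≤ L) (hB : 0 ≤ B) {c₁ c₂ : ℂ} (hC : c₁ * c₂ = C * 2 ^ (j + k + 4)) (hC0 : C ≠ 0)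
    (hjN : j < N) (hkN : k < N) {t₁ t₂ ρ β F : ℂ → ℂ}
    (hρ : Tendsto (fun z => ρ z / eps z ^ (j + 2)) l (𝓝 (-c₁)))
    (hβ : Tendsto (fun z => β z / eps z ^ (k + 2)) l (𝓝 (-c₂)))
    (hF : Tendsto (fun z => F z * Complex.exp (-(2 * Complex.I * z * L))) l (𝓝 1))
    (ht₁ : ∀ᶠ z in l, ‖t₁ z‖ ≤ B * ‖eps z‖ ^ (N + 1) * L + B * ‖eps z‖ ^ (N + 1) *
      ((1 + L) / (1 + 2 * growth z)) * Real.exp (2 * growth z * L) * (3 * ‖ρ z‖ + 12 *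
        (B * ‖eps z‖ ^ (N + 1)) * ((1 + L) / (1 + 2 * growth z))))
    (ht₂ : ∀ᶠ z in l, ‖t₂ z‖ ≤ B * ‖eps z‖ ^ (N + 1) * Real.exp (2 * growth z * L) *
      (6 * L * ‖ρ z‖ + 6 * ((1 + L) / (1 + 2 * growth z)))) :
    (fun z => (1 + t₁ z) * (1 + β z) - β z * (F z * ρ z + t₂ z) -
      (1 - oscillation C L (j + k + 4) z)) =o[l] fun z => 1 + ‖oscillation C L (j + k + 4) z‖ := by
  set p := j + k + 4 with hp
  set g : ℂ → ℝ := fun z => 1 + ‖oscillation C L p z‖ with hg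
  set H : ℂ → ℝ := fun z => Real.exp (2 * growth z * L) * ‖eps z‖ ^ p *
      ((1 + L) / (1 + 2 * growth z) + ‖eps z‖) with hH
  have hHo : H =o[l] g := (isLittleO_error hC0 hL (by omega)).mono hl
  have hone : (fun _ : ℂ => (1 : ℝ)) =O[l] g := by
    refine isBigO_of_le _ fun z => ?_
    have := norm_nonneg (oscillation C L p z)
    rw [norm_one, Real.norm_of_nonneg (by positivity)]
    linarith
  have hne : ∀ᶠ z in l, z ≠ 0 := eventually_ne_zero_cobounded.filter_mono hl
  have hε1 : ∀ᶠ z in l, ‖eps z‖ ≤ 1 := eventually_norm_eps_le_one.filter_mono hl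
  have hε0 : Tendsto eps l (𝓝 0) := (tendsto_nhdsWithin_iff.1 tendsto_eps).1.mono_left hl
  have hεo : (fun z => ‖eps z‖) =o[l] g :=
    ((isLittleO_one_iff ℝ).2 (tendsto_norm_eps.mono_left hl)).trans_isBigO hone
  have hbd : ∀ {f : ℂ → ℂ} {n : ℕ} {c : ℂ}, Tendsto (fun z => f z / eps z ^ n) l (𝓝 c) →
      ∀ᶠ z in l, ‖f z‖ ≤ (‖c‖ + 1) * ‖eps z‖ ^ n := by
    intro f n c hf
    filter_upwards [hf.norm.eventually (gt_mem_nhds (lt_add_one ‖c‖)), hne] with z h1 h2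
    rw [norm_div, norm_pow, div_lt_iff₀ (pow_pos (norm_pos_iff.2 (eps_ne_zero h2)) _)] at h1
    exact h1.le
  have bρ := hbd hρ
  have bβ := hbd hβ
  rw [norm_neg] at bρ bβ
  set A₁ := ‖c₁‖ + 1 with hA₁
  set A₂ := ‖c₂‖ + 1 with hA₂
  have hA₁0 : 0 ≤ A₁ := by positivity
  have hA₂0 : 0 ≤ A₂ := by positivity
  have hθ0 : ∀ z, 0 ≤ (1 + L) / (1 + 2 * growth z) := fun z =>
    div_nonneg (by linarith) (by linarith [growth_nonneg z])
  -- the error of the transmitted wave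
  have o1 : t₁ =o[l] g := by
    have hO : t₁ =O[l] fun z => B * L * ‖eps z‖ + B * (3 * A₁ + 12 * B * (1 + L)) * H z := by
      refine IsBigO.of_bound 1 ?_
      filter_upwards [ht₁, bρ, hε1] with z h1 h2 h3
      have e0 := norm_nonneg (eps z)
      have hθ := hθ0 z
      have hθ' := theta_le (z := z) hL
      rw [one_mul]
      refine h1.trans (le_trans ?_ (le_abs_self _))
      simp only [hH]
      set θ := (1 + L) / (1 + 2 * growth z)
      set G := Real.exp (2 * growth z * L)
      have hG : 0 < G := Real.exp_pos _
      have q1 : ‖eps z‖ ^ (N + 1) ≤ ‖eps z‖ := by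
        simpa using pow_le_pow_of_le_one e0 h3 (show 1 ≤ N + 1 by omega)
      have q2 : ‖eps z‖ ^ (N + 1) ≤ ‖eps z‖ ^ (j + 2) := pow_le_pow_of_le_one e0 h3 (by omega)
      have q3 : ‖eps z‖ ^ (N + 1) ≤ ‖eps z‖ ^ (k + 2) := pow_le_pow_of_le_one e0 h3 (by omega)
      calc _ ≤ B * ‖eps z‖ * L + B * ‖eps z‖ ^ (k + 2) * θ * G *
            (3 * (A₁ * ‖eps z‖ ^ (j + 2)) + 12 * (B * ‖eps z‖ ^ (j + 2)) * (1 + L)) := by gcongr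
        _ = B * L * ‖eps z‖ + B * (3 * A₁ + 12 * B * (1 + L)) * (G * ‖eps z‖ ^ p * θ) := by
            rw [hp, show j + k + 4 = (k + 2) + (j + 2) by ring, pow_add]; ring
        _ ≤ _ := by
            gcongr
            linarith
    exact hO.trans_isLittleO ((hεo.const_mul_left _).add (hHo.const_mul_left _))
  have hβ0 : Tendsto β l (𝓝 0) := by
    refine squeeze_zero_norm' bβ ?_
    simpa using ((tendsto_norm_eps.mono_left hl).pow (k + 2)).const_mul A₂
  have o2 : β =o[l] g := ((isLittleO_one_iff ℝ).2 hβ0).trans_isBigO hone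
  have o3 : (fun z => t₁ z * β z) =o[l] g := by
    have := o1.mul_isBigO (hβ0.isBigO_one ℝ)
    simpa using this
  -- the error of the twice reflected wave
  have o4 : (fun z => β z * t₂ z) =o[l] g := by
    have hO : (fun z => β z * t₂ z) =O[l] fun z => A₂ * B * 6 * (L * A₁ + 1) * H z := by
      refine IsBigO.of_bound 1 ?_
      filter_upwards [ht₂, bρ, bβ, hε1] with z h1 h2 h4 h3
      have e0 := norm_nonneg (eps z)
      have hθ := hθ0 z
      rw [one_mul, norm_mul]
      refine le_trans ?_ (le_abs_self _)
      simp only [hH]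
      set θ := (1 + L) / (1 + 2 * growth z)
      set G := Real.exp (2 * growth z * L)
      have hG : 0 < G := Real.exp_pos _
      have q2 : ‖eps z‖ ^ (N + 1) ≤ ‖eps z‖ ^ (j + 2) := pow_le_pow_of_le_one e0 h3 (by omega)
      have q4 : ‖eps z‖ ^ (j + 2) ≤ ‖eps z‖ := by
        simpa using pow_le_pow_of_le_one e0 h3 (show 1 ≤ j + 2 by omega)
      have q5 : 6 * L * ‖ρ z‖ + 6 * θ ≤ 6 * (L * A₁ + 1) * (θ + ‖eps z‖) := by
        have : L * ‖ρ z‖ ≤ L * (A₁ * ‖eps z‖) := by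
          gcongr
          exact h2.trans (by gcongr)
        have hn : 0 ≤ L * A₁ * θ := by positivity
        nlinarith
      have hq : 0 ≤ 6 * L * ‖ρ z‖ + 6 * θ := by positivity
      calc _ ≤ (A₂ * ‖eps z‖ ^ (k + 2)) * (B * ‖eps z‖ ^ (j + 2) * G *
            (6 * (L * A₁ + 1) * (θ + ‖eps z‖))) := by
            gcongr
            exact h1.trans (by gcongr)
        _ = _ := by
            rw [hp, show j + k + 4 = (k + 2) + (j + 2) by ring, pow_add]; ring
    exact hO.trans_isLittleO (hHo.const_mul_left _)
  have o5 : (fun z => β z * F z * ρ z - oscillation C L p z) =o[l] g := by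
    have h1 : Tendsto (fun z => (ρ z / eps z ^ (j + 2)) * (β z / eps z ^ (k + 2)) *
        (F z * Complex.exp (-(2 * Complex.I * z * L))) / (C * 2 ^ p) - 1) l (𝓝 0) := by
      have := (((hρ.mul hβ).mul hF).div_const (C * 2 ^ p)).sub_const 1
      rwa [neg_mul_neg, hC, mul_one, div_self (mul_ne_zero hC0 (pow_ne_zero _ two_ne_zero)),
        sub_self] at this
    have h2 : (fun z => oscillation C L p z) =O[l] g := by
      refine isBigO_of_le _ fun z => ?_
      simp only [hg]
      rw [Real.norm_of_nonneg (by positivity)]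
      linarith
    have h3 := ((isLittleO_one_iff ℝ).2 h1).mul_isBigO h2
    simp only [one_mul] at h3
    refine h3.congr' ?_ EventuallyEq.rfl
    filter_upwards [hne] with z hz
    have hε := eps_ne_zero hz
    rw [oscillation_eq, Complex.exp_neg]
    have e2 := Complex.exp_ne_zero (2 * Complex.I * z * L)
    rw [hp, show j + k + 4 = (k + 2) + (j + 2) by ring, pow_add (eps z)]
    field_simp
    ring
  refine ((((o1.add o2).add o3).sub o4).sub o5).congr_left fun z => ?_
  ring

/-- The Wronskian of the Jost solutions, divided by its free value `2 i z`, is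
`1 - C e^{2 i z (b - a)} (i z)^{-(j + k + 4)}` to leading order in the logarithmic region. -/
theorem IsJumpData.det_asymptotics (h : IsJumpData j k N a b r C₁ C₂ V W)
    (J : JostPair (jumpPotential a b V W) {a, b} r) {M : ℝ} (hM : 0 < M)
    (hC : C = (j.factorial : ℂ) * k.factorial * C₁ * C₂ / 2 ^ (j + k + 4)) :
    (fun z => J.det z / (2 * Complex.I * z) - (1 - oscillation C (b - a) (j + k + 4) z))
      =o[logFilter M] fun z => 1 + ‖oscillation C (b - a) (j + k + 4) z‖ := by
  obtain ⟨e1, e2, e3, e4⟩ := h.end_asymptotics J hM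
  set l := logFilter M with hldef
  have hl : l ≤ Bornology.cobounded ℂ := logFilter_le M
  have hab := h.lt
  have hC0 : C ≠ 0 := by
    rw [hC]
    have f1 : (j.factorial : ℂ) ≠ 0 := by exact_mod_cast j.factorial_ne_zero
    have f2 : (k.factorial : ℂ) ≠ 0 := by exact_mod_cast k.factorial_ne_zero
    exact div_ne_zero (mul_ne_zero (mul_ne_zero (mul_ne_zero f1 f2) h.left_ne) h.right_ne)
      (pow_ne_zero _ two_ne_zero)
  have hVW : ContDiff ℝ N (V + W) := h.smooth.add (h.smooth'.of_le (by exact_mod_cast le_top))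
  have hN1 : 1 ≤ N := by have := h.lt_order; omega
  obtain ⟨B, hB0, hB⟩ := exists_transport_bound hVW N hN1 le_rfl hab.le
  have hne : ∀ᶠ z in l, z ≠ 0 := eventually_ne_zero_cobounded.filter_mono hl
  have hε0 : Tendsto eps l (𝓝 0) := (tendsto_nhdsWithin_iff.1 tendsto_eps).1.mono_left hl
  have hua0 : ∀ᶠ z in l, J.left z a ≠ 0 :=
    (e1.eventually_ne one_ne_zero).mono fun z hz => left_ne_zero_of_mul hz
  have hvb0 : ∀ᶠ z in l, J.right z b ≠ 0 :=
    (e2.eventually_ne one_ne_zero).mono fun z hz => left_ne_zero_of_mul hz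
  set Q := qdiff (V + W) N with hQdef
  have hQa := (tendsto_qdiff hVW N (by omega) a).mono_left hl
  have hQb := (tendsto_qdiff hVW N (by omega) b).mono_left hl
  have hE := (tendsto_eplus hVW N (by omega) hab.le).mono_left hl
  have hF := (tendsto_ediff hVW N (by omega) hab.le).mono_left hl
  set E := eplus (V + W) N a b with hEdef
  set F := ediff (V + W) N a b with hFdef
  have hE0 : ∀ z, E z ≠ 0 := fun z => Complex.exp_ne_zero _
  set Xa : ℂ → ℂ := fun z => J.left' z a - qminus (V + W) N z a * J.left z a with hXa
  set Ya : ℂ → ℂ := fun z => J.left' z a - qplus (V + W) N z a * J.left z a with hYa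
  set Xb : ℂ → ℂ := fun z => J.left' z b - qminus (V + W) N z b * J.left z b with hXb
  set Yb : ℂ → ℂ := fun z => J.left' z b - qplus (V + W) N z b * J.left z b with hYb
  set ηb : ℂ → ℂ := fun z => (J.right' z b - qplus (V + W) N z b * J.right z b) / J.right z b
    with hηb
  have hYXa : ∀ z, Ya z = Xa z - Q z a * J.left z a := fun z => by
    simp only [hYa, hXa, hQdef, qdiff]; ring
  have hYXb : ∀ z, Yb z = Xb z - Q z b * J.left z b := fun z => by
    simp only [hYb, hXb, hQdef, qdiff]; ring
  -- `Y = -2 i z u` to leading order at `a`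
  have hYlim : Tendsto (fun z => eps z * (Ya z / J.left z a)) l (𝓝 (-1)) := by
    have h1 := ((hε0.pow (j + 2)).mul e3).sub hQa
    rw [zero_pow (by omega), zero_mul, zero_sub] at h1
    refine h1.congr' ?_
    filter_upwards [hua0, hne] with z h2 h3
    have hε := eps_ne_zero h3
    rw [hYXa]
    change eps z ^ (j + 2) * (Xa z / J.left z a / eps z ^ (j + 1)) - eps z * Q z a = _
    field_simp
    ring
  have hYa0 : ∀ᶠ z in l, Ya z ≠ 0 := by
    filter_upwards [hYlim.eventually_ne (by norm_num : (-1 : ℂ) ≠ 0)] with z hz h0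
    rw [h0, zero_div, mul_zero] at hz
    exact hz rfl
  have hρ : Tendsto (fun z => Xa z / Ya z / eps z ^ (j + 2)) l (𝓝 (-(j.factorial * C₁))) := by
    have h1 := e3.div hYlim (by norm_num)
    rw [div_neg, div_one] at h1
    refine h1.congr' ?_
    filter_upwards [hua0, hne, hYa0] with z h2 h3 h4
    have hε := eps_ne_zero h3
    change Xa z / J.left z a / eps z ^ (j + 1) / (eps z * (Ya z / J.left z a)) = _
    field_simp
    ring
  have hβ : Tendsto (fun z => ηb z / Q z b / eps z ^ (k + 2)) l (𝓝 (-(k.factorial * C₂))) := by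
    have h1 := e4.div hQb one_ne_zero
    rw [div_one] at h1
    refine h1.congr' ?_
    filter_upwards [hne, hQb.eventually_ne one_ne_zero] with z h3 h5
    have hε := eps_ne_zero h3
    have hQ : Q z b ≠ 0 := right_ne_zero_of_mul h5
    change ηb z / eps z ^ (k + 1) / (eps z * Q z b) = _
    field_simp
    ring
  have hρ0 : Tendsto (fun z => Xa z / Ya z) l (𝓝 0) := by
    have h1 := (hε0.pow (j + 2)).mul hρ
    rw [zero_pow (by omega), zero_mul] at h1
    refine h1.congr' ?_
    filter_upwards [hne] with z h3
    have hε := eps_ne_zero h3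
    field_simp
  have hXYa : ∀ᶠ z in l, ‖Xa z‖ ≤ ‖Ya z‖ := by
    have h1 := hρ0.norm
    rw [norm_zero] at h1
    filter_upwards [h1.eventually (gt_mem_nhds one_pos), hYa0] with z h2 h3
    rw [norm_div, div_lt_one (norm_pos_iff.2 h3)] at h2
    exact h2.le
  have hT : ∀ᶠ z in l,
      ‖Yb z * E z / Ya z - 1‖ ≤ B * ‖eps z‖ ^ (N + 1) * (b - a) + B * ‖eps z‖ ^ (N + 1) *
        ((1 + (b - a)) / (1 + 2 * growth z)) * Real.exp (2 * growth z * (b - a)) *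
          (3 * ‖Xa z / Ya z‖ + 12 * (B * ‖eps z‖ ^ (N + 1)) *
            ((1 + (b - a)) / (1 + 2 * growth z))) ∧
      ‖Xb z * E z / Ya z - F z * (Xa z / Ya z)‖ ≤ B * ‖eps z‖ ^ (N + 1) *
        Real.exp (2 * growth z * (b - a)) * (6 * (b - a) * ‖Xa z / Ya z‖ +
          6 * ((1 + (b - a)) / (1 + 2 * growth z))) := by
    filter_upwards [hB.filter_mono hl, hXYa, hYa0] with z h1 h2 h3
    obtain ⟨k1, k2⟩ := h1 (jumpPotential a b V W) {a, b} (J.left z) (J.left' z) (J.isSol_left z)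
      (fun x hx => by
        have hx1 : x ∈ Set.Icc a b := ⟨hx.1.le, hx.2.le⟩
        refine ⟨by simp [jumpPotential, hx1], ?_⟩
        rintro (hxa | hxb)
        · exact hx.1.ne' hxa
        · exact hx.2.ne hxb) h2
    have hpos : 0 < ‖Ya z‖ := norm_pos_iff.2 h3
    change ‖Xb z * E z - F z * Xa z‖ ≤ _ * (6 * (b - a) * ‖Xa z‖ + _ * ‖Ya z‖) at k1
    change ‖Yb z * E z - Ya z‖ ≤ _ * ‖Ya z‖ + _ * (3 * ‖Xa z‖ + _ * ‖Ya z‖) at k2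
    constructor
    · have : Yb z * E z / Ya z - 1 = (Yb z * E z - Ya z) / Ya z := by field_simp
      rw [this, norm_div, norm_div, div_le_iff₀ hpos]
      refine k2.trans (le_of_eq ?_)
      field_simp
    · have : Xb z * E z / Ya z - F z * (Xa z / Ya z) = (Xb z * E z - F z * Xa z) / Ya z := by
        field_simp
      rw [this, norm_div, norm_div, div_le_iff₀ hpos]
      refine k1.trans (le_of_eq ?_)
      field_simp
  have hF' : Tendsto (fun z => F z * Complex.exp (-(2 * Complex.I * z * ((b - a : ℝ) : ℂ)))) l
      (𝓝 1) := by
    refine hF.congr fun z => ?_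
    push_cast
    ring_nf
  have key := reflection_asymptotics (C := C) (j := j) (k := k) (N := N) hl (L := b - a)
    (sub_nonneg.2 hab.le) hB0 (c₁ := j.factorial * C₁) (c₂ := k.factorial * C₂)
    (by rw [hC]; field_simp) hC0 h.lt_order h.lt_order' hρ hβ hF'
    (hT.mono fun z hz => hz.1) (hT.mono fun z hz => hz.2)
  set osc := oscillation C (b - a) (j + k + 4) with hosc
  -- the remaining factor tends to `1`
  have hm : Tendsto (fun z => -(eps z * (Ya z / J.left z a)) *
      (J.left z a * Complex.exp (Complex.I * z * a)) *
      (J.right z b * Complex.exp (-(Complex.I * z * b))) *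
      (E z * Complex.exp (-(Complex.I * z * (b - a))))⁻¹ - 1) l (𝓝 0) := by
    have h1 := (((hYlim.neg.mul e1).mul e2).mul (hE.inv₀ one_ne_zero)).sub_const 1
    simpa using h1
  set hh : ℂ → ℂ := fun z => (1 + (Yb z * E z / Ya z - 1)) * (1 + ηb z / Q z b) -
    ηb z / Q z b * (F z * (Xa z / Ya z) + (Xb z * E z / Ya z - F z * (Xa z / Ya z))) with hhh
  have hhO : hh =O[l] fun z => 1 + ‖osc z‖ := by
    have h1 : (fun z => 1 - osc z) =O[l] fun z => 1 + ‖osc z‖ := by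
      refine isBigO_of_le _ fun z => ?_
      rw [Real.norm_of_nonneg (by positivity)]
      simpa using norm_sub_le (1 : ℂ) (osc z)
    exact (key.isBigO.add h1).congr_left fun z => by simp only [hhh]; ring
  have h5 := ((isLittleO_one_iff ℝ).2 hm).mul_isBigO hhO
  simp only [one_mul] at h5
  refine (h5.add key).congr' ?_ EventuallyEq.rfl
  filter_upwards [hua0, hvb0, hne, hYa0, hQb.eventually_ne one_ne_zero] with z z1 z2 z3 z4 z5
  have hε := eps_ne_zero z3
  have hQ : Q z b ≠ 0 := right_ne_zero_of_mul z5
  have hdet := J.det_eq (Set.toFinite _) z b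
  have hηb' : J.right' z b = (qplus (V + W) N z b + ηb z) * J.right z b := by
    simp only [hηb]
    field_simp
    ring
  have hub : J.left z b = (Xb z - Yb z) / Q z b := by
    rw [hYXb]
    field_simp
    ring
  have hub' : J.left' z b = Yb z + qplus (V + W) N z b * J.left z b := by
    simp only [hYb]; ring
  have hdet2 : J.det z = J.right z b * (-Yb z + ηb z * ((Xb z - Yb z) / Q z b)) := by
    rw [hdet, hub', hηb', ← hub]
    ring
  have hexp : Complex.exp (-(Complex.I * z * (b - a))) =
      Complex.exp (-(Complex.I * z * b)) * Complex.exp (Complex.I * z * a) := by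
    rw [← Complex.exp_add]; ring_nf
  have hE0' := hE0 z
  have x1 := Complex.exp_ne_zero (Complex.I * z * a)
  have x2 := Complex.exp_ne_zero (-(Complex.I * z * b))
  have hD : J.det z / (2 * Complex.I * z) = -(eps z * Ya z) * J.right z b / E z * hh z := by
    rw [hdet2, div_eq_mul_one_div]
    have : (1 : ℂ) / (2 * Complex.I * z) = eps z := rfl
    rw [this]
    simp only [hhh]
    field_simp
    ring
  have hfac : -(eps z * (Ya z / J.left z a)) * (J.left z a * Complex.exp (Complex.I * z * a)) *
      (J.right z b * Complex.exp (-(Complex.I * z * b))) *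
      (E z * Complex.exp (-(Complex.I * z * (b - a))))⁻¹ =
      -(eps z * Ya z) * J.right z b / E z := by
    rw [hexp]
    field_simp
  rw [hfac, hD]
  simp only [hhh]
  ring

end det

/-! ### Zeros of functions asymptotic to `1 - C e^{2 i L z} (i z)^{-p}` -/

section zeros

/-- A holomorphic function close to the identity has exactly one zero near `0`, and it is
simple. -/
theorem zero_of_near_id {Φ : ℂ → ℂ} {δ : ℝ} (hδ : 0 < δ)
    (hΦ : DifferentiableOn ℂ Φ (Metric.ball 0 (2 * δ)))
    (h : ∀ z ∈ Metric.ball (0 : ℂ) (2 * δ), ‖Φ z - z‖ ≤ δ / 4) :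
    (∃ z, ‖z‖ ≤ δ ∧ Φ z = 0) ∧
      (∀ z w, ‖z‖ ≤ δ → ‖w‖ ≤ δ → Φ z = 0 → Φ w = 0 → z = w) ∧
      ∀ z, ‖z‖ ≤ δ → deriv Φ z ≠ 0 := by
  set g : ℂ → ℂ := fun z => Φ z - z with hg
  have hgd : DifferentiableOn ℂ g (Metric.ball 0 (2 * δ)) := hΦ.sub differentiableOn_id
  have hmem : ∀ z : ℂ, ‖z‖ ≤ δ → z ∈ Metric.ball (0 : ℂ) (2 * δ) := fun z hz => by
    rw [mem_ball_zero_iff]; linarith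
  have hsub : ∀ z : ℂ, ‖z‖ ≤ δ → Metric.closedBall z (δ / 2) ⊆ Metric.ball (0 : ℂ) (2 * δ) := by
    intro z hz w hw
    rw [mem_ball_zero_iff]
    rw [mem_closedBall_iff_norm] at hw
    have := norm_add_le (w - z) z
    rw [sub_add_cancel] at this
    linarith
  have hderiv : ∀ z : ℂ, ‖z‖ ≤ δ → ‖deriv g z‖ ≤ 1 / 2 := by
    intro z hz
    have := Complex.norm_deriv_le_of_forall_mem_sphere_norm_le (c := z) (R := δ / 2) (C := δ / 4)
      (f := g) (by linarith) ((hgd.mono ((closure_mono Metric.ball_subset_closedBall).trans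
        (by rw [Metric.isClosed_closedBall.closure_eq]; exact hsub z hz))).diffContOnCl)
      fun w hw => h w (hsub z hz (Metric.sphere_subset_closedBall hw))
    refine this.trans (le_of_eq ?_)
    field_simp
    norm_num
  have hdg : ∀ z : ℂ, ‖z‖ ≤ δ → DifferentiableAt ℂ g z := fun z hz =>
    hgd.differentiableAt (Metric.isOpen_ball.mem_nhds (hmem z hz))
  have hlip : ∀ z w : ℂ, ‖z‖ ≤ δ → ‖w‖ ≤ δ → ‖g z - g w‖ ≤ 1 / 2 * ‖z - w‖ := by
    intro z w hz hw
    refine (convex_closedBall (0 : ℂ) δ).norm_image_sub_le_of_norm_deriv_le (𝕜 := ℂ)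
      (fun x hx => hdg x ?_) (fun x hx => hderiv x ?_) ?_ ?_
    · simpa using hx
    · simpa using hx
    · simpa using hw
    · simpa using hz
  refine ⟨?_, ?_, ?_⟩
  · have hmaps : Set.MapsTo (fun z => -g z) (Metric.closedBall (0 : ℂ) δ)
        (Metric.closedBall (0 : ℂ) δ) := by
      intro z hz
      rw [mem_closedBall_zero_iff] at hz ⊢
      rw [norm_neg]
      exact (h z (hmem z hz)).trans (by linarith)
    have hcontr : ContractingWith (1 / 2) (hmaps.restrict _ _ _) := by
      refine ⟨by rw [← NNReal.coe_lt_coe]; norm_num, LipschitzWith.of_dist_le_mul ?_⟩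
      rintro ⟨z, hz⟩ ⟨w, hw⟩
      rw [mem_closedBall_zero_iff] at hz hw
      rw [Subtype.dist_eq, Subtype.dist_eq, dist_eq_norm, dist_eq_norm]
      have := hlip w z hw hz
      rw [norm_sub_rev w z] at this
      simpa [neg_add_eq_sub] using this
    obtain ⟨z, hz, hfix, -⟩ := hcontr.exists_fixedPoint' Metric.isClosed_closedBall.isComplete hmaps
      (x := 0) (by simpa using hδ.le) (edist_ne_top _ _)
    refine ⟨z, by simpa using hz, ?_⟩
    have : -g z = z := hfix
    simp only [hg] at this
    linear_combination -this
  · intro z w hz hw hz0 hw0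
    have := hlip z w hz hw
    simp only [hg, hz0, hw0] at this
    rw [zero_sub, zero_sub, neg_sub_neg, norm_sub_rev] at this
    have h0 : ‖z - w‖ ≤ 0 := by linarith [norm_nonneg (z - w)]
    exact sub_eq_zero.1 (norm_le_zero_iff.1 h0)
  · intro z hz h0
    have h1 : deriv g z = deriv Φ z - 1 := by
      simp only [hg]
      have : DifferentiableAt ℂ Φ z :=
        hΦ.differentiableAt (Metric.isOpen_ball.mem_nhds (hmem z hz))
      rw [deriv_fun_sub this differentiableAt_fun_id, deriv_id'']
    have := hderiv z hz
    rw [h1, h0] at this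
    norm_num at this

/-- The points near which the zeros lie: approximate solutions of `C e^{2 i L z} = (i z)^p`, with
`s = ±1` the sign of the real part. -/
def approxZero (C : ℂ) (L : ℝ) (p : ℕ) (s : ℝ) (n : ℕ) : ℂ :=
  s * ((n * Real.pi / L : ℝ) : ℂ) + s * (p / (2 * L) * (Real.pi / 2)) +
    Complex.I * (Complex.log C / (2 * L)) -
    Complex.I * (p / (2 * L) * (Real.log (n * Real.pi / L) : ℝ))

/-- Large indices, with a bounded perturbation of the approximate zero. -/
def indexFilter : Filter (ℕ × ℂ) := atTop ×ˢ 𝓟 (Metric.closedBall 0 1)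

variable {C : ℂ} {L M s : ℝ} {p : ℕ}

theorem tendsto_index (hL : 0 < L) :
    Tendsto (fun q : ℕ × ℂ => (q.1 * Real.pi / L : ℝ)) indexFilter atTop := by
  have : Tendsto (fun n : ℕ => (n * Real.pi / L : ℝ)) atTop atTop :=
    (tendsto_natCast_atTop_atTop.atTop_mul_const Real.pi_pos).atTop_div_const hL
  exact this.comp tendsto_fst

theorem eventually_norm_snd_le : ∀ᶠ q in indexFilter, ‖q.2‖ ≤ 1 := by
  have : Tendsto (fun q : ℕ × ℂ => q.2) indexFilter (𝓟 (Metric.closedBall 0 1)) := tendsto_snd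
  simpa using tendsto_principal.1 this

theorem approxZero_sub_isLittleO (hL : 0 < L) :
    (fun q : ℕ × ℂ => approxZero C L p s q.1 + q.2 - s * ((q.1 * Real.pi / L : ℝ) : ℂ))
      =o[indexFilter] fun q => (q.1 * Real.pi / L : ℝ) := by
  have hX := tendsto_index hL
  have h0 : ∀ c : ℂ, (fun _ : ℕ × ℂ => c) =o[indexFilter] fun q => (q.1 * Real.pi / L : ℝ) :=
    fun c => isLittleO_const_left.2 (.inr (tendsto_norm_atTop_atTop.comp hX))
  have h1 : (fun q : ℕ × ℂ => q.2) =o[indexFilter] fun q => (q.1 * Real.pi / L : ℝ) := by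
    refine IsBigO.trans_isLittleO (IsBigO.of_bound 1 ?_) (h0 1)
    filter_upwards [eventually_norm_snd_le] with q hq
    simpa using hq
  have h2 : (fun q : ℕ × ℂ => ((Real.log (q.1 * Real.pi / L) : ℝ) : ℂ))
      =o[indexFilter] fun q => (q.1 * Real.pi / L : ℝ) := by
    have := Real.isLittleO_log_id_atTop.comp_tendsto hX
    refine IsLittleO.of_norm_left ?_
    simpa [Function.comp_def] using this.norm_left
  refine (((h0 (s * (p / (2 * L) * (Real.pi / 2)) + Complex.I * (Complex.log C / (2 * L)))).add
    h1).sub (h2.const_mul_left (Complex.I * (p / (2 * L))))).congr_left fun q => ?_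
  simp only [approxZero]
  ring

theorem tendsto_approxZero_div (hs : s = 1 ∨ s = -1) (hL : 0 < L) :
    Tendsto (fun q : ℕ × ℂ => s * (approxZero C L p s q.1 + q.2) /
      ((q.1 * Real.pi / L : ℝ) : ℂ)) indexFilter (𝓝 1) := by
  have h1 : (fun q : ℕ × ℂ => approxZero C L p s q.1 + q.2 - s * ((q.1 * Real.pi / L : ℝ) : ℂ))
      =o[indexFilter] fun q => (((q.1 * Real.pi / L : ℝ)) : ℂ) :=
    ((approxZero_sub_isLittleO hL).norm_right).trans_isBigO
      (isBigO_of_le _ fun q => by rw [norm_norm, Complex.norm_real])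
  have h2 := (h1.tendsto_div_nhds_zero.const_mul (s : ℂ)).add_const 1
  rw [mul_zero, zero_add] at h2
  refine h2.congr' ?_
  filter_upwards [(tendsto_index hL).eventually_gt_atTop 0] with q hq
  have hq' : ((q.1 * Real.pi / L : ℝ) : ℂ) ≠ 0 := by exact_mod_cast hq.ne'
  have hs2 : (s : ℂ) * s = 1 := by rcases hs with rfl | rfl <;> norm_num
  rw [← mul_div_assoc, div_add_one hq']
  congr 1
  linear_combination (-((q.1 * Real.pi / L : ℝ) : ℂ)) * hs2

theorem tendsto_norm_approxZero_div (hs : s = 1 ∨ s = -1) (hL : 0 < L) :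
    Tendsto (fun q : ℕ × ℂ => ‖approxZero C L p s q.1 + q.2‖ / (q.1 * Real.pi / L : ℝ))
      indexFilter (𝓝 1) := by
  have h := (tendsto_approxZero_div (C := C) (p := p) hs hL).norm
  rw [norm_one] at h
  refine h.congr' ?_
  filter_upwards [(tendsto_index hL).eventually_gt_atTop 0] with q hq
  have hs1 : ‖(s : ℂ)‖ = 1 := by rcases hs with rfl | rfl <;> norm_num
  rw [norm_div, norm_mul, hs1, one_mul, Complex.norm_real, Real.norm_of_nonneg hq.le]

theorem tendsto_approxZero (hs : s = 1 ∨ s = -1) (hL : 0 < L) (hM : p / (2 * L) < M) :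
    Tendsto (fun q : ℕ × ℂ => approxZero C L p s q.1 + q.2) indexFilter (logFilter M) := by
  have hX := tendsto_index hL
  have h1 := tendsto_norm_approxZero_div (C := C) (p := p) hs hL
  have hnorm : Tendsto (fun q : ℕ × ℂ => ‖approxZero C L p s q.1 + q.2‖) indexFilter atTop := by
    refine (h1.pos_mul_atTop one_pos hX).congr' ?_
    filter_upwards [hX.eventually_gt_atTop 0] with q hq
    exact div_mul_cancel₀ _ hq.ne'
  have hM0 : 0 < M := lt_of_le_of_lt (by positivity) hM
  refine tendsto_inf.2 ⟨tendsto_norm_atTop_iff_cobounded.1 hnorm, tendsto_principal.2 ?_⟩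
  have h2 : Tendsto (fun q : ℕ × ℂ => Real.log (‖approxZero C L p s q.1 + q.2‖ /
      (q.1 * Real.pi / L : ℝ))) indexFilter (𝓝 0) := by
    simpa using h1.log one_ne_zero
  have h3 := ((Real.tendsto_log_atTop.comp hX).const_mul_atTop (sub_pos.2 hM)).eventually_gt_atTop
    (1 + M - (Complex.log C).re / (2 * L))
  filter_upwards [h3, h2.eventually (lt_mem_nhds (show (-1 : ℝ) < 0 by norm_num)),
    hX.eventually_gt_atTop 0, hnorm.eventually_gt_atTop 0, eventually_norm_snd_le]
    with q h3 h4 h5 h6 h7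
  change _ < Complex.im _
  set w := approxZero C L p s q.1 + q.2 with hw
  have him : w.im = (Complex.log C).re / (2 * L) - p / (2 * L) * Real.log (q.1 * Real.pi / L) +
      q.2.im := by
    have e : w = (s * ((q.1 * Real.pi / L : ℝ) : ℂ) + s * ((p / (2 * L) * (Real.pi / 2) : ℝ) : ℂ)) +
      Complex.I * (Complex.log C / ((2 * L : ℝ) : ℂ)) -
      Complex.I * ((p / (2 * L) * Real.log (q.1 * Real.pi / L) : ℝ) : ℂ) + q.2 := by
      rw [hw, approxZero]; push_cast; ring
    rw [e]
    simp only [Complex.add_im, Complex.sub_im, Complex.mul_im, Complex.I_re, Complex.I_im,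
      Complex.ofReal_im, Complex.ofReal_re, Complex.div_ofReal_re]
    ring
  have h8 : -1 ≤ q.2.im := by
    have := (abs_le.1 (Complex.abs_im_le_norm q.2)).1
    linarith
  rw [Real.log_div h6.ne' h5.ne'] at h4
  have h9 : Real.log ‖w‖ ≤ Real.log (1 + ‖w‖) := Real.log_le_log h6 (by linarith)
  have h10 : M * Real.log ‖w‖ ≤ M * Real.log (1 + ‖w‖) := by gcongr
  have h11 : M * -1 < M * (Real.log ‖w‖ - Real.log (q.1 * Real.pi / L)) := by gcongr
  simp only [Function.comp_apply] at h3
  rw [him]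
  linarith

theorem oscillation_approxZero (hC : C ≠ 0) (hs : s = 1 ∨ s = -1) (hL : 0 < L) {n : ℕ}
    (hn : 0 < n) {z : ℂ} (hw : approxZero C L p s n + z ≠ 0) :
    oscillation C L p (approxZero C L p s n + z) = Complex.exp (2 * Complex.I * z * L) *
      (s * (approxZero C L p s n + z) / ((n * Real.pi / L : ℝ) : ℂ))⁻¹ ^ p := by
  have hX : 0 < n * Real.pi / L := by positivity
  have hLc : (L : ℂ) ≠ 0 := by exact_mod_cast hL.ne'
  have e1 : 2 * Complex.I * (approxZero C L p s n + z) * L = 2 * Complex.I * z * L +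
      ((s * n : ℝ) : ℂ) * (2 * Real.pi * Complex.I) - Complex.log C +
      p * (s * (Real.pi / 2) * Complex.I + (Real.log (n * Real.pi / L) : ℝ)) := by
    simp only [approxZero]
    push_cast
    field_simp
    ring_nf
    simp only [Complex.I_sq]
    ring
  have e2 : Complex.exp (((s * n : ℝ) : ℂ) * (2 * Real.pi * Complex.I)) = 1 := by
    rcases hs with rfl | rfl
    · simp [Complex.exp_nat_mul_two_pi_mul_I]
    · simpa using Complex.exp_int_mul_two_pi_mul_I (-n)
  have e3 : Complex.exp (s * (Real.pi / 2) * Complex.I) = s * Complex.I := by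
    rcases hs with rfl | rfl
    · simp [Complex.exp_pi_div_two_mul_I]
    · simp [neg_mul, Complex.exp_neg]
  have hs2 : (s : ℂ)⁻¹ = s := by rcases hs with rfl | rfl <;> norm_num
  rw [oscillation, e1, Complex.exp_add, Complex.exp_sub, Complex.exp_add, e2, mul_one,
    Complex.exp_log hC, Complex.exp_nat_mul, Complex.exp_add, e3, ← Complex.ofReal_exp,
    Real.exp_log hX, inv_div, mul_comm (s : ℂ) (approxZero C L p s n + z), ← div_div,
    div_eq_mul_inv _ (s : ℂ), hs2]
  have hI : (Complex.I : ℂ) ^ p ≠ 0 := pow_ne_zero _ Complex.I_ne_zero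
  field_simp
  rw [← mul_pow]
  congr 1
  field_simp

/-- `D` is asymptotic to `1 - oscillation C L p`, relatively to the size of the two terms. -/
def HasOscillation (D : ℂ → ℂ) (C : ℂ) (L : ℝ) (p : ℕ) (M : ℝ) : Prop :=
  (fun z => D z - (1 - oscillation C L p z)) =o[logFilter M] fun z => 1 + ‖oscillation C L p z‖

variable {D : ℂ → ℂ}

theorem HasOscillation.tendsto_sub (h : HasOscillation D C L p M) (hC : C ≠ 0)
    (hs : s = 1 ∨ s = -1) (hL : 0 < L) (hM : p / (2 * L) < M) :
    Tendsto (fun q : ℕ × ℂ => D (approxZero C L p s q.1 + q.2) -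
      (1 - Complex.exp (2 * Complex.I * q.2 * L))) indexFilter (𝓝 0) := by
  have hw := tendsto_approxZero (C := C) (s := s) hs hL hM
  have hX := tendsto_index hL
  have h1 := ((tendsto_approxZero_div (C := C) (p := p) hs hL).inv₀ one_ne_zero).pow p
  rw [inv_one, one_pow] at h1
  have hexp : (fun q : ℕ × ℂ => Complex.exp (2 * Complex.I * q.2 * L)) =O[indexFilter]
      fun _ => (1 : ℝ) := by
    refine IsBigO.of_bound (Real.exp (2 * L)) ?_
    filter_upwards [eventually_norm_snd_le] with q hq
    rw [Complex.norm_exp, norm_one, mul_one, Real.exp_le_exp]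
    refine (Complex.re_le_norm _).trans ?_
    rw [norm_mul, norm_mul, norm_mul, Complex.norm_I, Complex.norm_real, Complex.norm_ofNat,
      Real.norm_of_nonneg hL.le, mul_one]
    nlinarith
  have hosc : (fun q : ℕ × ℂ => oscillation C L p (approxZero C L p s q.1 + q.2)) =ᶠ[indexFilter]
      fun q => Complex.exp (2 * Complex.I * q.2 * L) *
        (s * (approxZero C L p s q.1 + q.2) / ((q.1 * Real.pi / L : ℝ) : ℂ))⁻¹ ^ p := by
    filter_upwards [hX.eventually_gt_atTop 0,
      hw.eventually (eventually_ne_zero_cobounded.filter_mono (logFilter_le M))] with q hq hq'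
    refine oscillation_approxZero hC hs hL ?_ hq'
    rcases Nat.eq_zero_or_pos q.1 with h0 | h0
    · simp [h0] at hq
    · exact h0
  have hoscO : (fun q : ℕ × ℂ => oscillation C L p (approxZero C L p s q.1 + q.2))
      =O[indexFilter] fun _ => (1 : ℝ) := by
    refine hosc.trans_isBigO ?_
    simpa using hexp.mul (h1.isBigO_one ℝ)
  have h2 : (fun q : ℕ × ℂ => D (approxZero C L p s q.1 + q.2) -
      (1 - oscillation C L p (approxZero C L p s q.1 + q.2))) =o[indexFilter]
      fun _ => (1 : ℝ) := by
    refine (h.comp_tendsto hw).trans_isBigO ?_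
    exact (isBigO_refl _ _).add hoscO.norm_left
  have h3 : Tendsto (fun q : ℕ × ℂ => Complex.exp (2 * Complex.I * q.2 * L) *
      ((s * (approxZero C L p s q.1 + q.2) / ((q.1 * Real.pi / L : ℝ) : ℂ))⁻¹ ^ p - 1))
      indexFilter (𝓝 0) := by
    have h4 := h1.sub_const 1
    rw [sub_self] at h4
    replace h4 := (isLittleO_one_iff ℝ).2 h4
    have := hexp.mul_isLittleO h4
    simpa using (isLittleO_one_iff ℝ).1 (by simpa using this)
  have h4 := ((isLittleO_one_iff ℝ).1 h2).sub h3
  rw [sub_zero] at h4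
  refine h4.congr' ?_
  filter_upwards [hosc] with q hq
  rw [hq]
  ring

/-- Near each approximate zero of large index there is exactly one zero, and it is simple. -/
theorem HasOscillation.eventually_unique_zero (h : HasOscillation D C L p M) (hC : C ≠ 0)
    (hD : ∀ z, z ≠ 0 → DifferentiableAt ℂ D z)
    (hs : s = 1 ∨ s = -1) (hL : 0 < L) (hM : p / (2 * L) < M) {δ : ℝ} (hδ : 0 < δ)
    (hδ' : δ ≤ 1 / 2) (hδL : 64 * L * δ ≤ 1) :
    ∀ᶠ n in atTop, (∃ z, ‖z - approxZero C L p s n‖ ≤ δ ∧ D z = 0) ∧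
      (∀ z w, ‖z - approxZero C L p s n‖ ≤ δ → ‖w - approxZero C L p s n‖ ≤ δ →
        D z = 0 → D w = 0 → z = w) ∧
      ∀ z, ‖z - approxZero C L p s n‖ ≤ δ → deriv D z ≠ 0 := by
  have h1 := (h.tendsto_sub hC hs hL hM).eventually
    (Metric.ball_mem_nhds (0 : ℂ) (show 0 < L * δ / 4 by positivity))
  have h2 := (tendsto_approxZero (C := C) (s := s) hs hL hM).eventually
    (eventually_ne_zero_cobounded.filter_mono (logFilter_le M))
  have h3 := eventually_prod_principal_iff.1 (h1.and h2)
  filter_upwards [h3] with n hn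
  set c := approxZero C L p s n
  have hLc : (-2 * Complex.I * L : ℂ) ≠ 0 := by
    simp [hL.ne']
  have hmem : ∀ z ∈ Metric.ball (0 : ℂ) (2 * δ), z ∈ Metric.closedBall (0 : ℂ) 1 := by
    intro z hz
    rw [mem_ball_zero_iff] at hz
    rw [mem_closedBall_zero_iff]
    linarith
  have hΦ : ∀ z ∈ Metric.ball (0 : ℂ) (2 * δ),
      DifferentiableAt ℂ (fun z => D (c + z) / (-2 * Complex.I * L)) z := by
    intro z hz
    have := hD (c + z) (hn z (hmem z hz)).2
    exact (this.comp z (differentiableAt_id.const_add c)).div_const _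
  have key := zero_of_near_id (Φ := fun z => D (c + z) / (-2 * Complex.I * L)) hδ
    (fun z hz => (hΦ z hz).differentiableWithinAt) ?_
  · obtain ⟨⟨z, hz, hz0⟩, k2, k3⟩ := key
    refine ⟨⟨c + z, by simpa using hz, ?_⟩, ?_, ?_⟩
    · exact (div_eq_zero_iff.1 hz0).resolve_right hLc
    · intro z w hz hw hz0 hw0
      have := k2 (z - c) (w - c) hz hw (by simp [hz0]) (by simp [hw0])
      simpa using this
    · intro z hz h0
      refine k3 (z - c) hz ?_
      rw [deriv_div_const, deriv_comp_const_add]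
      simp [h0]
  · intro z hz
    have hz1 : ‖D (c + z) - (1 - Complex.exp (2 * Complex.I * z * L))‖ < L * δ / 4 := by
      simpa using (hn z (hmem z hz)).1
    rw [mem_ball_zero_iff] at hz
    have hw : ‖2 * Complex.I * z * L‖ = 2 * L * ‖z‖ := by
      rw [norm_mul, norm_mul, norm_mul, Complex.norm_I, Complex.norm_real, Complex.norm_ofNat,
        Real.norm_of_nonneg hL.le, mul_one]
      ring
    have h5 := Complex.norm_exp_sub_one_sub_id_le (x := 2 * Complex.I * z * L)
      (by rw [hw]; nlinarith)
    rw [hw] at h5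
    have h6 : D (c + z) / (-2 * Complex.I * L) - z =
        ((D (c + z) - (1 - Complex.exp (2 * Complex.I * z * L))) -
          (Complex.exp (2 * Complex.I * z * L) - 1 - 2 * Complex.I * z * L)) /
            (-2 * Complex.I * L) := by
      rw [eq_div_iff hLc, sub_mul, div_mul_cancel₀ _ hLc]
      ring
    have h7 : ‖(-2 * Complex.I * L : ℂ)‖ = 2 * L := by
      simp [abs_of_pos hL]
    rw [h6, norm_div, h7, div_le_iff₀ (by positivity)]
    refine (norm_sub_le _ _).trans ?_
    have h8 : (2 * L * ‖z‖) ^ 2 ≤ L * δ / 4 := by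
      have := norm_nonneg z
      have h9 : (2 * L * ‖z‖) ^ 2 ≤ (2 * L * (2 * δ)) ^ 2 := by gcongr
      have h10 : L * δ * (64 * L * δ) ≤ L * δ * 1 := by gcongr
      nlinarith
    linarith

/-- Conversely, where the oscillation is close to `1`, an approximate zero is near. -/
theorem eventually_near_approxZero {F : Filter ℂ} (hF : F ≤ Bornology.cobounded ℂ) (hC : C ≠ 0)
    (hs : s = 1 ∨ s = -1) (hL : 0 < L) (hE : Tendsto (oscillation C L p) F (𝓝 1))
    (hre : ∀ᶠ z in F, 0 ≤ s * z.re) {δ : ℝ} (hδ : 0 < δ) (n₀ : ℕ) :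
    ∀ᶠ z in F, ∃ n, n₀ ≤ n ∧ ‖z - approxZero C L p s n‖ ≤ δ := by
  have hs2 : s * s = 1 := by rcases hs with rfl | rfl <;> norm_num
  have hs2c : (s : ℂ) * s = 1 := by exact_mod_cast hs2
  have hsn : (s : ℂ) ≠ 0 := left_ne_zero_of_mul (hs2c ▸ one_ne_zero)
  have hLc : (L : ℂ) ≠ 0 := by exact_mod_cast hL.ne'
  have hN : Tendsto (fun z : ℂ => ‖z‖) F atTop := tendsto_norm_cobounded_atTop.mono_left hF
  have hne : ∀ᶠ z in F, z ≠ 0 := eventually_ne_zero_cobounded.filter_mono hF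
  have hEne : ∀ᶠ z in F, oscillation C L p z ≠ 0 := hE.eventually_ne one_ne_zero
  have hlogE : Tendsto (fun z => Complex.log (oscillation C L p z)) F (𝓝 0) := by
    simpa using hE.clog (by simp)
  have hlogdiv : Tendsto (fun z : ℂ => Real.log ‖z‖ / ‖z‖) F (𝓝 0) :=
    (Real.isLittleO_log_id_atTop.tendsto_div_nhds_zero).comp hN
  have hinv : Tendsto (fun z : ℂ => ‖z‖⁻¹) F (𝓝 0) := tendsto_inv_atTop_zero.comp hN
  -- the imaginary part is logarithmic
  have him : Tendsto (fun z : ℂ => z.im / ‖z‖) F (𝓝 0) := by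
    have h1 : Tendsto (fun z => Real.log ‖oscillation C L p z‖) F (𝓝 0) := by
      simpa using hE.norm.log (by simp)
    have h2 := (((hinv.const_mul (Real.log ‖C‖)).sub (h1.mul hinv)).sub
      (hlogdiv.const_mul (p : ℝ))).div_const (2 * L)
    simp only [mul_zero, sub_zero, zero_div] at h2
    refine h2.congr' ?_
    filter_upwards [hne] with z hz
    have hz' : 0 < ‖z‖ := norm_pos_iff.2 hz
    have h3 : Real.log ‖oscillation C L p z‖ =
        Real.log ‖C‖ - 2 * L * z.im - p * Real.log ‖z‖ := by
      have h4 : (2 * Complex.I * z * L).re = -(2 * L * z.im) := by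
        simp [Complex.mul_re, Complex.mul_im]
        ring
      rw [oscillation, norm_div, norm_mul, norm_pow, norm_mul, Complex.norm_I, one_mul,
        Real.log_div (by simp [hC]) (by positivity), Real.log_mul (by simp [hC]) (by simp),
        Real.log_pow, Complex.norm_exp, Real.log_exp, h4]
      ring
    rw [h3]
    field_simp
    ring
  have hdir : Tendsto (fun z : ℂ => s * z / ((‖z‖ : ℝ) : ℂ)) F (𝓝 1) := by
    have h1 : Tendsto (fun z : ℂ => s * z.re / ‖z‖) F (𝓝 1) := by
      have h2 := ((him.pow 2).const_sub 1).sqrt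
      rw [zero_pow two_ne_zero, sub_zero, Real.sqrt_one] at h2
      refine h2.congr' ?_
      filter_upwards [hre, hne] with z h3 h4
      have hz' : 0 < ‖z‖ := norm_pos_iff.2 h4
      rw [← Real.sqrt_sq (show 0 ≤ s * z.re / ‖z‖ by positivity)]
      congr 1
      have h5 : ‖z‖ ^ 2 = z.re ^ 2 + z.im ^ 2 := by
        rw [← Complex.normSq_eq_norm_sq, Complex.normSq_apply]; ring
      field_simp
      linear_combination h5 - z.re ^ 2 * hs2
    have h2 := (Complex.continuous_ofReal.continuousAt.tendsto.comp h1).add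
      ((Complex.continuous_ofReal.continuousAt.tendsto.comp (him.const_mul s)).mul_const
        Complex.I)
    simp only [mul_zero, Complex.ofReal_zero, zero_mul, add_zero, Complex.ofReal_one] at h2
    refine h2.congr fun z => ?_
    simp only [Function.comp_apply]
    have h3 := Complex.re_add_im z
    push_cast
    linear_combination (s / ((‖z‖ : ℝ) : ℂ) : ℂ) * h3
  have hlogdir : Tendsto (fun z : ℂ => Complex.log (s * z / ((‖z‖ : ℝ) : ℂ))) F (𝓝 0) := by
    simpa using hdir.clog (by simp)
  have hlog : ∀ᶠ z in F, Complex.log (s * z) = (Real.log ‖z‖ : ℝ) +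
      Complex.log (s * z / ((‖z‖ : ℝ) : ℂ)) := by
    filter_upwards [hne] with z hz
    have hz' : 0 < ‖z‖ := norm_pos_iff.2 hz
    have hzc : ((‖z‖ : ℝ) : ℂ) ≠ 0 := by exact_mod_cast hz'.ne'
    rw [← Complex.log_ofReal_mul hz' (by simp [hsn, hz])]
    congr 1
    field_simp
  -- the integer comes from the periodicity of the exponential
  have hm : ∀ z : ℂ, ∃ m : ℤ, z ≠ 0 → 2 * Complex.I * L * z + Complex.log C -
      p * (Complex.log (s * z) + s * (Real.pi / 2) * Complex.I) =
      Complex.log (oscillation C L p z) + m * (2 * Real.pi * Complex.I) := by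
    intro z
    by_cases hz : z = 0
    · exact ⟨0, fun h => absurd hz h⟩
    have e3 : Complex.exp (s * (Real.pi / 2) * Complex.I) = s * Complex.I := by
      rcases hs with rfl | rfl
      · simp [Complex.exp_pi_div_two_mul_I]
      · simp [neg_mul, Complex.exp_neg]
    have e1 : oscillation C L p z ≠ 0 := by
      rw [oscillation]
      exact div_ne_zero (mul_ne_zero hC (Complex.exp_ne_zero _))
        (pow_ne_zero _ (mul_ne_zero Complex.I_ne_zero hz))
    obtain ⟨m, hm⟩ := Complex.exp_eq_exp_iff_exists_int.1 (show Complex.exp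
      (2 * Complex.I * L * z + Complex.log C -
        p * (Complex.log (s * z) + s * (Real.pi / 2) * Complex.I)) =
      Complex.exp (Complex.log (oscillation C L p z)) by
        rw [Complex.exp_log e1, Complex.exp_sub, Complex.exp_add, Complex.exp_log hC,
          Complex.exp_nat_mul, Complex.exp_add, Complex.exp_log (mul_ne_zero hsn hz), e3,
          oscillation]
        have : (s : ℂ) * z * (s * Complex.I) = Complex.I * z := by
          linear_combination z * Complex.I * hs2c
        rw [this]
        ring_nf)
    exact ⟨m, fun _ => hm⟩
  choose m hm using hm
  set X : ℂ → ℝ := fun z => s * m z * Real.pi / L with hX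
  have hXdiv : Tendsto (fun z => X z / ‖z‖) F (𝓝 1) := by
    have h1 : Tendsto (fun z => ((‖z‖⁻¹ : ℝ) : ℂ)) F (𝓝 0) := by
      simpa [Function.comp_def] using Complex.continuous_ofReal.continuousAt.tendsto.comp hinv
    have h2 : Tendsto (fun z : ℂ => ((Real.log ‖z‖ / ‖z‖ : ℝ) : ℂ)) F (𝓝 0) := by
      simpa [Function.comp_def] using Complex.continuous_ofReal.continuousAt.tendsto.comp hlogdiv
    have h3 := hdir.sub ((((hlogE.mul h1).sub (h1.const_mul (Complex.log C))).add
      (((h2.add (hlogdir.mul h1)).add (h1.const_mul (s * (Real.pi / 2) * Complex.I))).const_mul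
        (p : ℂ))).const_mul (s / (2 * Complex.I * L)))
    simp only [mul_zero, add_zero, sub_zero] at h3
    have h4 : Tendsto (fun z => ((X z / ‖z‖ : ℝ) : ℂ)) F (𝓝 1) := by
      refine h3.congr' ?_
      filter_upwards [hne, hlog] with z hz h5
      have hzc : ((‖z‖ : ℝ) : ℂ) ≠ 0 := by
        exact_mod_cast (norm_pos_iff.2 hz).ne'
      have h6 := hm z hz
      rw [h5] at h6
      have h7 : Complex.log (oscillation C L p z) = 2 * Complex.I * L * z + Complex.log C -
        p * ((Real.log ‖z‖ : ℝ) + Complex.log (s * z / ((‖z‖ : ℝ) : ℂ)) +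
          s * (Real.pi / 2) * Complex.I) - m z * (2 * Real.pi * Complex.I) := by
        linear_combination -h6
      rw [h7]
      simp only [hX]
      push_cast
      field_simp
      ring
    have := Complex.continuous_re.continuousAt.tendsto.comp h4
    simpa [Function.comp_def] using this
  have hXlog : Tendsto (fun z => ((Real.log (X z / ‖z‖) : ℝ) : ℂ)) F (𝓝 0) := by
    have := Complex.continuous_ofReal.continuousAt.tendsto.comp (hXdiv.log one_ne_zero)
    simpa [Function.comp_def] using this
  have hXtop : Tendsto X F atTop := by
    refine (hXdiv.pos_mul_atTop one_pos hN).congr' ?_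
    filter_upwards [hne] with z hz
    exact div_mul_cancel₀ _ (norm_ne_zero_iff.2 hz)
  have hlim : Tendsto (fun z => 1 / (2 * Complex.I * L) * (Complex.log (oscillation C L p z) +
      p * (Complex.log (s * z / ((‖z‖ : ℝ) : ℂ)) - (Real.log (X z / ‖z‖) : ℝ)))) F (𝓝 0) := by
    simpa using (hlogE.add ((hlogdir.sub hXlog).const_mul (p : ℂ))).const_mul
      (1 / (2 * Complex.I * L))
  filter_upwards [hlim.eventually (Metric.closedBall_mem_nhds 0 hδ), hne, hlog,
    hXtop.eventually_gt_atTop (n₀ * Real.pi / L)] with z h1 h2 h3 h4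
  have hz' : 0 < ‖z‖ := norm_pos_iff.2 h2
  -- `s m` is the index
  have h5 : (n₀ : ℝ) < s * m z := by
    simp only [hX] at h4
    have := (div_lt_div_iff_of_pos_right hL).1 h4
    exact lt_of_mul_lt_mul_right this Real.pi_pos.le
  obtain ⟨n, hn⟩ : ∃ n : ℕ, (n : ℝ) = s * m z := by
    rcases hs with rfl | rfl
    · have : 0 ≤ m z := by
        have : (0 : ℝ) ≤ m z := by linarith [(Nat.cast_nonneg n₀ : (0 : ℝ) ≤ n₀)]
        exact_mod_cast this
      refine ⟨(m z).toNat, ?_⟩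
      rw [one_mul]
      exact_mod_cast Int.toNat_of_nonneg this
    · have : 0 ≤ -m z := by
        have : (0 : ℝ) ≤ -m z := by linarith [(Nat.cast_nonneg n₀ : (0 : ℝ) ≤ n₀)]
        exact_mod_cast this
      refine ⟨(-m z).toNat, ?_⟩
      have h6 : ((-m z).toNat : ℤ) = -m z := Int.toNat_of_nonneg this
      have h7 : (((-m z).toNat : ℤ) : ℝ) = ((-m z : ℤ) : ℝ) := by rw [h6]
      push_cast at h7
      rw [h7]
      ring
  refine ⟨n, ?_, ?_⟩
  · have : (n₀ : ℝ) < n := by rw [hn]; exact h5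
    exact_mod_cast this.le
  · rw [dist_zero_right] at h1
    refine le_of_eq_of_le ?_ h1
    congr 1
    have hX0 : 0 < X z := lt_of_le_of_lt (by positivity) h4
    have h6 : ((n * Real.pi / L : ℝ)) = X z := by rw [hn]
    have h8 := hm z h2
    rw [h3] at h8
    have h9 : Complex.log (oscillation C L p z) = 2 * Complex.I * L * z + Complex.log C -
        p * ((Real.log ‖z‖ : ℝ) + Complex.log (s * z / ((‖z‖ : ℝ) : ℂ)) +
          s * (Real.pi / 2) * Complex.I) - m z * (2 * Real.pi * Complex.I) := by
      linear_combination -h8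
    have h10 : ((X z : ℝ) : ℂ) = s * m z * Real.pi / L := by simp only [hX]; push_cast; ring
    have hms : (s : ℂ) * ((X z : ℝ) : ℂ) = m z * Real.pi / L := by
      rw [h10]
      linear_combination (m z * Real.pi / L : ℂ) * hs2c
    rw [approxZero, h6, hms, h9, Real.log_div hX0.ne' hz'.ne']
    push_cast
    field_simp
    ring_nf
    simp only [Complex.I_sq]
    ring

/-- At the zeros of `D` the oscillation is close to `1`. -/
theorem HasOscillation.tendsto_oscillation (h : HasOscillation D C L p M) :
    Tendsto (oscillation C L p) (logFilter M ⊓ 𝓟 {z | D z = 0}) (𝓝 1) := by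
  rw [Metric.tendsto_nhds]
  intro ε hε
  set η := min (1 / 2) (ε / 6) with hη
  have hη0 : 0 < η := lt_min (by norm_num) (by linarith)
  have h1 : η ≤ 1 / 2 := min_le_left _ _
  have h2 : η ≤ ε / 6 := min_le_right _ _
  filter_upwards [(h.bound hη0).filter_mono inf_le_left,
    mem_inf_of_right (mem_principal_self {z | D z = 0})] with z h3 h4
  replace h4 : D z = 0 := h4
  rw [h4, zero_sub, norm_neg, Real.norm_of_nonneg (by positivity)] at h3
  have h5 := norm_sub_norm_le (oscillation C L p z) 1
  rw [norm_one, norm_sub_rev] at h5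
  have h6 := norm_nonneg (oscillation C L p z)
  rw [dist_eq_norm, norm_sub_rev]
  have h7 : ‖oscillation C L p z‖ ≤ 3 := by nlinarith
  nlinarith

theorem norm_sub_re_le {s : ℝ} (hs : s = 1 ∨ s = -1) {z : ℂ} (hz : 0 < s * z.re) :
    ‖z‖ - s * z.re ≤ z.im ^ 2 / (s * z.re) := by
  rw [le_div_iff₀ hz]
  have h5 : ‖z‖ ^ 2 = z.re ^ 2 + z.im ^ 2 := by
    rw [← Complex.normSq_eq_norm_sq, Complex.normSq_apply]; ring
  have hs2 : s * s = 1 := by rcases hs with rfl | rfl <;> norm_num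
  have h6 : s * z.re ≤ ‖z‖ := by
    rcases hs with rfl | rfl
    · rw [one_mul]; exact Complex.re_le_norm z
    · have := (abs_le.1 (Complex.abs_re_le_norm z)).1
      linarith
  have h7 : (s * z.re) ^ 2 = z.re ^ 2 := by rw [mul_pow, sq s, hs2, one_mul]
  nlinarith

/-- A sequence asymptotic to the approximate zeros has eventually increasing modulus. -/
theorem eventually_norm_lt_norm_succ (hs : s = 1 ∨ s = -1) (hL : 0 < L) {ζ : ℕ → ℂ}
    (hζ : Tendsto (fun n => ζ n - approxZero C L p s n) atTop (𝓝 0)) :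
    Tendsto (fun n => s * (ζ n).re) atTop atTop ∧ ∀ᶠ n in atTop, ‖ζ n‖ < ‖ζ (n + 1)‖ := by
  have hs2 : s * s = 1 := by rcases hs with rfl | rfl <;> norm_num
  have hX : Tendsto (fun n : ℕ => (n * Real.pi / L : ℝ)) atTop atTop :=
    (tendsto_natCast_atTop_atTop.atTop_mul_const Real.pi_pos).atTop_div_const hL
  set K : ℂ := s * ((p / (2 * L) * (Real.pi / 2) : ℝ) : ℂ) +
    Complex.I * (Complex.log C / ((2 * L : ℝ) : ℂ)) with hK
  have happ : ∀ n : ℕ, approxZero C L p s n = s * ((n * Real.pi / L : ℝ) : ℂ) + K -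
      Complex.I * ((p / (2 * L) * Real.log (n * Real.pi / L) : ℝ) : ℂ) := fun n => by
    rw [approxZero, hK]; push_cast; ring
  have hre : Tendsto (fun n : ℕ => s * (ζ n).re - n * Real.pi / L) atTop (𝓝 (s * K.re)) := by
    have h1 := ((Complex.continuous_re.tendsto 0).comp hζ).const_mul s |>.add_const (s * K.re)
    rw [Complex.zero_re, mul_zero, zero_add] at h1
    refine h1.congr fun n => ?_
    simp only [Function.comp_apply, happ, Complex.sub_re, Complex.add_re, Complex.mul_re,
      Complex.I_re, Complex.I_im, Complex.ofReal_re, Complex.ofReal_im]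
    linear_combination (-(n * Real.pi / L)) * hs2
  have hretop : Tendsto (fun n => s * (ζ n).re) atTop atTop :=
    (hX.atTop_add hre).congr fun n => by ring
  have him : Tendsto (fun n : ℕ => (ζ n).im + p / (2 * L) * Real.log (n * Real.pi / L)) atTop
      (𝓝 K.im) := by
    have h1 := ((Complex.continuous_im.tendsto 0).comp hζ).add_const K.im
    rw [Complex.zero_im, zero_add] at h1
    refine h1.congr fun n => ?_
    simp only [Function.comp_apply, happ, Complex.sub_im, Complex.add_im, Complex.mul_im,
      Complex.I_re, Complex.I_im, Complex.ofReal_re, Complex.ofReal_im]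
    ring
  -- the square of the imaginary part is negligible against the real part
  have hsq : Tendsto (fun n : ℕ => (ζ n).im ^ 2 / (s * (ζ n).re)) atTop (𝓝 0) := by
    have h1 : Tendsto (fun n : ℕ => Real.log (n * Real.pi / L) ^ 2 / (n * Real.pi / L)) atTop
        (𝓝 0) := by
      have := (Real.tendsto_pow_log_div_mul_add_atTop 1 0 2 one_ne_zero).comp hX
      simpa [Function.comp_def] using this
    have h2 : Tendsto (fun n : ℕ => Real.log (n * Real.pi / L) / (n * Real.pi / L)) atTop
        (𝓝 0) := by
      have := (Real.tendsto_pow_log_div_mul_add_atTop 1 0 1 one_ne_zero).comp hX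
      simpa [Function.comp_def] using this
    have h3 : Tendsto (fun n : ℕ => (n * Real.pi / L)⁻¹) atTop (𝓝 0) :=
      tendsto_inv_atTop_zero.comp hX
    have h4 : Tendsto (fun n : ℕ => (s * (ζ n).re) / (n * Real.pi / L)) atTop (𝓝 1) := by
      have := (hre.mul h3).const_add 1
      rw [mul_zero, add_zero] at this
      refine this.congr' ?_
      filter_upwards [hX.eventually_gt_atTop 0] with n hn
      have := hn.ne'
      rw [← div_eq_mul_inv, sub_div, div_self this]
      ring
    have h5 := ((((him.pow 2).mul h3).sub ((him.mul h2).const_mul (2 * (p / (2 * L))))).add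
      (h1.const_mul ((p / (2 * L)) ^ 2))).div h4 one_ne_zero
    simp only [mul_zero, sub_zero, add_zero, zero_div] at h5
    refine h5.congr' ?_
    filter_upwards [hX.eventually_gt_atTop 0, hretop.eventually_gt_atTop 0] with n hn hn'
    simp only [Pi.div_apply]
    set x := n * Real.pi / L
    set y := s * (ζ n).re
    rw [div_div_eq_mul_div, div_left_inj' hn'.ne']
    have := hn.ne'
    field_simp
    ring
  refine ⟨hretop, ?_⟩
  have hnorm : Tendsto (fun n : ℕ => ‖ζ n‖ - n * Real.pi / L) atTop (𝓝 (s * K.re)) := by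
    have h1 : Tendsto (fun n => ‖ζ n‖ - s * (ζ n).re) atTop (𝓝 0) := by
      refine squeeze_zero' ?_ ?_ hsq
      · refine Eventually.of_forall fun n => sub_nonneg.2 ?_
        refine (le_abs_self _).trans ?_
        rw [abs_mul]
        have : |s| = 1 := by rcases hs with rfl | rfl <;> norm_num
        rw [this, one_mul]
        exact Complex.abs_re_le_norm _
      · filter_upwards [hretop.eventually_gt_atTop 0] with n hn
        exact norm_sub_re_le hs hn
    have h2 := h1.add hre
    rw [zero_add] at h2
    exact h2.congr fun n => by ring
  have h1 := (hnorm.comp (tendsto_add_atTop_nat 1)).sub hnorm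
  rw [sub_self] at h1
  have hpi : 0 < Real.pi / L := div_pos Real.pi_pos hL
  filter_upwards [h1.eventually (lt_mem_nhds (show -(Real.pi / L) < 0 by linarith))] with n hn
  simp only [Function.comp_apply] at hn
  push_cast at hn
  have : (n + 1 : ℝ) * Real.pi / L = n * Real.pi / L + Real.pi / L := by ring
  rw [this] at hn
  linarith

/-- The zeros of `D` with real part of sign `s` in the logarithmic region. -/
theorem HasOscillation.exists_sequence (h : HasOscillation D C L p M) (hC : C ≠ 0)
    (hD : ∀ z, z ≠ 0 → DifferentiableAt ℂ D z)
    (hs : s = 1 ∨ s = -1) (hL : 0 < L) (hM : p / (2 * L) < M) :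
    ∃ (ζ : ℕ → ℂ) (n₁ : ℕ) (R₁ : ℝ),
      Tendsto (fun n => ζ n - approxZero C L p s n) atTop (𝓝 0) ∧
      Tendsto (fun n => ‖ζ n‖) atTop atTop ∧
      (∀ n, n₁ ≤ n → D (ζ n) = 0 ∧ ζ n ∈ logRegion M ∧ 0 < s * (ζ n).re ∧ deriv D (ζ n) ≠ 0 ∧
        ‖ζ n‖ < ‖ζ (n + 1)‖) ∧
      ∀ z, D z = 0 → z ∈ logRegion M → R₁ < ‖z‖ → 0 ≤ s * z.re → ∃ n, n₁ ≤ n ∧ z = ζ n := by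
  set δ₀ : ℝ := min (1 / 2) (1 / (64 * L)) with hδ₀
  have hδ0 : 0 < δ₀ := lt_min (by norm_num) (by positivity)
  have small : ∀ δ, 0 < δ → δ ≤ δ₀ → δ ≤ 1 / 2 ∧ 64 * L * δ ≤ 1 := by
    intro δ _ h2
    refine ⟨h2.trans (min_le_left _ _), ?_⟩
    have := h2.trans (min_le_right _ _)
    rwa [le_div_iff₀ (by positivity), mul_comm] at this
  have key : ∀ δ, 0 < δ → δ ≤ δ₀ → _ := fun δ h1 h2 =>
    h.eventually_unique_zero hC hD hs hL hM h1 (small δ h1 h2).1 (small δ h1 h2).2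
  have h0 := key δ₀ hδ0 le_rfl
  have hex : ∀ n, ∃ z, (∃ z, ‖z - approxZero C L p s n‖ ≤ δ₀ ∧ D z = 0) →
      ‖z - approxZero C L p s n‖ ≤ δ₀ ∧ D z = 0 := fun n => by
    by_cases hn : ∃ z, ‖z - approxZero C L p s n‖ ≤ δ₀ ∧ D z = 0
    · exact ⟨hn.choose, fun _ => hn.choose_spec⟩
    · exact ⟨0, fun h => absurd h hn⟩
  choose ζ hζ using hex
  have hlim : Tendsto (fun n => ζ n - approxZero C L p s n) atTop (𝓝 0) := by
    rw [Metric.tendsto_nhds]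
    intro ε hε
    have hδ : 0 < min δ₀ (ε / 2) := lt_min hδ0 (by linarith)
    filter_upwards [h0, key (min δ₀ (ε / 2)) hδ (min_le_left _ _)] with n h1 h2
    obtain ⟨z, hz, hz0⟩ := h2.1
    have h3 := hζ n h1.1
    have h4 : ζ n = z := h1.2.1 _ _ h3.1 (hz.trans (min_le_left _ _)) h3.2 hz0
    rw [dist_zero_right, h4]
    exact lt_of_le_of_lt (hz.trans (min_le_right _ _)) (by linarith)
  obtain ⟨hretop, hmono⟩ := eventually_norm_lt_norm_succ hs hL hlim
  have hreg : ∀ᶠ n in atTop, ∀ z : ℂ, ‖z - approxZero C L p s n‖ ≤ 1 → z ∈ logRegion M := by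
    have h1 : ∀ᶠ q in indexFilter, approxZero C L p s q.1 + q.2 ∈ logRegion M :=
      (tendsto_approxZero (C := C) hs hL hM).eventually
        (mem_inf_of_right (mem_principal_self (logRegion M)))
    filter_upwards [eventually_prod_principal_iff.1 h1] with n hn z hz
    simpa using hn (z - approxZero C L p s n) (by simpa using hz)
  have hn₁ : ∀ᶠ n in atTop, D (ζ n) = 0 ∧ ζ n ∈ logRegion M ∧ 0 < s * (ζ n).re ∧
      deriv D (ζ n) ≠ 0 ∧ ‖ζ n‖ < ‖ζ (n + 1)‖ ∧
      ∀ z, ‖z - approxZero C L p s n‖ ≤ δ₀ → D z = 0 → z = ζ n := by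
    filter_upwards [h0, hreg, hmono, hretop.eventually_gt_atTop 0] with n h1 h2 h3 h4
    have h5 := hζ n h1.1
    exact ⟨h5.2, h2 _ (h5.1.trans ((small δ₀ hδ0 le_rfl).1.trans (by norm_num))), h4,
      h1.2.2 _ h5.1, h3, fun z hz hz0 => h1.2.1 _ _ hz h5.1 hz0 h5.2⟩
  obtain ⟨n₁, hn₁⟩ := eventually_atTop.1 hn₁
  have hloc := eventually_near_approxZero (F := (logFilter M ⊓ 𝓟 {z | D z = 0}) ⊓
    𝓟 {z | 0 ≤ s * z.re}) (C := C) (s := s) (p := p)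
    (inf_le_left.trans (inf_le_left.trans (logFilter_le M))) hC hs hL
    (h.tendsto_oscillation.mono_left inf_le_left)
    (mem_inf_of_right (mem_principal_self _)) hδ0 n₁
  rw [eventually_inf_principal, eventually_inf_principal, logFilter, eventually_inf_principal]
    at hloc
  obtain ⟨R₁, -, hR₁⟩ := (Filter.hasBasis_cobounded_norm (E := ℂ)).eventually_iff.1 hloc
  refine ⟨ζ, n₁, R₁, hlim, ?_, fun n hn => ?_, fun z h1 h2 h3 h4 => ?_⟩
  · refine tendsto_atTop_mono (fun n => ?_) hretop
    refine (le_abs_self _).trans ?_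
    rw [abs_mul]
    have : |s| = 1 := by rcases hs with rfl | rfl <;> norm_num
    rw [this, one_mul]
    exact Complex.abs_re_le_norm _
  · obtain ⟨h1, h2, h3, h4, h5, -⟩ := hn₁ n hn
    exact ⟨h1, h2, h3, h4, h5⟩
  · obtain ⟨n, hn, hz⟩ := hR₁ (x := z) h3.le h2 h1 h4
    exact ⟨n, hn, (hn₁ n hn).2.2.2.2.2 z hz h1⟩

theorem exists_index_iff {ζ : ℕ → ℂ} {n₁ : ℕ} {R : ℝ} (htop : Tendsto (fun n => ‖ζ n‖) atTop atTop)
    (hmono : ∀ n, n₁ ≤ n → ‖ζ n‖ < ‖ζ (n + 1)‖) (hR : ‖ζ n₁‖ ≤ R) :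
    ∃ n₂, n₁ ≤ n₂ ∧ ∀ n, n₁ ≤ n → (R < ‖ζ n‖ ↔ n₂ < n) := by
  have hm : ∀ m n, n₁ ≤ m → m ≤ n → ‖ζ m‖ ≤ ‖ζ n‖ := by
    intro m n h1 h2
    induction n, h2 using Nat.le_induction with
    | base => exact le_rfl
    | succ n h3 ih => exact ih.trans (hmono n (h1.trans h3)).le
  have hex : ∃ n, n₁ ≤ n ∧ R < ‖ζ n‖ :=
    ((eventually_ge_atTop n₁).and (htop.eventually_gt_atTop R)).exists
  classical
  set N := Nat.find hex with hN
  have hN1 := Nat.find_spec hex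
  rw [← hN] at hN1
  have hlt : n₁ < N := lt_of_le_of_ne hN1.1 fun h => by
    rw [← h] at hN1
    linarith [hN1.2]
  refine ⟨N - 1, by omega, fun n hn => ⟨fun h => ?_, fun h => ?_⟩⟩
  · have := Nat.find_min' hex ⟨hn, h⟩
    omega
  · exact hN1.2.trans_le (hm N n hN1.1 (by omega))

/-- The zeros of a function asymptotic to `1 - C e^{2 i L z} (i z)^{-p}` in the logarithmic
region: apart from a bounded set they are simple and form two sequences. -/
theorem HasOscillation.exists_zeros (h : HasOscillation D C L p M) (hC : C ≠ 0)
    (hD : ∀ z, z ≠ 0 → DifferentiableAt ℂ D z) (hL : 0 < L) (hM : p / (2 * L) < M) :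
    ∃ (R : ℝ) (Npos Nneg : ℕ) (lam : ℤ → ℂ), 0 < R ∧
      Set.BijOn lam {n : ℤ | (Npos : ℤ) < n ∨ n < -(Nneg : ℤ)}
        {z : ℂ | D z = 0 ∧ z ∈ logRegion M ∧ R < ‖z‖} ∧
      (∀ z : ℂ, D z = 0 → z ∈ logRegion M → R < ‖z‖ → deriv D z ≠ 0) ∧
      Tendsto (fun n : ℕ => lam n - approxZero C L p 1 n) atTop (𝓝 0) ∧
      Tendsto (fun n : ℕ => lam (-(n : ℤ)) - approxZero C L p (-1) n) atTop (𝓝 0) := by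
  obtain ⟨ζ, n₁, R₁, h1, h2, h3, h4⟩ := h.exists_sequence hC hD (s := 1) (.inl rfl) hL hM
  obtain ⟨ξ, m₁, R₂, k1, k2, k3, k4⟩ := h.exists_sequence hC hD (s := -1) (.inr rfl) hL hM
  set R := max (max 1 (max R₁ R₂)) (max ‖ζ n₁‖ ‖ξ m₁‖) with hR
  have r0 : 1 ≤ R := (le_max_left _ _).trans (le_max_left _ _)
  have r1 : R₁ ≤ R := ((le_max_left _ _).trans (le_max_right _ _)).trans (le_max_left _ _)
  have r2 : R₂ ≤ R := ((le_max_right _ _).trans (le_max_right _ _)).trans (le_max_left _ _)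
  obtain ⟨N, hN, hN'⟩ := exists_index_iff h2 (fun n hn => (h3 n hn).2.2.2.2) (R := R)
    ((le_max_left _ _).trans (le_max_right _ _))
  obtain ⟨K, hK, hK'⟩ := exists_index_iff k2 (fun n hn => (k3 n hn).2.2.2.2) (R := R)
    ((le_max_right _ _).trans (le_max_right _ _))
  have hinj : ∀ {θ : ℕ → ℂ} {l : ℕ}, (∀ n, l ≤ n → ‖θ n‖ < ‖θ (n + 1)‖) →
      ∀ m n, l ≤ m → l ≤ n → θ m = θ n → m = n := by
    intro θ l hθ
    have hlt : ∀ m n, l ≤ m → m < n → ‖θ m‖ < ‖θ n‖ := by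
      intro m n h1 h2
      induction n, h2 using Nat.le_induction with
      | base => exact hθ m h1
      | succ n h3 ih => exact ih.trans (hθ n (by omega))
    intro m n hm hn he
    rcases lt_trichotomy m n with h5 | h5 | h5
    · exact absurd (hlt m n hm h5) (by rw [he]; exact lt_irrefl _)
    · exact h5
    · exact absurd (hlt n m hn h5) (by rw [he]; exact lt_irrefl _)
  have hcase : ∀ z, D z = 0 → z ∈ logRegion M → R < ‖z‖ →
      (∃ n, N < n ∧ z = ζ n) ∨ ∃ n, K < n ∧ z = ξ n := by
    intro z z1 z2 z3
    rcases le_total 0 z.re with z4 | z4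
    · obtain ⟨n, hn, rfl⟩ := h4 z z1 z2 (r1.trans_lt z3) (by simpa using z4)
      exact .inl ⟨n, (hN' n hn).1 z3, rfl⟩
    · obtain ⟨n, hn, rfl⟩ := k4 z z1 z2 (r2.trans_lt z3) (by simpa using z4)
      exact .inr ⟨n, (hK' n hn).1 z3, rfl⟩
  set lam : ℤ → ℂ := fun n => if 0 < n then ζ n.toNat else ξ (-n).toNat with hlam
  have lam_pos : ∀ n : ℕ, 0 < n → lam n = ζ n := fun n hn => by
    simp only [hlam]
    rw [if_pos (by exact_mod_cast hn), Int.toNat_natCast]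
  have lam_neg : ∀ n : ℕ, lam (-n) = ξ n := fun n => by
    simp only [hlam]
    rw [if_neg (by simp), neg_neg, Int.toNat_natCast]
  have hidx : ∀ n : ℤ, ((N : ℤ) < n ∨ n < -(K : ℤ)) →
      (∃ m : ℕ, N < m ∧ n = m) ∨ ∃ m : ℕ, K < m ∧ n = -m := by
    rintro n (hn | hn)
    · exact .inl ⟨n.toNat, by omega, by omega⟩
    · exact .inr ⟨(-n).toNat, by omega, by omega⟩
  refine ⟨R, N, K, lam, by linarith, ⟨?_, ?_, ?_⟩, ?_, ?_, ?_⟩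
  · intro n hn
    rcases hidx n hn with ⟨m, hm, rfl⟩ | ⟨m, hm, rfl⟩
    · rw [lam_pos m (by omega)]
      have h5 := h3 m (by omega)
      exact ⟨h5.1, h5.2.1, (hN' m (by omega)).2 hm⟩
    · rw [lam_neg m]
      have h5 := k3 m (by omega)
      exact ⟨h5.1, h5.2.1, (hK' m (by omega)).2 hm⟩
  · intro n hn n' hn' he
    rcases hidx n hn with ⟨m, hm, rfl⟩ | ⟨m, hm, rfl⟩ <;>
    rcases hidx n' hn' with ⟨m', hm', rfl⟩ | ⟨m', hm', rfl⟩
    · rw [lam_pos m (by omega), lam_pos m' (by omega)] at he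
      rw [hinj (fun n hn => (h3 n hn).2.2.2.2) m m' (by omega) (by omega) he]
    · rw [lam_pos m (by omega), lam_neg m'] at he
      have h5 := (h3 m (by omega)).2.2.1
      have h6 := (k3 m' (by omega)).2.2.1
      rw [he] at h5
      linarith
    · rw [lam_neg m, lam_pos m' (by omega)] at he
      have h5 := (h3 m' (by omega)).2.2.1
      have h6 := (k3 m (by omega)).2.2.1
      rw [he] at h6
      linarith
    · rw [lam_neg m, lam_neg m'] at he
      rw [hinj (fun n hn => (k3 n hn).2.2.2.2) m m' (by omega) (by omega) he]
  · rintro z ⟨z1, z2, z3⟩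
    rcases hcase z z1 z2 z3 with ⟨n, hn, rfl⟩ | ⟨n, hn, rfl⟩
    · exact ⟨n, .inl (by exact_mod_cast hn), lam_pos n (by omega)⟩
    · exact ⟨-n, .inr (by omega), lam_neg n⟩
  · intro z z1 z2 z3
    rcases hcase z z1 z2 z3 with ⟨n, hn, rfl⟩ | ⟨n, hn, rfl⟩
    · exact (h3 n (by omega)).2.2.2.1
    · exact (k3 n (by omega)).2.2.2.1
  · refine h1.congr' ?_
    filter_upwards [eventually_gt_atTop 0] with n hn
    rw [lam_pos n hn]
  · exact k1.congr fun n => by rw [lam_neg n]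

end zeros

/-! ### Integral operators on `L²(ℝ)` with exponentially decaying kernels -/

section kernelOp

theorem integrable_exp_neg_abs : Integrable fun t : ℝ => Real.exp (-|t|) := by
  have h1 : IntegrableOn (fun t : ℝ => Real.exp (-|t|)) (Set.Iic 0) :=
    (integrableOn_exp_Iic 0).congr_fun (fun t ht => by
      simp only [abs_of_nonpos (Set.mem_Iic.1 ht), neg_neg]) measurableSet_Iic
  have h2 : IntegrableOn (fun t : ℝ => Real.exp (-|t|)) (Set.Ioi 0) :=
    (integrableOn_exp_neg_Ioi 0).congr_fun (fun t ht => by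
      simp only [abs_of_pos (Set.mem_Ioi.1 ht)]) measurableSet_Ioi
  rw [← integrableOn_univ, ← Set.Iic_union_Ioi (a := (0 : ℝ))]
  exact h1.union h2

/-- The total mass of the weight `e^{-|t|}`. -/
def weightMass : ENNReal := ∫⁻ t : ℝ, ENNReal.ofReal (Real.exp (-|t|))

theorem weightMass_ne_top : weightMass ≠ ⊤ :=
  integrable_exp_neg_abs.lintegral_lt_top.ne

theorem lintegral_weight_left (x : ℝ) :
    ∫⁻ y : ℝ, ENNReal.ofReal (Real.exp (-|x - y|)) = weightMass :=
  lintegral_sub_left_eq_self (fun t : ℝ => ENNReal.ofReal (Real.exp (-|t|))) x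

theorem lintegral_weight_right (y : ℝ) :
    ∫⁻ x : ℝ, ENNReal.ofReal (Real.exp (-|x - y|)) = weightMass :=
  lintegral_sub_right_eq_self (fun t : ℝ => ENNReal.ofReal (Real.exp (-|t|))) y

/-- Schur's test for the weight `e^{-|x - y|}`. -/
theorem lintegral_weight_mul_sq_le {g : ℝ → ENNReal} (hg : AEMeasurable g) :
    ∫⁻ x : ℝ, (∫⁻ y : ℝ, ENNReal.ofReal (Real.exp (-|x - y|)) * g y) ^ (2 : ℝ) ≤
      weightMass ^ (2 : ℝ) * ∫⁻ y, g y ^ (2 : ℝ) := by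
  set h : ℝ → ENNReal := fun t => ENNReal.ofReal (Real.exp (-|t| / 2)) with hh
  have hsq : ∀ t, h t ^ (2 : ℝ) = ENNReal.ofReal (Real.exp (-|t|)) := fun t => by
    simp only [hh]
    rw [ENNReal.rpow_ofNat, ← ENNReal.ofReal_pow (Real.exp_pos _).le, ← Real.exp_nat_mul]
    congr 2
    push_cast
    ring
  have hmeas : Measurable h := by fun_prop
  have key : ∀ x : ℝ, (∫⁻ y : ℝ, ENNReal.ofReal (Real.exp (-|x - y|)) * g y) ^ (2 : ℝ) ≤
      weightMass * ∫⁻ y : ℝ, ENNReal.ofReal (Real.exp (-|x - y|)) * g y ^ (2 : ℝ) := by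
    intro x
    have h1 := ENNReal.lintegral_mul_le_Lp_mul_Lq volume Real.HolderConjugate.two_two
      (f := fun y => h (x - y)) (g := fun y => h (x - y) * g y)
      (by fun_prop) ((by fun_prop : AEMeasurable fun y => h (x - y)).mul hg)
    have h2 : ∀ y, ((fun y => h (x - y)) * fun y => h (x - y) * g y) y =
        ENNReal.ofReal (Real.exp (-|x - y|)) * g y := fun y => by
      rw [← hsq, ENNReal.rpow_ofNat, Pi.mul_apply]; ring
    simp_rw [h2, ENNReal.mul_rpow_of_nonneg _ _ zero_le_two, hsq, lintegral_weight_left] at h1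
    refine (ENNReal.rpow_le_rpow h1 zero_le_two).trans (le_of_eq ?_)
    rw [ENNReal.mul_rpow_of_nonneg _ _ zero_le_two, ← ENNReal.rpow_mul, ← ENNReal.rpow_mul]
    norm_num
  refine (lintegral_mono key).trans ?_
  rw [lintegral_const_mul' _ _ weightMass_ne_top, lintegral_lintegral_swap]
  · have h3 : ∀ y : ℝ, ∫⁻ x : ℝ, ENNReal.ofReal (Real.exp (-|x - y|)) * g y ^ (2 : ℝ) =
        weightMass * g y ^ (2 : ℝ) := fun y => by
      rw [lintegral_mul_const _ (by fun_prop), lintegral_weight_right]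
    simp_rw [h3]
    rw [lintegral_const_mul' _ _ weightMass_ne_top, ← mul_assoc, ENNReal.rpow_ofNat, sq]
  · have h4 : AEMeasurable (fun q : ℝ × ℝ => g q.2) (volume.prod volume) := hg.comp_snd
    exact (by fun_prop : AEMeasurable (fun q : ℝ × ℝ => ENNReal.ofReal (Real.exp (-|q.1 - q.2|)))
      (volume.prod volume)).mul (h4.pow_const _)

/-- The integral operator with kernel `e^{-|x - y|} k (x, y)`, on functions. -/
def kernelIntegral (k : ℝ × ℝ →ᵇ ℂ) (f : ℝ → ℂ) (x : ℝ) : ℂ :=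
  ∫ y, ((Real.exp (-|x - y|) : ℝ) : ℂ) * k (x, y) * f y

variable (k : ℝ × ℝ →ᵇ ℂ) {f : ℝ → ℂ}

theorem enorm_kernel_le (x y : ℝ) : ‖((Real.exp (-|x - y|) : ℝ) : ℂ) * k (x, y) * f y‖ₑ ≤
    ENNReal.ofReal (Real.exp (-|x - y|)) * (‖k‖ₑ * ‖f y‖ₑ) := by
  rw [enorm_mul, enorm_mul, mul_assoc]
  gcongr
  · rw [← ofReal_norm, Complex.norm_real, Real.norm_of_nonneg (Real.exp_pos _).le]
  · rw [← ofReal_norm, ← ofReal_norm]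
    exact ENNReal.ofReal_le_ofReal (k.norm_coe_le_norm _)

theorem memLp_weight (x : ℝ) : MemLp (fun y : ℝ => ((Real.exp (-|x - y|) : ℝ) : ℂ)) 2 := by
  have h1 : Integrable (fun y : ℝ => ‖((Real.exp (-|x - y|) : ℝ) : ℂ)‖ ^ 2) := by
    refine ((integrable_exp_neg_abs.comp_sub_left x)).mono' (by fun_prop)
      (Eventually.of_forall fun y => ?_)
    rw [Complex.norm_real, Real.norm_of_nonneg (by positivity),
      Real.norm_of_nonneg (Real.exp_pos _).le, sq]
    refine mul_le_of_le_one_right (Real.exp_pos _).le ?_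
    rw [Real.exp_le_one_iff]
    exact neg_nonpos.2 (abs_nonneg _)
  exact (memLp_two_iff_integrable_sq_norm (by fun_prop)).2 h1

theorem integrable_kernel (hf : MemLp f 2) (x : ℝ) :
    Integrable fun y => ((Real.exp (-|x - y|) : ℝ) : ℂ) * k (x, y) * f y := by
  have h1 : Integrable fun y => ((Real.exp (-|x - y|) : ℝ) : ℂ) * f y :=
    (memLp_weight x).integrable_mul hf
  refine (h1.bdd_mul (c := ‖k‖) (f := fun y => k (x, y)) (by fun_prop)
    (Eventually.of_forall fun y => k.norm_coe_le_norm _)).congr (Eventually.of_forall fun y => ?_)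
  ring

theorem eLpNorm_kernelIntegral_le (hf : AEStronglyMeasurable f) :
    eLpNorm (kernelIntegral k f) 2 ≤ weightMass * ‖k‖ₑ * eLpNorm f 2 := by
  have h1 : ∀ x, ‖kernelIntegral k f x‖ₑ ≤
      ∫⁻ y : ℝ, ENNReal.ofReal (Real.exp (-|x - y|)) * (‖k‖ₑ * ‖f y‖ₑ) := fun x =>
    (enorm_integral_le_lintegral_enorm _).trans (lintegral_mono fun y => enorm_kernel_le k x y)
  rw [eLpNorm_eq_lintegral_rpow_enorm_toReal two_ne_zero ENNReal.ofNat_ne_top,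
    eLpNorm_eq_lintegral_rpow_enorm_toReal two_ne_zero ENNReal.ofNat_ne_top, ENNReal.toReal_ofNat]
  have h2 : ∫⁻ x, ‖kernelIntegral k f x‖ₑ ^ (2 : ℝ) ≤
      (weightMass * ‖k‖ₑ) ^ (2 : ℝ) * ∫⁻ y, ‖f y‖ₑ ^ (2 : ℝ) := by
    refine (lintegral_mono fun x => ENNReal.rpow_le_rpow (h1 x) zero_le_two).trans ?_
    refine (lintegral_weight_mul_sq_le (hf.enorm.const_mul _)).trans (le_of_eq ?_)
    simp_rw [ENNReal.mul_rpow_of_nonneg _ _ zero_le_two]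
    rw [lintegral_const_mul'' _ (hf.enorm.pow_const _), mul_assoc]
  refine (ENNReal.rpow_le_rpow h2 (by norm_num)).trans (le_of_eq ?_)
  rw [ENNReal.mul_rpow_of_nonneg _ _ (by norm_num), ← ENNReal.rpow_mul]
  norm_num

theorem aestronglyMeasurable_kernel (hf : AEStronglyMeasurable f) :
    AEStronglyMeasurable (fun q : ℝ × ℝ => ((Real.exp (-|q.1 - q.2|) : ℝ) : ℂ) * k q * f q.2)
      (volume.prod volume) :=
  AEStronglyMeasurable.mul (by fun_prop) hf.comp_snd

theorem memLp_kernelIntegral (hf : MemLp f 2) : MemLp (kernelIntegral k f) 2 := by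
  refine ⟨(aestronglyMeasurable_kernel k hf.1).integral_prod_right',
    (eLpNorm_kernelIntegral_le k hf.1).trans_lt ?_⟩
  exact ENNReal.mul_lt_top (ENNReal.mul_lt_top weightMass_ne_top.lt_top enorm_lt_top) hf.2

theorem kernelIntegral_congr {f g : ℝ → ℂ} (h : f =ᵐ[volume] g) :
    kernelIntegral k f = kernelIntegral k g := by
  funext x
  refine integral_congr_ae ?_
  filter_upwards [h] with y hy
  rw [hy]

/-- The integral operator on `L²(ℝ)` with kernel `e^{-|x - y|} k (x, y)`, as a function of `k`. -/
def kernelOp : (ℝ × ℝ →ᵇ ℂ) →L[ℂ] L2 →L[ℂ] L2 :=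
  LinearMap.mkContinuous₂
    (LinearMap.mk₂ ℂ (fun k f => (memLp_kernelIntegral k (Lp.memLp f)).toLp _)
      (fun k₁ k₂ f => by
        rw [← MemLp.toLp_add]
        refine MemLp.toLp_congr _ _ (Eventually.of_forall fun x => ?_)
        simp only [kernelIntegral, Pi.add_apply]
        rw [← integral_add (integrable_kernel k₁ (Lp.memLp f) x)
          (integrable_kernel k₂ (Lp.memLp f) x)]
        refine integral_congr_ae (Eventually.of_forall fun y => ?_)
        simp only [BoundedContinuousFunction.add_apply]
        ring)
      (fun c k f => by
        rw [← MemLp.toLp_const_smul]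
        refine MemLp.toLp_congr _ _ (Eventually.of_forall fun x => ?_)
        simp only [kernelIntegral, Pi.smul_apply, smul_eq_mul]
        rw [← integral_const_mul]
        refine integral_congr_ae (Eventually.of_forall fun y => ?_)
        simp only [BoundedContinuousFunction.smul_apply, smul_eq_mul]
        ring)
      (fun k f g => by
        rw [← MemLp.toLp_add]
        refine MemLp.toLp_congr _ _ (Eventually.of_forall fun x => ?_)
        rw [kernelIntegral_congr k (Lp.coeFn_add f g)]
        simp only [kernelIntegral, Pi.add_apply]
        rw [← integral_add (integrable_kernel k (Lp.memLp f) x)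
          (integrable_kernel k (Lp.memLp g) x)]
        refine integral_congr_ae (Eventually.of_forall fun y => ?_)
        ring)
      (fun c k f => by
        rw [← MemLp.toLp_const_smul]
        refine MemLp.toLp_congr _ _ (Eventually.of_forall fun x => ?_)
        rw [kernelIntegral_congr k (Lp.coeFn_smul c f)]
        simp only [kernelIntegral, Pi.smul_apply, smul_eq_mul]
        rw [← integral_const_mul]
        refine integral_congr_ae (Eventually.of_forall fun y => ?_)
        ring))
    weightMass.toReal (fun k f => by
      rw [LinearMap.mk₂_apply, Lp.norm_toLp, Lp.norm_def]
      refine (ENNReal.toReal_mono ?_ (eLpNorm_kernelIntegral_le k (Lp.memLp f).1)).trans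
        (le_of_eq ?_)
      · exact ENNReal.mul_ne_top (ENNReal.mul_ne_top weightMass_ne_top enorm_ne_top)
          (Lp.eLpNorm_ne_top f)
      · rw [ENNReal.toReal_mul, ENNReal.toReal_mul, toReal_enorm])

theorem coeFn_kernelOp (f : L2) : kernelOp k f =ᵐ[volume] kernelIntegral k f :=
  (memLp_kernelIntegral k (Lp.memLp f)).coeFn_toLp

theorem coeFn_cutoff (ρ : ℝ) (f : L2) :
    cutoff ρ f =ᵐ[volume] (Set.Icc (-ρ) ρ).indicator f :=
  ((Lp.memLp f).indicator measurableSet_Icc).coeFn_toLp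

theorem coeFn_cutoff_kernelOp (ρ : ℝ) (f : L2) :
    (cutoff ρ).comp ((kernelOp k).comp (cutoff ρ)) f =ᵐ[volume]
      (Set.Icc (-ρ) ρ).indicator (kernelIntegral k ((Set.Icc (-ρ) ρ).indicator f)) := by
  filter_upwards [coeFn_cutoff ρ (kernelOp k (cutoff ρ f)), coeFn_kernelOp k (cutoff ρ f)]
    with x h1 h2
  have h3 : (cutoff ρ).comp ((kernelOp k).comp (cutoff ρ)) f x =
    cutoff ρ (kernelOp k (cutoff ρ f)) x := rfl
  rw [h3, h1]
  by_cases hx : x ∈ Set.Icc (-ρ) ρ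
  · rw [Set.indicator_of_mem hx, Set.indicator_of_mem hx, h2,
      kernelIntegral_congr k (coeFn_cutoff ρ f)]
  · rw [Set.indicator_of_notMem hx, Set.indicator_of_notMem hx]

/-- The cut-off operator only depends on the values of the kernel on the square. -/
theorem cutoff_kernelOp_congr {ρ : ℝ} {k k' : ℝ × ℝ →ᵇ ℂ}
    (h : ∀ x ∈ Set.Icc (-ρ) ρ, ∀ y ∈ Set.Icc (-ρ) ρ, k (x, y) = k' (x, y)) :
    (cutoff ρ).comp ((kernelOp k).comp (cutoff ρ)) =
      (cutoff ρ).comp ((kernelOp k').comp (cutoff ρ)) := by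
  refine ContinuousLinearMap.ext fun f => Lp.ext ?_
  filter_upwards [coeFn_cutoff_kernelOp k ρ f, coeFn_cutoff_kernelOp k' ρ f] with x h1 h2
  rw [h1, h2]
  by_cases hx : x ∈ Set.Icc (-ρ) ρ
  · rw [Set.indicator_of_mem hx, Set.indicator_of_mem hx]
    refine integral_congr_ae (Eventually.of_forall fun y => ?_)
    by_cases hy : y ∈ Set.Icc (-ρ) ρ
    · simp only [h x hx y hy]
    · simp only [Set.indicator_of_notMem hy, mul_zero]
  · rw [Set.indicator_of_notMem hx, Set.indicator_of_notMem hx]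

/-- A cut-off kernel of product form `c v(x) v(y)` gives an operator of rank at most one. -/
theorem rank_cutoff_kernelOp_le {ρ : ℝ} {c : ℂ} {v : ℝ → ℂ} (hv : Continuous v)
    (h : ∀ x ∈ Set.Icc (-ρ) ρ, ∀ y ∈ Set.Icc (-ρ) ρ,
      ((Real.exp (-|x - y|) : ℝ) : ℂ) * k (x, y) = c * (v x * v y)) :
    LinearMap.rank ((cutoff ρ).comp ((kernelOp k).comp (cutoff ρ))).toLinearMap ≤ 1 := by
  have hmem : MemLp ((Set.Icc (-ρ) ρ).indicator v) 2 := by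
    obtain ⟨B, hB⟩ := isCompact_Icc.exists_bound_of_continuousOn (s := Set.Icc (-ρ) ρ)
      hv.continuousOn
    rw [memLp_indicator_iff_restrict measurableSet_Icc]
    refine MemLp.of_bound hv.aestronglyMeasurable B ?_
    filter_upwards [ae_restrict_mem measurableSet_Icc] with x hx using hB x hx
  have hrange : ∀ f : L2, ∃ α : ℂ, (cutoff ρ).comp ((kernelOp k).comp (cutoff ρ)) f =
      α • hmem.toLp _ := by
    intro f
    refine ⟨c * ∫ y, v y * (Set.Icc (-ρ) ρ).indicator f y, Lp.ext ?_⟩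
    filter_upwards [coeFn_cutoff_kernelOp k ρ f, Lp.coeFn_smul
      (c * ∫ y, v y * (Set.Icc (-ρ) ρ).indicator f y) (hmem.toLp _), hmem.coeFn_toLp] with x h1 h2 h3
    rw [h1, h2, Pi.smul_apply, h3, smul_eq_mul]
    by_cases hx : x ∈ Set.Icc (-ρ) ρ
    · rw [Set.indicator_of_mem hx, Set.indicator_of_mem hx, mul_right_comm,
        ← integral_const_mul]
      refine integral_congr_ae (Eventually.of_forall fun y => ?_)
      by_cases hy : y ∈ Set.Icc (-ρ) ρ
      · simp only [h x hx y hy]; ring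
      · simp only [Set.indicator_of_notMem hy, mul_zero]
    · rw [Set.indicator_of_notMem hx, Set.indicator_of_notMem hx, mul_zero]
  refine (Submodule.rank_mono (t := Submodule.span ℂ {hmem.toLp _}) ?_).trans ?_
  · rintro _ ⟨f, rfl⟩
    obtain ⟨α, hα⟩ := hrange f
    exact Submodule.mem_span_singleton.2 ⟨α, hα.symm⟩
  · exact (rank_span_le _).trans (by simp)

/-- A cut-off kernel of product form `c v(x) v(y)` gives a nonzero operator. -/
theorem cutoff_kernelOp_ne_zero {ρ : ℝ} {c : ℂ} (hc : c ≠ 0) {v : ℝ → ℂ} (hv : Continuous v)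
    (h : ∀ x ∈ Set.Icc (-ρ) ρ, ∀ y ∈ Set.Icc (-ρ) ρ,
      ((Real.exp (-|x - y|) : ℝ) : ℂ) * k (x, y) = c * (v x * v y))
    {x₀ : ℝ} (hx₀ : x₀ ∈ Set.Ioo (-ρ) ρ) (hv₀ : v x₀ ≠ 0) :
    (cutoff ρ).comp ((kernelOp k).comp (cutoff ρ)) ≠ 0 := by
  intro h0
  set w : ℝ → ℂ := fun y => (starRingEnd ℂ) (v y) with hw
  have hwc : Continuous w := Complex.continuous_conj.comp hv
  have hmem : MemLp ((Set.Icc (-ρ) ρ).indicator w) 2 := by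
    obtain ⟨B, hB⟩ := isCompact_Icc.exists_bound_of_continuousOn (s := Set.Icc (-ρ) ρ)
      hwc.continuousOn
    rw [memLp_indicator_iff_restrict measurableSet_Icc]
    refine MemLp.of_bound hwc.aestronglyMeasurable B ?_
    filter_upwards [ae_restrict_mem measurableSet_Icc] with x hx using hB x hx
  set I : ℝ := ∫ y in Set.Icc (-ρ) ρ, ‖v y‖ ^ 2 with hI
  have hI0 : 0 < I := by
    rw [hI, integral_Icc_eq_integral_Ioc, ← intervalIntegral.integral_of_le
      (hx₀.1.trans hx₀.2).le]
    refine intervalIntegral.integral_pos (hx₀.1.trans hx₀.2) (by fun_prop)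
      (fun x _ => by positivity) ⟨x₀, ⟨hx₀.1.le, hx₀.2.le⟩, ?_⟩
    have := norm_pos_iff.2 hv₀
    positivity
  have h1 := coeFn_cutoff_kernelOp k ρ (hmem.toLp _)
  rw [h0] at h1
  have h2 : ∀ᵐ x : ℝ, x ∈ Set.Ioo (-ρ) ρ → v x = 0 := by
    have hz : (((0 : L2 →L[ℂ] L2) (hmem.toLp _) : L2) : ℝ → ℂ) =ᵐ[volume] 0 := by
      simpa using Lp.coeFn_zero ℂ 2 (volume : Measure ℝ)
    filter_upwards [h1, hz] with x h3 h4 hx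
    have hx' : x ∈ Set.Icc (-ρ) ρ := ⟨hx.1.le, hx.2.le⟩
    rw [h4, Set.indicator_of_mem hx'] at h3
    have h5 : kernelIntegral k ((Set.Icc (-ρ) ρ).indicator (hmem.toLp _)) x = c * v x * I := by
      have e1 : (Set.Icc (-ρ) ρ).indicator (hmem.toLp _) =ᵐ[volume]
          (Set.Icc (-ρ) ρ).indicator w := by
        filter_upwards [hmem.coeFn_toLp] with y hy
        by_cases hy' : y ∈ Set.Icc (-ρ) ρ
        · rw [Set.indicator_of_mem hy', hy]
        · rw [Set.indicator_of_notMem hy', Set.indicator_of_notMem hy']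
      rw [kernelIntegral_congr k e1, hI, ← integral_complex_ofReal, ← integral_const_mul,
        ← integral_indicator measurableSet_Icc]
      refine integral_congr_ae (Eventually.of_forall fun y => ?_)
      by_cases hy : y ∈ Set.Icc (-ρ) ρ
      · simp only [Set.indicator_of_mem hy, h x hx' y hy, hw]
        have := Complex.mul_conj' (v y)
        push_cast
        linear_combination c * v x * this
      · simp only [Set.indicator_of_notMem hy, mul_zero]
    rw [h5] at h3
    have hIc : (I : ℂ) ≠ 0 := by exact_mod_cast hI0.ne'
    have h6 : c * v x * I = 0 := h3.symm
    simpa [hc, hIc] using h6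
  have h7 : ∀ x ∈ Set.Ioo (-ρ) ρ, v x = 0 := by
    have h8 : v =ᵐ[volume.restrict (Set.Ioo (-ρ) ρ)] 0 :=
      (ae_restrict_iff' measurableSet_Ioo).2 h2
    exact Measure.eqOn_open_of_ae_eq h8 isOpen_Ioo hv.continuousOn continuousOn_const
  exact hv₀ (h7 x₀ hx₀)

end kernelOp

/-! ### Weak solutions are classical solutions -/

section weak

theorem integrable_mul_of_hasCompactSupport {h φ : ℝ → ℂ} (hh : LocallyIntegrable h)
    (hφ : Continuous φ) (hc : HasCompactSupport φ) : Integrable fun x => h x * φ x :=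
  (hh.integrable_smul_left_of_hasCompactSupport hφ hc).congr
    (Eventually.of_forall fun x => by simp only [smul_eq_mul, mul_comm])

theorem HasCompactSupport.exists_Ioo {φ : ℝ → ℂ} (hc : HasCompactSupport φ) (y : ℝ) :
    ∃ R : ℝ, |y| < R ∧ ∀ x, R ≤ |x| → φ x = 0 := by
  obtain ⟨B, hB⟩ := hc.isCompact.isBounded.exists_norm_le
  refine ⟨max (B + 1) (|y| + 1), by linarith [le_max_right (B + 1) (|y| + 1)], fun x hx => ?_⟩
  by_contra h
  have := hB x (subset_tsupport _ h)
  rw [Real.norm_eq_abs] at this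
  linarith [le_max_left (B + 1) (|y| + 1)]

theorem integral_eq_intervalIntegral {f : ℝ → ℂ} {R : ℝ} (hR : 0 ≤ R)
    (h : ∀ x, R ≤ |x| → f x = 0) : ∫ x, f x = ∫ x in (-R)..R, f x := by
  rw [intervalIntegral.integral_of_le (by linarith),
    setIntegral_eq_integral_of_forall_compl_eq_zero fun x hx => h x ?_]
  by_contra hlt
  rw [not_le, abs_lt] at hlt
  exact hx ⟨hlt.1, hlt.2.le⟩

/-- A test function of mean zero is the derivative of a test function. -/
theorem exists_primitive_of_integral_eq_zero {η : ℝ → ℂ} (hη : ContDiff ℝ ∞ η)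
    (hc : HasCompactSupport η) (h0 : ∫ x, η x = 0) :
    ∃ φ : ℝ → ℂ, ContDiff ℝ ∞ φ ∧ HasCompactSupport φ ∧ deriv φ = η := by
  obtain ⟨R, hR, hR'⟩ := HasCompactSupport.exists_Ioo hc 0
  rw [abs_zero] at hR
  have hd : ∀ x, HasDerivAt (fun x => ∫ t in (-R)..x, η t) (η x) x := fun x =>
    intervalIntegral.integral_hasDerivAt_right (hη.continuous.intervalIntegrable _ _)
      (hη.continuous.stronglyMeasurableAtFilter _ _) hη.continuous.continuousAt
  have hd' : deriv (fun x => ∫ t in (-R)..x, η t) = η := funext fun x => (hd x).deriv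
  refine ⟨fun x => ∫ t in (-R)..x, η t, ?_, ?_, hd'⟩
  · refine contDiff_infty_iff_deriv.2 ⟨fun x => (hd x).differentiableAt, ?_⟩
    rw [hd']
    exact hη
  · refine HasCompactSupport.of_support_subset_isCompact (isCompact_Icc (a := -R) (b := R)) ?_
    intro x hx
    by_contra hx'
    refine hx ?_
    rw [Set.mem_Icc, not_and_or, not_le, not_le] at hx'
    rcases hx' with hx' | hx'
    · refine intervalIntegral.integral_zero_ae (Eventually.of_forall fun t ht => hR' t ?_)
      rw [Set.uIoc_of_ge hx'.le] at ht
      rw [abs_of_nonpos (by linarith [ht.2])]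
      linarith [ht.2]
    · change ∫ t in (-R)..x, η t = 0
      rw [← intervalIntegral.integral_add_adjacent_intervals
        (hη.continuous.intervalIntegrable (-R) R) (hη.continuous.intervalIntegrable R x),
        ← integral_eq_intervalIntegral hR.le hR', h0, zero_add]
      refine intervalIntegral.integral_zero_ae (Eventually.of_forall fun t ht => hR' t ?_)
      rw [Set.uIoc_of_le hx'.le] at ht
      exact ht.1.le.trans (le_abs_self t)

theorem exists_test_function_integral_eq_one :
    ∃ θ : ℝ → ℂ, ContDiff ℝ ∞ θ ∧ HasCompactSupport θ ∧ ∫ x, θ x = 1 := by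
  set b : ContDiffBump (0 : ℝ) := default
  refine ⟨fun x => ((b.normed volume x : ℝ) : ℂ), ?_, ?_, ?_⟩
  · exact Complex.ofRealCLM.contDiff.comp b.contDiff_normed
  · exact b.hasCompactSupport_normed.comp_left (g := fun x : ℝ => (x : ℂ)) Complex.ofReal_zero
  · rw [integral_complex_ofReal, b.integral_normed, Complex.ofReal_one]

variable {h : ℝ → ℂ}

/-- The lemma of du Bois-Reymond: a function with vanishing weak derivative is constant. -/
theorem ae_eq_const_of_integral_deriv_eq_zero (hh : LocallyIntegrable h)
    (h0 : ∀ φ : ℝ → ℂ, ContDiff ℝ ∞ φ → HasCompactSupport φ → ∫ x, h x * deriv φ x = 0) :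
    ∃ c : ℂ, h =ᵐ[volume] fun _ => c := by
  obtain ⟨θ, hθ, hθc, hθ1⟩ := exists_test_function_integral_eq_one
  refine ⟨∫ x, h x * θ x, ae_eq_of_integral_contDiff_smul_eq hh
    (continuous_const.locallyIntegrable) fun g hg hgc => ?_⟩
  set ψ : ℝ → ℂ := fun x => (g x : ℂ) with hψ
  have hψs : ContDiff ℝ ∞ ψ := Complex.ofRealCLM.contDiff.comp hg
  have hψc : HasCompactSupport ψ := hgc.comp_left (g := fun x : ℝ => (x : ℂ)) Complex.ofReal_zero
  have hψi := hψs.continuous.integrable_of_hasCompactSupport (μ := volume) hψc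
  have hθi := hθ.continuous.integrable_of_hasCompactSupport (μ := volume) hθc
  set m := ∫ x, ψ x with hm
  obtain ⟨φ, φ1, φ2, φ3⟩ := exists_primitive_of_integral_eq_zero
    (η := fun x => ψ x - m * θ x) (hψs.sub (contDiff_const.mul hθ)) (hψc.sub (hθc.mul_left))
    (by rw [integral_sub hψi (hθi.const_mul m), integral_const_mul, hθ1, mul_one, sub_self])
  have h1 := h0 φ φ1 φ2
  rw [φ3] at h1
  have i1 := integrable_mul_of_hasCompactSupport hh hψs.continuous hψc
  have i2 := integrable_mul_of_hasCompactSupport hh hθ.continuous hθc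
  have h2 : ∫ x, h x * (ψ x - m * θ x) = (∫ x, h x * ψ x) - m * ∫ x, h x * θ x := by
    rw [← integral_const_mul, ← integral_sub i1 (i2.const_mul m)]
    congr 1
    funext x
    ring
  rw [h2, sub_eq_zero] at h1
  simp only [Complex.real_smul]
  rw [integral_mul_const, ← h1]
  congr 1
  funext x
  ring

/-- A function with vanishing second weak derivative is affine. -/
theorem ae_eq_affine_of_integral_deriv_deriv_eq_zero (hh : LocallyIntegrable h)
    (h0 : ∀ φ : ℝ → ℂ, ContDiff ℝ ∞ φ → HasCompactSupport φ →
      ∫ x, h x * deriv (deriv φ) x = 0) :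
    ∃ c d : ℂ, h =ᵐ[volume] fun x => c + d * x := by
  obtain ⟨θ, hθ, hθc, hθ1⟩ := exists_test_function_integral_eq_one
  set d : ℂ := -∫ x, h x * deriv θ x with hd
  have hlin : Continuous fun x : ℝ => d * x := by fun_prop
  have hdd : ∀ {φ : ℝ → ℂ}, ContDiff ℝ ∞ φ → ContDiff ℝ ∞ (deriv φ) := fun hφ =>
    (contDiff_infty_iff_deriv.1 hφ).2
  obtain ⟨c, hc⟩ := ae_eq_const_of_integral_deriv_eq_zero (h := fun x => h x - d * x)
    (hh.sub hlin.locallyIntegrable) (fun ψ hψ hψc => by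
      have hψi := hψ.continuous.integrable_of_hasCompactSupport (μ := volume) hψc
      have hθi := hθ.continuous.integrable_of_hasCompactSupport (μ := volume) hθc
      set m := ∫ x, ψ x with hm
      obtain ⟨φ, φ1, φ2, φ3⟩ := exists_primitive_of_integral_eq_zero
        (η := fun x => ψ x - m * θ x) (hψ.sub (contDiff_const.mul hθ)) (hψc.sub (hθc.mul_left))
        (by rw [integral_sub hψi (hθi.const_mul m), integral_const_mul, hθ1, mul_one, sub_self])
      have φ4 : deriv (deriv φ) = fun x => deriv ψ x - m * deriv θ x := by
        rw [φ3]
        funext x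
        have e1 : DifferentiableAt ℝ ψ x := hψ.differentiable (by simp) x
        have e2 : DifferentiableAt ℝ θ x := hθ.differentiable (by simp) x
        rw [deriv_fun_sub e1 (e2.const_mul m), deriv_const_mul_field]
      have h1 := h0 φ φ1 φ2
      rw [φ4] at h1
      have i1 := integrable_mul_of_hasCompactSupport hh (hdd hψ).continuous hψc.deriv
      have i2 := integrable_mul_of_hasCompactSupport hh (hdd hθ).continuous hθc.deriv
      have h2 : ∫ x, h x * (deriv ψ x - m * deriv θ x) =
          (∫ x, h x * deriv ψ x) - m * ∫ x, h x * deriv θ x := by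
        rw [← integral_const_mul, ← integral_sub i1 (i2.const_mul m)]
        congr 1
        funext x
        ring
      rw [h2] at h1
      have i3 := integrable_mul_of_hasCompactSupport hlin.locallyIntegrable (hdd hψ).continuous
        hψc.deriv
      have h3 : ∫ x : ℝ, d * x * deriv ψ x = -∫ x, d * ψ x := by
        refine integral_mul_deriv_eq_deriv_mul_of_integrable (u := fun x : ℝ => d * x)
          (u' := fun _ => d) (fun x _ => ?_)
          (fun x _ => (hψ.differentiable (by simp) x).hasDerivAt) i3 (hψi.const_mul d) ?_
        · simpa using (Complex.ofRealCLM.hasDerivAt (x := x)).const_mul d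
        · exact integrable_mul_of_hasCompactSupport hlin.locallyIntegrable hψ.continuous hψc
      have h4 : ∫ x, (h x - d * x) * deriv ψ x =
          (∫ x, h x * deriv ψ x) - ∫ x : ℝ, d * x * deriv ψ x := by
        rw [← integral_sub i1 i3]
        congr 1
        funext x
        ring
      rw [h4, h3, integral_const_mul]
      linear_combination h1 + m * hd)
  refine ⟨c, d, ?_⟩
  filter_upwards [hc] with x hx
  linear_combination hx

/-- Integration by parts against the primitive of a locally integrable function. -/
theorem integral_primitive_mul_deriv {g : ℝ → ℂ} (hg : LocallyIntegrable g) {φ : ℝ → ℂ}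
    (hφ : ContDiff ℝ ∞ φ) (hc : HasCompactSupport φ) :
    ∫ x, (∫ t in (0 : ℝ)..x, g t) * deriv φ x = -∫ x, g x * φ x := by
  obtain ⟨R, hR, hR'⟩ := HasCompactSupport.exists_Ioo hc 0
  rw [abs_zero] at hR
  have hφ' : Continuous (deriv φ) := (contDiff_infty_iff_deriv.1 hφ).2.continuous
  have hI : ∀ a b, IntervalIntegrable g volume a b := fun a b =>
    (intervalIntegrable_iff).2 ((hg.integrableOn_isCompact isCompact_uIcc).mono_set
      Set.uIoc_subset_uIcc)
  have hd : ∀ a b : ℝ, ∫ x in a..b, deriv φ x = φ b - φ a := fun a b =>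
    intervalIntegral.integral_deriv_eq_sub (fun x _ => hφ.differentiable (by simp) x)
      (hφ'.intervalIntegrable _ _)
  have hRz : ∀ x, R < |x| → deriv φ x = 0 := fun x hx => by
    have : φ =ᶠ[𝓝 x] fun _ => 0 := by
      filter_upwards [continuous_abs.continuousAt.eventually (lt_mem_nhds hx)] with y hy
      exact hR' y hy.le
    rw [this.deriv_eq, deriv_const]
  have hR1 : ∀ x, R + 1 ≤ |x| → deriv φ x = 0 := fun x hx => hRz x (by linarith)
  set Q := R + 1 with hQ
  have hQ0 : 0 ≤ Q := by linarith
  have hφQ : φ Q = 0 := hR' _ (by rw [abs_of_nonneg hQ0]; linarith)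
  have hφQ' : φ (-Q) = 0 := hR' _ (by rw [abs_neg, abs_of_nonneg hQ0]; linarith)
  rw [integral_eq_intervalIntegral hQ0 fun x hx => by rw [hR1 x hx, mul_zero],
    integral_eq_intervalIntegral hQ0 fun x hx => by
      rw [hR' x (by linarith : R ≤ |x|), mul_zero]]
  have h1 : ∀ x, (∫ t in (0 : ℝ)..x, g t) = (∫ t in (-Q)..x, g t) - ∫ t in (-Q)..0, g t :=
    fun x => by
      rw [← intervalIntegral.integral_add_adjacent_intervals (hI (-Q) 0) (hI 0 x)]; ring
  have hcont : Continuous fun x => ∫ t in (-Q)..x, g t :=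
    intervalIntegral.continuous_primitive hI _
  simp_rw [h1, sub_mul]
  have i0 : IntervalIntegrable (fun x => (∫ t in (-Q)..x, g t) * deriv φ x) volume (-Q) Q :=
    (hcont.mul hφ').intervalIntegrable _ _
  rw [intervalIntegral.integral_sub i0 ((hφ'.const_mul _).intervalIntegrable _ _), intervalIntegral.integral_const_mul, hd, hφQ, hφQ',
    sub_zero, mul_zero, sub_zero]
  -- exchange the order of integration over the triangle `y ≤ x`
  set μ : Measure ℝ := volume.restrict (Set.Ioc (-Q) Q) with hμ
  have hle : -Q ≤ Q := by linarith
  set F : ℝ → ℝ → ℂ := fun x y => {q : ℝ × ℝ | q.2 ≤ q.1}.indicator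
    (fun q => deriv φ q.1 * g q.2) (x, y) with hF
  have i1 : Integrable (deriv φ) μ := (hφ'.intervalIntegrable (-Q) Q).1
  have i2 : Integrable g μ := (hI (-Q) Q).1
  have hFi : Integrable (Function.uncurry F) (μ.prod μ) :=
    (i1.mul_prod i2).indicator (measurableSet_le measurable_snd measurable_fst)
  have hswap := integral_integral_swap hFi
  have e1 : ∀ x ∈ Set.Ioc (-Q) Q, ∫ y, F x y ∂μ = (∫ t in (-Q)..x, g t) * deriv φ x := by
    intro x hx
    have : ∀ y, F x y = (Set.Iic x).indicator (fun y => deriv φ x * g y) y := fun y => by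
      simp only [hF, Set.indicator_apply, Set.mem_ofPred_eq, Set.mem_Iic]
    simp_rw [this]
    rw [integral_indicator measurableSet_Iic, hμ, Measure.restrict_restrict measurableSet_Iic,
      Set.inter_comm, Set.Ioc_inter_Iic, min_eq_right hx.2, integral_const_mul,
      intervalIntegral.integral_of_le hx.1.le, mul_comm]
  have e2 : ∀ y ∈ Set.Ioc (-Q) Q, ∫ x, F x y ∂μ = -(g y * φ y) := by
    intro y hy
    have : ∀ x, F x y = (Set.Ici y).indicator (fun x => deriv φ x * g y) x := fun x => by
      simp only [hF, Set.indicator_apply, Set.mem_ofPred_eq, Set.mem_Ici]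
    simp_rw [this]
    have e3 : Set.Ici y ∩ Set.Ioc (-Q) Q = Set.Icc y Q := by
      ext t
      simp only [Set.mem_inter_iff, Set.mem_Ici, Set.mem_Ioc, Set.mem_Icc]
      exact ⟨fun h => ⟨h.1, h.2.2⟩, fun h => ⟨h.1, hy.1.trans_le h.1, h.2⟩⟩
    rw [integral_indicator measurableSet_Ici, hμ, Measure.restrict_restrict measurableSet_Ici, e3,
      integral_mul_const, integral_Icc_eq_integral_Ioc,
      ← intervalIntegral.integral_of_le hy.2, hd, hφQ]
    ring
  rw [intervalIntegral.integral_of_le hle, intervalIntegral.integral_of_le hle, ← integral_neg,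
    ← setIntegral_congr_fun measurableSet_Ioc e1, ← setIntegral_congr_fun measurableSet_Ioc e2]
  exact hswap

variable {U : ℝ → ℂ} {S : Set ℝ} {z : ℂ}

/-- A weak solution of `-u'' + U u = z² u` agrees almost everywhere with a classical one. -/
theorem exists_isSol_of_weak (hU : IsPotential U S) {u : ℝ → ℂ} (hu : LocallyIntegrable u)
    (hw : ∀ φ : ℝ → ℂ, ContDiff ℝ ∞ φ → HasCompactSupport φ →
      ∫ x, u x * (-(deriv (deriv φ) x) + U x * φ x - z ^ 2 * φ x) = 0) :
    ∃ v v', IsSol U S z v v' ∧ u =ᵐ[volume] v := by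
  have hdd : ∀ {φ : ℝ → ℂ}, ContDiff ℝ ∞ φ → ContDiff ℝ ∞ (deriv φ) := fun hφ =>
    (contDiff_infty_iff_deriv.1 hφ).2
  obtain ⟨B, hB⟩ := hU.bounded
  set g : ℝ → ℂ := fun x => (U x - z ^ 2) * u x with hg
  have hgl : LocallyIntegrable g := by
    intro x
    obtain ⟨s, hs, hs'⟩ := hu x
    refine ⟨s, hs, ?_⟩
    refine Integrable.bdd_mul (c := B + ‖z ^ 2‖) hs'
      (hU.measurable.sub_const _).aestronglyMeasurable (Eventually.of_forall fun y => ?_)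
    exact (norm_sub_le _ _).trans (by gcongr; exact hB y)
  have hI : ∀ a b, IntervalIntegrable g volume a b := fun a b =>
    (intervalIntegrable_iff).2 ((hgl.integrableOn_isCompact isCompact_uIcc).mono_set
      Set.uIoc_subset_uIcc)
  set p : ℝ → ℂ := fun x => ∫ t in (0 : ℝ)..x, g t with hp
  have hpc : Continuous p := intervalIntegral.continuous_primitive hI 0
  set q : ℝ → ℂ := fun x => ∫ t in (0 : ℝ)..x, p t with hq
  have hqd : ∀ x, HasDerivAt q (p x) x := fun x =>
    intervalIntegral.integral_hasDerivAt_right (hpc.intervalIntegrable _ _)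
      (hpc.stronglyMeasurableAtFilter _ _) hpc.continuousAt
  have hqc : Continuous q := continuous_iff_continuousAt.2 fun x => (hqd x).continuousAt
  obtain ⟨c, d, hcd⟩ := ae_eq_affine_of_integral_deriv_deriv_eq_zero (h := fun x => u x - q x)
    (hu.sub hqc.locallyIntegrable) (fun φ hφ hφc => by
      have h1 := hw φ hφ hφc
      have i1 := integrable_mul_of_hasCompactSupport hu (hdd (hdd hφ)).continuous hφc.deriv.deriv
      have i2 := integrable_mul_of_hasCompactSupport hgl hφ.continuous hφc
      have i3 := integrable_mul_of_hasCompactSupport hqc.locallyIntegrable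
        (hdd (hdd hφ)).continuous hφc.deriv.deriv
      have h2 : ∫ x, u x * (-(deriv (deriv φ) x) + U x * φ x - z ^ 2 * φ x) =
          (∫ x, g x * φ x) - ∫ x, u x * deriv (deriv φ) x := by
        rw [← integral_sub i2 i1]
        congr 1
        funext x
        simp only [hg]
        ring
      have h3 : ∫ x, q x * deriv (deriv φ) x = ∫ x, g x * φ x := by
        rw [integral_primitive_mul_deriv hpc.locallyIntegrable (hdd hφ) hφc.deriv,
          integral_primitive_mul_deriv hgl hφ hφc, neg_neg]
      simp_rw [sub_mul]
      rw [integral_sub i1 i3, h3, ← neg_eq_zero, ← h1, h2]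
      ring)
  set v : ℝ → ℂ := fun x => q x + (c + d * x) with hv
  have huv : u =ᵐ[volume] v := by
    filter_upwards [hcd] with x hx
    simp only [hv]
    linear_combination hx
  have hvd : ∀ x, HasDerivAt v (p x + d) x := fun x => by
    have h1 : HasDerivAt (fun x : ℝ => c + d * (x : ℂ)) d x := by
      simpa using ((Complex.ofRealCLM.hasDerivAt (x := x)).const_mul d).const_add c
    exact (hqd x).add h1
  have hvc : Continuous v := continuous_iff_continuousAt.2 fun x => (hvd x).continuousAt
  have hp' : ∀ x, p x = ∫ t in (0 : ℝ)..x, (U t - z ^ 2) * v t := fun x => by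
    refine intervalIntegral.integral_congr_ae ?_
    filter_upwards [huv] with t ht _
    simp only [hg, ht]
  refine ⟨v, fun x => p x + d, ⟨hvd, hpc.add_const d, fun x hx => ?_⟩, huv⟩
  have hm : Measurable fun t => (U t - z ^ 2) * v t :=
    (hU.measurable.sub_const _).mul hvc.measurable
  have h1 : HasDerivAt (fun x => ∫ t in (0 : ℝ)..x, (U t - z ^ 2) * v t)
      ((U x - z ^ 2) * v x) x := by
    refine intervalIntegral.integral_hasDerivAt_right ?_
      (hm.stronglyMeasurable.stronglyMeasurableAtFilter)
      (((hU.continuousAt x hx).sub continuousAt_const).mul hvc.continuousAt)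
    refine (hI 0 x).congr_ae ?_
    refine ae_restrict_of_ae ?_
    filter_upwards [huv] with t ht
    simp only [hg, ht]
  have h2 : p = fun x => ∫ t in (0 : ℝ)..x, (U t - z ^ 2) * v t := funext hp'
  rw [h2]
  exact h1.add_const d

end weak

/-! ### The resolvent in the upper half plane -/

section resolvent
variable {U : ℝ → ℂ} {S : Set ℝ} {z : ℂ} {r : ℝ} {v v' : ℝ → ℂ}

theorem IsSol.eq_exp_right (hv : IsSol U S z v v') (hS : S.Finite) (hz : z ≠ 0)
    (hU : ∀ x, r < x → U x = 0) {x : ℝ} (hx : r ≤ x) :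
    v x = ((v r * (Complex.I * z) - v' r) * Complex.exp (Complex.I * z * r) *
        Complex.exp (-(Complex.I * z) * x) -
      (v r * -(Complex.I * z) - v' r) * Complex.exp (-(Complex.I * z) * r) *
        Complex.exp (Complex.I * z * x)) / (2 * Complex.I * z) := by
  have hI2 := Complex.I_sq
  have h1 := hv.wronskian_eq (isSol_exp z (Complex.I * z) (by linear_combination z ^ 2 * hI2))
    hS Set.finite_empty hx fun y hy => by rw [hU y hy.1]; rfl
  have h2 := hv.wronskian_eq (isSol_exp z (-(Complex.I * z)) (by linear_combination z ^ 2 * hI2))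
    hS Set.finite_empty hx fun y hy => by rw [hU y hy.1]; rfl
  have h3 : Complex.exp (Complex.I * z * x) * Complex.exp (-(Complex.I * z) * x) = 1 := by
    rw [← Complex.exp_add, neg_mul, add_neg_cancel, Complex.exp_zero]
  rw [eq_div_iff (by simp [hz])]
  linear_combination -Complex.exp (-(Complex.I * z) * x) * h1 +
    Complex.exp (Complex.I * z * x) * h2 - v x * (2 * Complex.I * z) * h3

theorem IsSol.eq_exp_left (hv : IsSol U S z v v') (hS : S.Finite) (hz : z ≠ 0)
    (hU : ∀ x, x < -r → U x = 0) {x : ℝ} (hx : x ≤ -r) :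
    v x = ((v (-r) * (Complex.I * z) + v' (-r)) * Complex.exp (Complex.I * z * r) *
        Complex.exp (Complex.I * z * x) -
      (v (-r) * -(Complex.I * z) + v' (-r)) * Complex.exp (-(Complex.I * z) * r) *
        Complex.exp (-(Complex.I * z) * x)) / (2 * Complex.I * z) := by
  have h := hv.comp_neg.eq_exp_right (hS.preimage neg_injective.injOn) hz
    (fun y hy => hU (-y) (neg_lt_neg hy)) (x := -x) (r := r) (by linarith)
  rw [neg_neg] at h
  rw [h]
  push_cast
  ring_nf

theorem norm_exp_mul (z : ℂ) (x : ℝ) :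
    ‖Complex.exp (-(Complex.I * z) * x)‖ = Real.exp (z.im * x) ∧
      ‖Complex.exp (Complex.I * z * x)‖ = Real.exp (-(z.im * x)) := by
  constructor <;> rw [Complex.norm_exp] <;> congr 1 <;> simp

/-- A square integrable function has no exponentially growing component. -/
theorem eq_zero_of_memLp_of_eq_exp {f : ℝ → ℂ} (hf : MemLp f 2) (hz : 0 < z.im) {a b : ℂ}
    (h : ∀ x, r ≤ x → f x = a * Complex.exp (-(Complex.I * z) * x) +
      b * Complex.exp (Complex.I * z * x)) : a = 0 := by
  by_contra ha
  have ha' : 0 < ‖a‖ := norm_pos_iff.2 ha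
  have h1 : Tendsto (fun x : ℝ => ‖a‖ * Real.exp (z.im * x)) atTop atTop :=
    (Real.tendsto_exp_atTop.comp (tendsto_id.const_mul_atTop hz)).const_mul_atTop ha'
  obtain ⟨X, hX⟩ := eventually_atTop.1 ((h1.eventually_ge_atTop (1 + ‖b‖)).and
    ((eventually_ge_atTop r).and (eventually_ge_atTop 0)))
  have h2 : ∀ x, X ≤ x → 1 ≤ ‖f x‖ := by
    intro x hx
    obtain ⟨k1, k2, k3⟩ := hX x hx
    rw [h x k2]
    have h3 := norm_sub_norm_le (a * Complex.exp (-(Complex.I * z) * x))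
      (-(b * Complex.exp (Complex.I * z * x)))
    rw [sub_neg_eq_add, norm_neg, norm_mul, norm_mul, (norm_exp_mul z x).1,
      (norm_exp_mul z x).2] at h3
    have h4 : Real.exp (-(z.im * x)) ≤ 1 := by
      rw [Real.exp_le_one_iff]
      nlinarith
    have h5 : ‖b‖ * Real.exp (-(z.im * x)) ≤ ‖b‖ * 1 := by gcongr
    linarith
  have h3 := ((memLp_two_iff_integrable_sq_norm hf.1).1 hf).measure_norm_ge_lt_top one_pos
  have h4 : Set.Ici X ⊆ {x | 1 ≤ ‖‖f x‖ ^ 2‖} := fun x hx => by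
    have := h2 x hx
    change 1 ≤ ‖‖f x‖ ^ 2‖
    rw [Real.norm_of_nonneg (by positivity)]
    nlinarith
  have h5 := (measure_mono h4).trans_lt h3
  simp at h5

/-- In the upper half plane there is no square integrable solution, unless the Jost solutions are
linearly dependent. -/
theorem JostPair.eq_zero_of_memLp (J : JostPair U S r) (hS : S.Finite) (hz : 0 < z.im)
    (hdet : J.det z ≠ 0) (hU : ∀ x, r < |x| → U x = 0) (hv : IsSol U S z v v')
    (hL : MemLp v 2) : v = 0 := by
  have hz0 : z ≠ 0 := by rintro rfl; simp at hz
  have hiz : 2 * Complex.I * z ≠ 0 := by simp [hz0]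
  have e1 : v r * (Complex.I * z) - v' r = 0 := by
    have h := eq_zero_of_memLp_of_eq_exp (r := r) hL hz
      (a := (v r * (Complex.I * z) - v' r) * Complex.exp (Complex.I * z * r) /
        (2 * Complex.I * z))
      (b := -((v r * -(Complex.I * z) - v' r) * Complex.exp (-(Complex.I * z) * r)) /
        (2 * Complex.I * z)) fun x hx => by
      rw [hv.eq_exp_right hS hz0 (fun y hy => hU y (hy.trans_le (le_abs_self y))) hx]
      ring
    exact (mul_eq_zero.1 ((div_eq_zero_iff.1 h).resolve_right hiz)).resolve_right
      (Complex.exp_ne_zero _)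
  have e2 : v (-r) * (Complex.I * z) + v' (-r) = 0 := by
    have hL' : MemLp (fun x => v (-x)) 2 :=
      hL.comp_measurePreserving (Measure.measurePreserving_neg volume)
    have h := eq_zero_of_memLp_of_eq_exp (r := r) hL' hz
      (a := (v (-r) * (Complex.I * z) + v' (-r)) * Complex.exp (Complex.I * z * r) /
        (2 * Complex.I * z))
      (b := -((v (-r) * -(Complex.I * z) + v' (-r)) * Complex.exp (-(Complex.I * z) * r)) /
        (2 * Complex.I * z)) fun x hx => by
      rw [hv.eq_exp_left (x := -x) (r := r) hS hz0
        (fun y hy => hU y (by rw [lt_abs]; right; linarith)) (by linarith)]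
      push_cast
      ring_nf
    exact (mul_eq_zero.1 ((div_eq_zero_iff.1 h).resolve_right hiz)).resolve_right
      (Complex.exp_ne_zero _)
  have w1 : ∀ x, v x * J.right' z x - v' x * J.right z x = 0 := fun x => by
    rw [← hv.wronskian_const (J.isSol_right z) hS r x, J.right_at, J.right'_at]
    linear_combination Complex.exp (Complex.I * z * r) * e1
  have w2 : ∀ x, v x * J.left' z x - v' x * J.left z x = 0 := fun x => by
    rw [← hv.wronskian_const (J.isSol_left z) hS (-r) x, J.left_at, J.left'_at]
    linear_combination -Complex.exp (Complex.I * z * r) * e2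
  funext x
  have h := J.det_eq hS z x
  have h3 : v x * J.det z = 0 := by
    rw [h]
    linear_combination J.left z x * w1 x - J.right z x * w2 x
  exact (mul_eq_zero.1 h3).resolve_right hdet

/-- A solution that is a multiple of `e^{-i z x}` to the left of the support is
`O(e^{Im z x})`. -/
theorem IsSol.exists_norm_le (hv : IsSol U S z v v') (hS : S.Finite) (hz : 0 < z.im)
    (hr : 0 ≤ r) (hU : ∀ x, r < |x| → U x = 0) (h : v (-r) * (Complex.I * z) + v' (-r) = 0) :
    ∃ B, ∀ x, ‖v x‖ ≤ B * Real.exp (z.im * x) := by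
  have hz0 : z ≠ 0 := by rintro rfl; simp at hz
  obtain ⟨B₀, hB₀⟩ := isCompact_Icc.exists_bound_of_continuousOn (s := Set.Icc (-r) r)
    (f := fun x : ℝ => v x * ((Real.exp (-(z.im * x)) : ℝ) : ℂ))
    ((hv.continuous.mul (by fun_prop)).continuousOn)
  set a := (v r * (Complex.I * z) - v' r) * Complex.exp (Complex.I * z * r) /
    (2 * Complex.I * z) with ha
  set b := -((v r * -(Complex.I * z) - v' r) * Complex.exp (-(Complex.I * z) * r)) /
    (2 * Complex.I * z) with hb
  set c := -((v (-r) * -(Complex.I * z) + v' (-r)) * Complex.exp (-(Complex.I * z) * r)) /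
    (2 * Complex.I * z) with hc
  have hB0 : 0 ≤ B₀ := (norm_nonneg _).trans (hB₀ 0 ⟨by linarith, hr⟩)
  refine ⟨B₀ + ‖a‖ + ‖b‖ + ‖c‖, fun x => ?_⟩
  have hex := Real.exp_pos (z.im * x)
  rcases le_total x (-r) with hx | hx
  · have h1 : v x = c * Complex.exp (-(Complex.I * z) * x) := by
      rw [hv.eq_exp_left (r := r) hS hz0 (fun y hy => hU y (by rw [lt_abs]; right; linarith)) hx,
        h, hc]
      ring
    rw [h1, norm_mul, (norm_exp_mul z x).1]
    gcongr
    linarith [norm_nonneg a, norm_nonneg b]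
  rcases le_total r x with hx' | hx'
  · have h1 : v x = a * Complex.exp (-(Complex.I * z) * x) +
        b * Complex.exp (Complex.I * z * x) := by
      rw [hv.eq_exp_right (r := r) hS hz0 (fun y hy => hU y (hy.trans_le (le_abs_self y))) hx']
      ring
    rw [h1]
    refine (norm_add_le _ _).trans ?_
    rw [norm_mul, norm_mul, (norm_exp_mul z x).1, (norm_exp_mul z x).2]
    have h2 : Real.exp (-(z.im * x)) ≤ Real.exp (z.im * x) := by
      rw [Real.exp_le_exp]
      have : 0 ≤ x := hr.trans hx'
      nlinarith
    have h3 : ‖b‖ * Real.exp (-(z.im * x)) ≤ ‖b‖ * Real.exp (z.im * x) := by gcongr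
    have h4 : 0 ≤ (B₀ + ‖c‖) * Real.exp (z.im * x) := by positivity
    linarith
  · have h1 := hB₀ x ⟨hx, hx'⟩
    rw [norm_mul, Complex.norm_real, Real.norm_of_nonneg (Real.exp_pos _).le, Real.exp_neg,
      ← div_eq_mul_inv, div_le_iff₀ hex] at h1
    refine h1.trans ?_
    gcongr
    linarith [norm_nonneg a, norm_nonneg b, norm_nonneg c]

/-- Green's kernel without the factor `-1 / det`, as a weight times a bounded function. -/
theorem JostPair.exists_kernel (J : JostPair U S r) (hS : S.Finite) (hz : 1 ≤ z.im) (hr : 0 ≤ r)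
    (hU : ∀ x, r < |x| → U x = 0) :
    ∃ k : ℝ × ℝ →ᵇ ℂ, ∀ x y, ((Real.exp (-|x - y|) : ℝ) : ℂ) * k (x, y) =
      J.left z (min x y) * J.right z (max x y) := by
  have hz0 : 0 < z.im := by linarith
  obtain ⟨B₁, hB₁⟩ := (J.isSol_left z).exists_norm_le hS hz0 hr hU (by
    rw [J.left_at, J.left'_at]; ring)
  obtain ⟨B₂, hB₂⟩ := (J.isSol_right z).comp_neg.exists_norm_le
    (hS.preimage neg_injective.injOn) hz0 hr (fun x hx => hU (-x) (by rwa [abs_neg])) (by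
      rw [neg_neg, J.right_at, J.right'_at]; ring)
  have hB₂' : ∀ x, ‖J.right z x‖ ≤ B₂ * Real.exp (-(z.im * x)) := fun x => by
    have := hB₂ (-x)
    rwa [neg_neg, mul_neg] at this
  have h1 : 0 ≤ B₁ := by
    have := (norm_nonneg _).trans (hB₁ 0)
    simpa using this
  have h2 : 0 ≤ B₂ := by
    have := (norm_nonneg _).trans (hB₂' 0)
    simpa using this
  have c1 := (J.isSol_left z).continuous
  have c2 := (J.isSol_right z).continuous
  refine ⟨BoundedContinuousFunction.ofNormedAddCommGroup
    (fun q : ℝ × ℝ => ((Real.exp |q.1 - q.2| : ℝ) : ℂ) *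
      (J.left z (min q.1 q.2) * J.right z (max q.1 q.2))) (by fun_prop) (B₁ * B₂) ?_, ?_⟩
  · rintro ⟨x, y⟩
    rw [norm_mul, norm_mul, Complex.norm_real, Real.norm_of_nonneg (Real.exp_pos _).le]
    calc _ ≤ Real.exp |x - y| * ((B₁ * Real.exp (z.im * min x y)) *
          (B₂ * Real.exp (-(z.im * max x y)))) := by
          gcongr
          · exact hB₁ _
          · exact hB₂' _
      _ = B₁ * B₂ * Real.exp (-((z.im - 1) * |x - y|)) := by
          have : |x - y| = max x y - min x y := by rw [max_sub_min_eq_abs']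
          have e : Real.exp (-((z.im - 1) * |x - y|)) =
              Real.exp |x - y| * (Real.exp (z.im * min x y) * Real.exp (-(z.im * max x y))) := by
            rw [← Real.exp_add, ← Real.exp_add, this]
            ring_nf
          rw [e]
          ring
      _ ≤ B₁ * B₂ * 1 := by
          gcongr
          rw [Real.exp_le_one_iff]
          have : 0 ≤ (z.im - 1) * |x - y| := mul_nonneg (by linarith) (abs_nonneg _)
          linarith
      _ = _ := mul_one _
  · intro x y
    change _ * (((Real.exp |x - y| : ℝ) : ℂ) * _) = _
    rw [← mul_assoc, ← Complex.ofReal_mul, ← Real.exp_add, neg_add_cancel, Real.exp_zero,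
      Complex.ofReal_one, one_mul]

/-- Green's formula on an interval. -/
theorem IsSol.integral_mul_operator (hU : IsPotential U S) (hv : IsSol U S z v v') {φ : ℝ → ℂ}
    (hφ : ContDiff ℝ ∞ φ) {c d : ℝ} (hcd : c ≤ d) :
    ∫ x in c..d, v x * (-(deriv (deriv φ) x) + U x * φ x - z ^ 2 * φ x) =
      (v' d * φ d - v d * deriv φ d) - (v' c * φ c - v c * deriv φ c) := by
  have d1 : ∀ x, HasDerivAt φ (deriv φ x) x := fun x =>
    (hφ.differentiable (by simp) x).hasDerivAt
  have hφ' := (contDiff_infty_iff_deriv.1 hφ).2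
  have d2 : ∀ x, HasDerivAt (deriv φ) (deriv (deriv φ) x) x := fun x =>
    (hφ'.differentiable (by simp) x).hasDerivAt
  have c2 : Continuous (deriv (deriv φ)) := (contDiff_infty_iff_deriv.1 hφ').2.continuous
  have hc : Continuous fun x => v' x * φ x - v x * deriv φ x :=
    (hv.continuous'.mul hφ.continuous).sub (hv.continuous.mul hφ'.continuous)
  refine integral_eq_of_hasDerivAt_off_countable_of_le
    (fun x => v' x * φ x - v x * deriv φ x) _ hcd hU.finite.countable hc.continuousOn
    (fun x hx => ?_) ?_
  · refine (((hv.hasDerivAt' x hx.2).mul (d1 x)).sub ((hv.hasDerivAt x).mul (d2 x))).congr_deriv ?_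
    ring
  · obtain ⟨B, hB⟩ := hU.bounded
    have h1 := (intervalIntegrable_of_bounded hU.measurable hB c d).mul_continuousOn
      (g := fun x => v x * φ x) (hv.continuous.mul hφ.continuous).continuousOn
    have h2 : IntervalIntegrable (fun x => v x * (-(deriv (deriv φ) x) - z ^ 2 * φ x))
        volume c d :=
      (hv.continuous.mul (c2.neg.sub (hφ.continuous.const_mul _))).intervalIntegrable _ _
    refine (h1.add h2).congr (fun x _ => ?_)
    ring

/-- Green's kernel inverts the operator on test functions. -/
theorem JostPair.integral_green (J : JostPair U S r) (hU : IsPotential U S) {φ : ℝ → ℂ}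
    (hφ : ContDiff ℝ ∞ φ) (hc : HasCompactSupport φ) (y : ℝ) :
    ∫ x, J.left z (min x y) * J.right z (max x y) *
      (-(deriv (deriv φ) x) + U x * φ x - z ^ 2 * φ x) = -(J.det z * φ y) := by
  obtain ⟨R, hR, hR'⟩ := HasCompactSupport.exists_Ioo hc y
  have hR0 : 0 ≤ R := (abs_nonneg y).trans hR.le
  have hφ' : ∀ x, R < |x| → deriv φ x = 0 ∧ deriv (deriv φ) x = 0 := fun x hx => by
    have : φ =ᶠ[𝓝 x] fun _ => 0 := by
      filter_upwards [continuous_abs.continuousAt.eventually (lt_mem_nhds hx)] with w hw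
      exact hR' w hw.le
    refine ⟨by rw [this.deriv_eq, deriv_const], ?_⟩
    rw [this.deriv.deriv_eq]
    simp
  set Q := R + 1 with hQ
  have hQ0 : 0 ≤ Q := by linarith
  have hQabs : |Q| = Q := abs_of_nonneg hQ0
  rw [abs_lt] at hR
  have z1 : φ Q = 0 := hR' _ (by linarith)
  have z2 : φ (-Q) = 0 := hR' _ (by rw [abs_neg]; linarith)
  have z3 : deriv φ Q = 0 := (hφ' _ (by linarith)).1
  have z4 : deriv φ (-Q) = 0 := (hφ' _ (by rw [abs_neg]; linarith)).1
  rw [integral_eq_intervalIntegral hQ0 fun x hx => by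
    rw [hR' x (by linarith), (hφ' x (by linarith)).2]; ring]
  have g1 := (J.isSol_left z).integral_mul_operator hU hφ (show -Q ≤ y by linarith)
  have g2 := (J.isSol_right z).integral_mul_operator hU hφ (show y ≤ Q by linarith)
  have hi : ∀ c d : ℝ, IntervalIntegrable (fun x => J.left z (min x y) * J.right z (max x y) *
      (-(deriv (deriv φ) x) + U x * φ x - z ^ 2 * φ x)) volume c d := fun c d => by
    obtain ⟨B, hB⟩ := hU.bounded
    have c0 := hφ.continuous
    have c1 := (contDiff_infty_iff_deriv.1 (contDiff_infty_iff_deriv.1 hφ).2).2.continuous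
    have c2 := (J.isSol_left z).continuous
    have c3 := (J.isSol_right z).continuous
    have h1 := (intervalIntegrable_of_bounded hU.measurable hB c d).mul_continuousOn
      (g := fun x => J.left z (min x y) * J.right z (max x y) * φ x)
      (by fun_prop : Continuous _).continuousOn
    have h2 : IntervalIntegrable (fun x => J.left z (min x y) * J.right z (max x y) *
        (-(deriv (deriv φ) x) - z ^ 2 * φ x)) volume c d :=
      (by fun_prop : Continuous _).intervalIntegrable _ _
    refine (h1.add h2).congr (fun x _ => ?_)
    ring
  rw [← intervalIntegral.integral_add_adjacent_intervals (hi (-Q) y) (hi y Q)]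
  have e1 : ∫ x in (-Q)..y, J.left z (min x y) * J.right z (max x y) *
      (-(deriv (deriv φ) x) + U x * φ x - z ^ 2 * φ x) =
      J.right z y * ∫ x in (-Q)..y, J.left z x *
        (-(deriv (deriv φ) x) + U x * φ x - z ^ 2 * φ x) := by
    rw [← intervalIntegral.integral_const_mul]
    refine intervalIntegral.integral_congr fun x hx => ?_
    rw [Set.uIcc_of_le (by linarith)] at hx
    simp only [min_eq_left hx.2, max_eq_right hx.2]
    ring
  have e2 : ∫ x in y..Q, J.left z (min x y) * J.right z (max x y) *
      (-(deriv (deriv φ) x) + U x * φ x - z ^ 2 * φ x) =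
      J.left z y * ∫ x in y..Q, J.right z x *
        (-(deriv (deriv φ) x) + U x * φ x - z ^ 2 * φ x) := by
    rw [← intervalIntegral.integral_const_mul]
    refine intervalIntegral.integral_congr fun x hx => ?_
    rw [Set.uIcc_of_le (by linarith)] at hx
    simp only [min_eq_right hx.1, max_eq_left hx.1]
    ring
  rw [e1, e2, g1, g2, z1, z2, z3, z4, J.det_eq hU.finite z y]
  ring

theorem exists_memLp_operator (hU : IsPotential U S) (z : ℂ) {φ : ℝ → ℂ}
    (hφ : ContDiff ℝ ∞ φ) (hc : HasCompactSupport φ) :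
    MemLp (fun x => -(deriv (deriv φ) x) + U x * φ x - z ^ 2 * φ x) 2 := by
  obtain ⟨B, hB⟩ := hU.bounded
  have c1 := (contDiff_infty_iff_deriv.1 (contDiff_infty_iff_deriv.1 hφ).2).2.continuous
  have h1 : MemLp φ 2 := hφ.continuous.memLp_of_hasCompactSupport hc
  have h2 : MemLp (deriv (deriv φ)) 2 := c1.memLp_of_hasCompactSupport hc.deriv.deriv
  have h3 : MemLp (fun x => U x * φ x) 2 := by
    refine h1.of_le_mul (c := B) (hU.measurable.aestronglyMeasurable.mul
      hφ.continuous.aestronglyMeasurable) (Eventually.of_forall fun x => ?_)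
    rw [norm_mul]
    gcongr
    exact hB x
  exact (h2.neg.add h3).sub (h1.const_mul (z ^ 2))

/-- The kernel operator solves the inhomogeneous equation weakly. -/
theorem JostPair.isWeakSolution (J : JostPair U S r) (hU : IsPotential U S)
    (hdet : J.det z ≠ 0) {k : ℝ × ℝ →ᵇ ℂ} (hk : ∀ x y, ((Real.exp (-|x - y|) : ℝ) : ℂ) *
      k (x, y) = J.left z (min x y) * J.right z (max x y)) (f : L2) :
    IsWeakSolution U z f ((-(J.det z)⁻¹ • kernelOp k) f) := by
  intro φ hφ hc
  set ℓ : ℝ → ℂ := fun x => -(deriv (deriv φ) x) + U x * φ x - z ^ 2 * φ x with hℓ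
  have hℓ2 : MemLp ℓ 2 := exists_memLp_operator hU z hφ hc
  have hf := Lp.memLp f
  set G : ℝ → ℝ → ℂ := fun x y => ((Real.exp (-|x - y|) : ℝ) : ℂ) * k (x, y) * f y * ℓ x with hG
  have hGi : Integrable (Function.uncurry G) (volume.prod volume) := by
    have hm : AEStronglyMeasurable (Function.uncurry G) (volume.prod volume) :=
      (aestronglyMeasurable_kernel k hf.1).mul hℓ2.1.comp_fst
    refine (integrable_prod_iff hm).2 ⟨Eventually.of_forall fun x =>
      (integrable_kernel k hf x).mul_const (ℓ x), ?_⟩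
    have h1 : MemLp (fun y => ((‖f y‖ : ℝ) : ℂ)) 2 := hf.norm.ofReal
    have h2 : Integrable fun x => kernelIntegral (BoundedContinuousFunction.const _ (‖k‖ : ℂ))
        (fun y => ((‖f y‖ : ℝ) : ℂ)) x * ℓ x :=
      (memLp_kernelIntegral _ h1).integrable_mul hℓ2
    refine h2.norm.mono' hm.norm.integral_prod_right' (Eventually.of_forall fun x => ?_)
    have h3 := integrable_kernel (BoundedContinuousFunction.const _ (‖k‖ : ℂ)) h1 x
    have h4 : ∀ y, ((Real.exp (-|x - y|) : ℝ) : ℂ) *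
        (BoundedContinuousFunction.const (ℝ × ℝ) (‖k‖ : ℂ)) (x, y) * ((‖f y‖ : ℝ) : ℂ) =
        ((Real.exp (-|x - y|) * ‖k‖ * ‖f y‖ : ℝ) : ℂ) := fun y => by
      rw [BoundedContinuousFunction.const_apply]; push_cast; ring
    simp_rw [h4] at h3
    rw [Real.norm_of_nonneg (integral_nonneg fun y => norm_nonneg _), norm_mul, kernelIntegral]
    simp_rw [h4]
    rw [integral_complex_ofReal, Complex.norm_real, Real.norm_of_nonneg
      (integral_nonneg fun y => by positivity), ← integral_mul_const]
    refine integral_mono ((integrable_kernel k hf x).mul_const (ℓ x)).norm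
      (h3.re.mul_const ‖ℓ x‖) fun y => ?_
    simp only [Function.uncurry_apply_pair, hG, norm_mul, Complex.norm_real]
    rw [Real.norm_of_nonneg (Real.exp_pos _).le]
    gcongr
    exact k.norm_coe_le_norm _
  have hswap := integral_integral_swap hGi
  have e1 : ∀ y, ∫ x, G x y = f y * -(J.det z * φ y) := fun y => by
    rw [← J.integral_green hU hφ hc y, ← integral_const_mul]
    congr 1
    funext x
    simp only [hG, hk, hℓ]
    ring
  have e2 : ∀ x, ∫ y, G x y = kernelIntegral k f x * ℓ x := fun x => by
    rw [kernelIntegral, ← integral_mul_const]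
  simp_rw [e1, e2] at hswap
  have e3 : ∫ x, ((-(J.det z)⁻¹ • kernelOp k) f) x * ℓ x =
      -(J.det z)⁻¹ * ∫ x, kernelIntegral k f x * ℓ x := by
    rw [← integral_const_mul]
    refine integral_congr_ae ?_
    filter_upwards [Lp.coeFn_smul (-(J.det z)⁻¹) (kernelOp k f), coeFn_kernelOp k f] with x h1 h2
    have h3 : ((-(J.det z)⁻¹ • kernelOp k) f) x = (-(J.det z)⁻¹ • kernelOp k f : L2) x := rfl
    rw [h3, h1, Pi.smul_apply, h2, smul_eq_mul, mul_assoc]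
  rw [e3, hswap, ← integral_const_mul]
  congr 1
  funext y
  field_simp

/-- The resolvent for `Im z ≥ 1` is the integral operator with Green's kernel. -/
theorem JostPair.isResolventAt (J : JostPair U S r) (hU : IsPotential U S) (hz : 1 ≤ z.im)
    (hdet : J.det z ≠ 0) (hU0 : ∀ x, r < |x| → U x = 0)
    {k : ℝ × ℝ →ᵇ ℂ} (hk : ∀ x y, ((Real.exp (-|x - y|) : ℝ) : ℂ) *
      k (x, y) = J.left z (min x y) * J.right z (max x y)) :
    IsResolventAt U z (-(J.det z)⁻¹ • kernelOp k) := by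
  intro f u
  have hw := J.isWeakSolution hU hdet hk f
  refine ⟨fun hu => ?_, fun hu => hu ▸ hw⟩
  set w := (-(J.det z)⁻¹ • kernelOp k) f with hwdef
  obtain ⟨v, v', hv, huv⟩ := exists_isSol_of_weak (z := z) hU (u := fun x => (u - w : L2) x)
    ((Lp.memLp (u - w)).locallyIntegrable (by norm_num)) (fun φ hφ hc => by
      have h1 := hu φ hφ hc
      have h2 := hw φ hφ hc
      have hℓ := exists_memLp_operator hU z hφ hc
      have i1 := (Lp.memLp u).integrable_mul hℓ
      have i2 := (Lp.memLp w).integrable_mul hℓ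
      have h3 := integral_sub i1 i2
      simp only [Pi.mul_apply] at h3
      rw [h1, h2, sub_self] at h3
      rw [← h3]
      refine integral_congr_ae ?_
      filter_upwards [Lp.coeFn_sub u w] with x hx
      rw [hx, Pi.sub_apply, sub_mul])
  have hv2 : MemLp v 2 := (memLp_congr_ae huv).1 (Lp.memLp (u - w))
  have hv0 := J.eq_zero_of_memLp hU.finite (by linarith) hdet hU0 hv hv2
  rw [hv0] at huv
  have h4 : u - w = 0 := Lp.ext (huv.trans (Lp.coeFn_zero ℂ 2 (volume : Measure ℝ)).symm)
  exact sub_eq_zero.1 h4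

end resolvent

/-! ### Meromorphic continuation of the resolvent and its poles -/

section continuation
variable {U : ℝ → ℂ} {F F' : ℝ → ℂ → (L2 →L[ℂ] L2)}

/-- The continued resolvent is unique up to isolated points. -/
theorem IsContinuedResolvent.eventuallyEq (h : IsContinuedResolvent U F)
    (h' : IsContinuedResolvent U F') (ρ : ℝ) (z₀ : ℂ) : F ρ =ᶠ[𝓝[≠] z₀] F' ρ := by
  obtain ⟨hm, A, hA⟩ := h
  obtain ⟨hm', A', hA'⟩ := h'
  have heq : ∀ z : ℂ, max A A' < z.im → F ρ z - F' ρ z = 0 := by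
    intro z hz
    obtain ⟨T, hT, hFT⟩ := hA z ((le_max_left _ _).trans_lt hz)
    obtain ⟨T', hT', hFT'⟩ := hA' z ((le_max_right _ _).trans_lt hz)
    have : T = T' := ContinuousLinearMap.ext fun f => (hT' f (T f)).1 ((hT f (T f)).2 rfl)
    rw [hFT, hFT', this, sub_self]
  set z₁ : ℂ := ((max A A' + 1 : ℝ) : ℂ) * Complex.I with hz₁
  have hmer : MeromorphicOn (F ρ - F' ρ) Set.univ := (hm ρ).sub (hm' ρ)
  have htop : meromorphicOrderAt (F ρ - F' ρ) z₁ = ⊤ := by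
    refine meromorphicOrderAt_eq_top_iff.2 (Eventually.filter_mono nhdsWithin_le_nhds ?_)
    have : ∀ᶠ z in 𝓝 z₁, max A A' < z.im := by
      refine Complex.continuous_im.continuousAt.eventually (lt_mem_nhds ?_)
      simp [hz₁]
    filter_upwards [this] with z hz
    exact heq z hz
  have h0 : meromorphicOrderAt (F ρ - F' ρ) z₀ = ⊤ := by
    by_contra hne
    exact hmer.meromorphicOrderAt_ne_top_of_isPreconnected isPreconnected_univ
      (Set.mem_univ z₀) (Set.mem_univ z₁) hne htop
  filter_upwards [meromorphicOrderAt_eq_top_iff.1 h0] with z hz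
  exact sub_eq_zero.1 hz

theorem residue_congr {G G' : ℂ → (L2 →L[ℂ] L2)} {z₀ : ℂ} (h : G =ᶠ[𝓝[≠] z₀] G') :
    residue G z₀ = residue G' z₀ := by
  obtain ⟨ε, hε, hball⟩ := Metric.mem_nhdsWithin_iff.1 h
  rw [residue, residue, limUnder, limUnder]
  congr 1
  refine Filter.map_congr ?_
  filter_upwards [Ioo_mem_nhdsGT hε] with t ht
  congr 1
  refine circleIntegral.integral_congr ht.1.le fun z hz => hball ⟨?_, ?_⟩
  · exact Metric.sphere_subset_closedBall.trans (Metric.closedBall_subset_ball ht.2) hz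
  · rintro rfl
    simp [ht.1.ne] at hz

theorem IsContinuedResolvent.order_eq (h : IsContinuedResolvent U F) (ρ : ℝ) (z₀ : ℂ) :
    meromorphicOrderAt (continuedResolvent U ρ) z₀ = meromorphicOrderAt (F ρ) z₀ ∧
      residue (continuedResolvent U ρ) z₀ = residue (F ρ) z₀ := by
  have hex : ∃ F, IsContinuedResolvent U F := ⟨F, h⟩
  have h1 : IsContinuedResolvent U (continuedResolvent U) := by
    rw [continuedResolvent, dif_pos hex]
    exact hex.choose_spec
  have h2 := h1.eventuallyEq h ρ z₀
  exact ⟨meromorphicOrderAt_congr h2, residue_congr h2⟩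

/-- The residue of a quotient at a simple zero of the denominator. -/
theorem residue_inv_smul {d : ℂ → ℂ} {N : ℂ → (L2 →L[ℂ] L2)} (hd : Differentiable ℂ d)
    (hN : Differentiable ℂ N) {z₀ : ℂ} (h0 : d z₀ = 0) (h1 : deriv d z₀ ≠ 0) :
    residue (fun z => (d z)⁻¹ • N z) z₀ = (deriv d z₀)⁻¹ • N z₀ := by
  set s := dslope d z₀ with hs
  have hsd : Differentiable ℂ s := fun z => by
    have := (Complex.differentiableOn_dslope (s := Set.univ) (c := z₀) (f := d)
      Filter.univ_mem).2 hd.differentiableOn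
    exact this.differentiableAt Filter.univ_mem
  have hs0 : s z₀ = deriv d z₀ := dslope_same _ _
  have hds : ∀ z, d z = (z - z₀) * s z := fun z => by
    have := sub_smul_dslope d z₀ z
    rw [h0, sub_zero, smul_eq_mul] at this
    exact this.symm
  have hne : ∀ᶠ z in 𝓝 z₀, s z ≠ 0 := hsd.continuous.continuousAt.eventually_ne (by rwa [hs0])
  obtain ⟨ε, hε, hball⟩ := Metric.eventually_nhds_iff_ball.1 hne
  refine Tendsto.limUnder_eq (tendsto_const_nhds.congr' ?_)
  filter_upwards [Ioo_mem_nhdsGT hε] with t ht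
  have e1 : (∮ z in C(z₀, t), (d z)⁻¹ • N z) = ∮ z in C(z₀, t), (z - z₀)⁻¹ • ((s z)⁻¹ • N z) := by
    refine circleIntegral.integral_congr ht.1.le fun z _ => ?_
    simp only [hds z, mul_inv, mul_smul]
  have hdiff : DifferentiableOn ℂ (fun z => (s z)⁻¹ • N z) (Metric.closedBall z₀ t) := fun z hz =>
    (((hsd z).inv (hball z (Metric.closedBall_subset_ball ht.2 hz))).smul
      (hN z)).differentiableWithinAt
  have hI : (2 * Real.pi * Complex.I : ℂ) ≠ 0 := by simp [Real.pi_ne_zero]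
  rw [e1, hdiff.circleIntegral_sub_inv_smul (Metric.mem_ball_self ht.1), smul_smul,
    inv_mul_cancel₀ hI, one_smul, hs0]

end continuation

section poles
variable {U : ℝ → ℂ} {S : Set ℝ} {r : ℝ}

/-- The projection of the line to `[-ρ, ρ]`. -/
def clamp (ρ x : ℝ) : ℝ := max (-|ρ|) (min |ρ| x)

theorem continuous_clamp (ρ : ℝ) : Continuous (clamp ρ) := by
  unfold clamp
  fun_prop

theorem abs_clamp_le (ρ x : ℝ) : |clamp ρ x| ≤ |ρ| :=
  abs_le.2 ⟨le_max_left _ _, max_le (by linarith [abs_nonneg ρ]) (min_le_left _ _)⟩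

theorem clamp_of_mem {ρ x : ℝ} (hx : x ∈ Set.Icc (-ρ) ρ) : clamp ρ x = x := by
  have hρ : 0 ≤ ρ := by linarith [hx.1, hx.2]
  rw [clamp, abs_of_nonneg hρ, min_eq_right hx.2, max_eq_right hx.1]

theorem abs_min_clamp_le (ρ x y : ℝ) : |min (clamp ρ x) (clamp ρ y)| ≤ |ρ| := by
  rcases min_choice (clamp ρ x) (clamp ρ y) with h | h <;> rw [h] <;> exact abs_clamp_le _ _

theorem abs_max_clamp_le (ρ x y : ℝ) : |max (clamp ρ x) (clamp ρ y)| ≤ |ρ| := by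
  rcases max_choice (clamp ρ x) (clamp ρ y) with h | h <;> rw [h] <;> exact abs_clamp_le _ _

/-- The cut-off numerator of Green's kernel is an entire function of the spectral parameter. -/
theorem JostPair.exists_cutoff_kernel (J : JostPair U S r) (ρ : ℝ) :
    ∃ k : ℂ → (ℝ × ℝ →ᵇ ℂ), Differentiable ℂ k ∧
      ∀ z, ∀ x ∈ Set.Icc (-ρ) ρ, ∀ y ∈ Set.Icc (-ρ) ρ, ((Real.exp (-|x - y|) : ℝ) : ℂ) *
        k z (x, y) = J.left z (min x y) * J.right z (max x y) := by
  have hc := continuous_clamp ρ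
  set m : C(ℝ × ℝ, ℝ) := ⟨fun q => min (clamp ρ q.1) (clamp ρ q.2), by fun_prop⟩ with hm
  set n : C(ℝ × ℝ, ℝ) := ⟨fun q => max (clamp ρ q.1) (clamp ρ q.2), by fun_prop⟩ with hn
  have key : ∀ Z : ℝ, ∃ K : ℂ → (ℝ × ℝ →ᵇ ℂ), DifferentiableOn ℂ K (Metric.ball 0 Z) ∧
      ∀ z ∈ Metric.ball (0 : ℂ) Z, ∀ q, K z q =
        ((Real.exp |clamp ρ q.1 - clamp ρ q.2| : ℝ) : ℂ) * (J.left z (m q) * J.right z (n q)) := by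
    intro Z
    obtain ⟨κ₁, v₁, hv₁, e₁⟩ := J.holomorphic_left Z
    obtain ⟨κ₂, v₂, hv₂, e₂⟩ := J.holomorphic_right Z
    set w : ℝ × ℝ →ᵇ ℂ := BoundedContinuousFunction.ofNormedAddCommGroup
      (fun q => ((Real.exp (|clamp ρ q.1 - clamp ρ q.2| + κ₁ * |m q| + κ₂ * |n q|) : ℝ) : ℂ))
      (by fun_prop) (Real.exp (2 * |ρ| + |κ₁| * |ρ| + |κ₂| * |ρ|)) (fun q => by
        rw [Complex.norm_real, Real.norm_of_nonneg (Real.exp_pos _).le, Real.exp_le_exp]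
        have h1 := abs_sub (clamp ρ q.1) (clamp ρ q.2)
        have h2 := abs_clamp_le ρ q.1
        have h3 := abs_clamp_le ρ q.2
        have h4 : κ₁ * |m q| ≤ |κ₁| * |ρ| := mul_le_mul (le_abs_self _)
          (abs_min_clamp_le ρ q.1 q.2) (abs_nonneg _) (abs_nonneg _)
        have h5 : κ₂ * |n q| ≤ |κ₂| * |ρ| := mul_le_mul (le_abs_self _)
          (abs_max_clamp_le ρ q.1 q.2) (abs_nonneg _) (abs_nonneg _)
        linarith) with hw
    refine ⟨fun z => w * ((v₁ z).compContinuous m * (v₂ z).compContinuous n), ?_, ?_⟩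
    · have d1 : DifferentiableOn ℂ (fun z => (v₁ z).compContinuous m) (Metric.ball 0 Z) :=
        (BoundedContinuousFunction.compContinuousCLM ℂ ℂ m).differentiable.comp_differentiableOn
          hv₁
      have d2 : DifferentiableOn ℂ (fun z => (v₂ z).compContinuous n) (Metric.ball 0 Z) :=
        (BoundedContinuousFunction.compContinuousCLM ℂ ℂ n).differentiable.comp_differentiableOn
          hv₂
      exact (d1.mul d2).const_mul w
    · intro z hz q
      rw [e₁ z hz, e₂ z hz]
      simp only [BoundedContinuousFunction.mul_apply, BoundedContinuousFunction.compContinuous_apply,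
        hw, BoundedContinuousFunction.coe_ofNormedAddCommGroup, Real.exp_add]
      push_cast
      ring
  choose K hK hKe using key
  set k : ℂ → (ℝ × ℝ →ᵇ ℂ) := fun z => K (‖z‖ + 1) z with hk
  have hkK : ∀ Z, ∀ z ∈ Metric.ball (0 : ℂ) Z, k z = K Z z := fun Z z hz => by
    ext q
    rw [hk, hKe (‖z‖ + 1) z (by simp) q, hKe Z z hz q]
  refine ⟨k, fun z => ?_, fun z x hx y hy => ?_⟩
  · have hz : Metric.ball (0 : ℂ) (‖z‖ + 1) ∈ 𝓝 z := Metric.isOpen_ball.mem_nhds (by simp)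
    refine ((hK (‖z‖ + 1)).differentiableAt hz).congr_of_eventuallyEq ?_
    filter_upwards [hz] with w hw using hkK _ w hw
  · rw [hk, hKe (‖z‖ + 1) z (by simp)]
    simp only [hm, hn, ContinuousMap.coe_mk, clamp_of_mem hx, clamp_of_mem hy]
    rw [← mul_assoc, ← Complex.ofReal_mul, ← Real.exp_add, neg_add_cancel, Real.exp_zero,
      Complex.ofReal_one, one_mul]

/-- The continued resolvent is the quotient of an entire operator-valued function by the
Wronskian of the Jost solutions. -/
theorem JostPair.isContinuedResolvent (J : JostPair U S r) (hU : IsPotential U S) (hr : 0 ≤ r)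
    (hU0 : ∀ x, r < |x| → U x = 0) {A : ℝ} (hA : ∀ z : ℂ, A < z.im → J.det z ≠ 0)
    {k : ℝ → ℂ → (ℝ × ℝ →ᵇ ℂ)} (hkd : ∀ ρ, Differentiable ℂ (k ρ))
    (hk : ∀ ρ z, ∀ x ∈ Set.Icc (-ρ) ρ, ∀ y ∈ Set.Icc (-ρ) ρ, ((Real.exp (-|x - y|) : ℝ) : ℂ) *
        k ρ z (x, y) = J.left z (min x y) * J.right z (max x y)) :
    (∀ ρ, Differentiable ℂ fun z => (cutoff ρ).comp ((kernelOp (k ρ z)).comp (cutoff ρ))) ∧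
    IsContinuedResolvent U fun ρ z =>
      (-J.det z)⁻¹ • (cutoff ρ).comp ((kernelOp (k ρ z)).comp (cutoff ρ)) := by
  have hN : ∀ ρ, Differentiable ℂ fun z =>
      (cutoff ρ).comp ((kernelOp (k ρ z)).comp (cutoff ρ)) := fun ρ z => by
    have h1 : DifferentiableAt ℂ (fun z => kernelOp (k ρ z)) z :=
      kernelOp.differentiableAt.comp z (hkd ρ z)
    exact (differentiableAt_const _).clm_comp (h1.clm_comp (differentiableAt_const _))
  refine ⟨hN, fun ρ z _ => ?_, max A 1, fun z hz => ?_⟩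
  · exact (J.differentiable_det.neg.analyticAt z).meromorphicAt.inv.smul
      ((hN ρ).analyticAt z).meromorphicAt
  · have hz1 : 1 ≤ z.im := ((le_max_right _ _).trans_lt hz).le
    have hdet := hA z ((le_max_left _ _).trans_lt hz)
    obtain ⟨k₀, hk₀⟩ := J.exists_kernel hU.finite hz1 hr hU0
    refine ⟨_, J.isResolventAt hU hz1 hdet hU0 hk₀, fun ρ => ?_⟩
    have h1 : (cutoff ρ).comp ((kernelOp (k ρ z)).comp (cutoff ρ)) =
        (cutoff ρ).comp ((kernelOp k₀).comp (cutoff ρ)) := by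
      refine cutoff_kernelOp_congr fun x hx y hy => ?_
      have hne : ((Real.exp (-|x - y|) : ℝ) : ℂ) ≠ 0 := by
        exact_mod_cast (Real.exp_pos _).ne'
      exact mul_left_cancel₀ hne ((hk ρ z x hx y hy).trans (hk₀ x y).symm)
    beta_reduce
    rw [h1, inv_neg, ContinuousLinearMap.smul_comp, ContinuousLinearMap.comp_smul]

/-- At a zero of the Wronskian the Jost solutions are proportional. -/
theorem JostPair.exists_left_eq (J : JostPair U S r) (hU : IsPotential U S) {z : ℂ}
    (h : J.det z = 0) : ∃ c : ℂ, c ≠ 0 ∧ ∀ x, J.left z x = c * J.right z x := by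
  have hr : J.right z r ≠ 0 := by rw [J.right_at]; exact Complex.exp_ne_zero _
  have h1 : J.left z r * J.right' z r - J.left' z r * J.right z r = 0 := h
  have h2 := ((J.isSol_left z).eq_of_eq_at (x₀ := r) hU
    ((J.isSol_right z).const_mul (J.left z r / J.right z r)) (by field_simp) (by
      field_simp
      linear_combination -h1)).1
  refine ⟨J.left z r / J.right z r, ?_, fun x => congrFun h2 x⟩
  intro h0
  have h3 := congrFun h2 (-r)
  rw [h0, zero_mul, J.left_at] at h3
  exact Complex.exp_ne_zero _ h3

/-- The resonances are the zeros of the Wronskian of the Jost solutions; simple zeros have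
multiplicity one. -/
theorem JostPair.isResonance_iff (J : JostPair U S r) (hU : IsPotential U S) (hr : 0 < r)
    (hU0 : ∀ x, r < |x| → U x = 0) {A : ℝ} (hA : ∀ z : ℂ, A < z.im → J.det z ≠ 0) (z₀ : ℂ) :
    (IsResonance U z₀ ↔ J.det z₀ = 0) ∧
      (J.det z₀ = 0 → deriv J.det z₀ ≠ 0 → resonanceMultiplicity U z₀ = 1) := by
  choose k hkd hk using J.exists_cutoff_kernel
  obtain ⟨hN, hF⟩ := J.isContinuedResolvent hU hr.le hU0 hA hkd hk
  set N : ℝ → ℂ → (L2 →L[ℂ] L2) := fun ρ z =>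
    (cutoff ρ).comp ((kernelOp (k ρ z)).comp (cutoff ρ)) with hNdef
  have hd := J.differentiable_det
  have hprod : J.det z₀ = 0 → ∃ c : ℂ, c ≠ 0 ∧ ∀ ρ, ∀ x ∈ Set.Icc (-ρ) ρ, ∀ y ∈ Set.Icc (-ρ) ρ,
      ((Real.exp (-|x - y|) : ℝ) : ℂ) * k ρ z₀ (x, y) =
        c * (J.right z₀ x * J.right z₀ y) := fun h => by
    obtain ⟨c, hc, hlr⟩ := J.exists_left_eq hU h
    refine ⟨c, hc, fun ρ x hx y hy => ?_⟩
    rw [hk ρ z₀ x hx y hy, hlr]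
    rcases le_total x y with hxy | hxy
    · rw [min_eq_left hxy, max_eq_right hxy]; ring
    · rw [min_eq_right hxy, max_eq_left hxy]; ring
  have hright : J.right z₀ r ≠ 0 := by rw [J.right_at]; exact Complex.exp_ne_zero _
  have hcont := (J.isSol_right z₀).continuous
  have hr1 : r ∈ Set.Ioo (-(r + 1)) (r + 1) := ⟨by linarith, by linarith⟩
  refine ⟨⟨?_, fun h => ⟨r + 1, ?_⟩⟩, fun h h' => ?_⟩
  · rintro ⟨ρ, hρ⟩
    by_contra h
    rw [(hF.order_eq ρ z₀).1] at hρ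
    have h1 : AnalyticAt ℂ (fun z => (-J.det z)⁻¹ • N ρ z) z₀ :=
      ((hd.neg.analyticAt z₀).inv (neg_ne_zero.2 h)).smul ((hN ρ).analyticAt z₀)
    exact absurd h1.meromorphicOrderAt_nonneg (not_le.2 hρ)
  · rw [(hF.order_eq (r + 1) z₀).1]
    obtain ⟨c, hc, hkc⟩ := hprod h
    have hN0 : N (r + 1) z₀ ≠ 0 :=
      cutoff_kernelOp_ne_zero _ hc hcont (hkc (r + 1)) hr1 hright
    have a1 : AnalyticAt ℂ (fun z => -J.det z) z₀ := hd.neg.analyticAt z₀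
    have a2 : AnalyticAt ℂ (N (r + 1)) z₀ := (hN (r + 1)).analyticAt z₀
    have e1 : meromorphicOrderAt (fun z => (-J.det z)⁻¹ • N (r + 1) z) z₀ =
        -meromorphicOrderAt (fun z => -J.det z) z₀ + meromorphicOrderAt (N (r + 1)) z₀ := by
      rw [← meromorphicOrderAt_inv]
      exact meromorphicOrderAt_smul a1.meromorphicAt.inv a2.meromorphicAt
    rw [e1, a1.meromorphicOrderAt_eq, a2.meromorphicOrderAt_eq,
      a2.analyticOrderAt_eq_zero.2 hN0]
    have hne0 : analyticOrderAt (fun z => -J.det z) z₀ ≠ 0 := fun h0 =>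
      a1.analyticOrderAt_eq_zero.1 h0 (by rw [h, neg_zero])
    have hnetop : analyticOrderAt (fun z => -J.det z) z₀ ≠ ⊤ := fun h0 => by
      have h2 := analyticOrderAt_eq_top.1 h0
      have h3 : (fun z => -J.det z) = 0 := by
        refine AnalyticOnNhd.eq_of_eventuallyEq (z₀ := z₀) (fun z _ => hd.neg.analyticAt z)
          (fun z _ => analyticAt_const) ?_
        filter_upwards [h2] with z hz using hz
      have h4 := congrFun h3 (((A + 1 : ℝ) : ℂ) * Complex.I)
      refine hA (((A + 1 : ℝ) : ℂ) * Complex.I) ?_ (neg_eq_zero.1 h4)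
      simp
    lift analyticOrderAt (fun z => -J.det z) z₀ to ℕ using hnetop with n hn
    have hn0 : n ≠ 0 := by exact_mod_cast hne0
    have h6 : ((-(n : ℤ) : ℤ) : WithTop ℤ) < ((0 : ℤ) : WithTop ℤ) := by
      rw [WithTop.coe_lt_coe]
      omega
    calc _ = ((-(n : ℤ) : ℤ) : WithTop ℤ) := by simp
      _ < _ := h6
  · obtain ⟨c, hc, hkc⟩ := hprod h
    set α := -(deriv J.det z₀)⁻¹ with hα
    have hα0 : α ≠ 0 := neg_ne_zero.2 (inv_ne_zero h')
    have hres : ∀ ρ, residue (continuedResolvent U ρ) z₀ =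
        (cutoff ρ).comp ((kernelOp (α • k ρ z₀)).comp (cutoff ρ)) := fun ρ => by
      have e1 : deriv (fun z => -J.det z) z₀ = -deriv J.det z₀ := deriv.fun_neg
      rw [(hF.order_eq ρ z₀).2, residue_inv_smul (d := fun z => -J.det z) (N := N ρ) hd.neg (hN ρ)
        (by rw [h, neg_zero]) (by rw [e1]; exact neg_ne_zero.2 h'), e1, inv_neg, ← hα, map_smul,
        ContinuousLinearMap.smul_comp, ContinuousLinearMap.comp_smul]
    have hkα : ∀ ρ, ∀ x ∈ Set.Icc (-ρ) ρ, ∀ y ∈ Set.Icc (-ρ) ρ,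
        ((Real.exp (-|x - y|) : ℝ) : ℂ) * (α • k ρ z₀) (x, y) =
          (α * c) * (J.right z₀ x * J.right z₀ y) := fun ρ x hx y hy => by
      rw [BoundedContinuousFunction.smul_apply, smul_eq_mul, mul_assoc α c, ← hkc ρ x hx y hy]
      ring
    have hle : ∀ ρ, LinearMap.rank (residue (continuedResolvent U ρ) z₀).toLinearMap ≤ 1 :=
      fun ρ => by
        rw [hres]
        exact rank_cutoff_kernelOp_le _ hcont (hkα ρ)
    refine le_antisymm (iSup_le fun ρ => Cardinal.toENat_le_one.2 (hle ρ))
      (le_iSup_of_le (r + 1) (le_of_eq ?_))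
    refine (Cardinal.toENat_eq_one.2 (le_antisymm (hle _) ?_)).symm
    rw [Cardinal.one_le_iff_ne_zero]
    intro h0
    have hne := cutoff_kernelOp_ne_zero (α • k (r + 1) z₀) (mul_ne_zero hα0 hc) hcont
      (hkα (r + 1)) hr1 hright
    rw [← hres] at hne
    refine hne (ContinuousLinearMap.coe_injective ?_)
    exact LinearMap.range_eq_bot.1 (Submodule.rank_eq_zero.1 h0)

end poles

/-! ### The class `𝒱_{j,k}` and the resonances -/

section main
variable {j k : ℕ} {a b r M : ℝ} {C C₁ C₂ : ℂ} {V W : ℝ → ℂ}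

/-- A function asymptotic to `1` minus the oscillation does not vanish for large `Im z`. -/
theorem HasOscillation.exists_ne_zero {D : ℂ → ℂ} {L : ℝ} {p : ℕ} (h : HasOscillation D C L p M)
    (hL : 0 < L) (hM : 0 < M) : ∃ A : ℝ, ∀ z : ℂ, A < z.im → D z ≠ 0 := by
  set l : Filter ℂ := comap Complex.im atTop with hl
  have him : Tendsto Complex.im l atTop := tendsto_comap
  have hnorm : Tendsto (fun z : ℂ => ‖z‖) l atTop := tendsto_atTop_mono
    (fun z => (le_abs_self _).trans (Complex.abs_im_le_norm z)) him
  have hle : l ≤ logFilter M := by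
    refine le_inf (tendsto_norm_atTop_iff_cobounded.1 hnorm) ?_
    refine le_principal_iff.2 ?_
    filter_upwards [him.eventually_gt_atTop 0] with z hz
    change _ < z.im
    have h1 : 0 ≤ Real.log (1 + ‖z‖) := Real.log_nonneg (by linarith [norm_nonneg z])
    nlinarith
  have hosc : Tendsto (oscillation C L p) l (𝓝 0) := by
    have h1 : Tendsto (fun z : ℂ => ‖C‖ * Real.exp (-(2 * L * z.im))) l (𝓝 0) := by
      have := (Real.tendsto_exp_neg_atTop_nhds_zero.comp
        (him.const_mul_atTop (show 0 < 2 * L by linarith))).const_mul ‖C‖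
      rwa [mul_zero] at this
    refine squeeze_zero_norm' ?_ h1
    filter_upwards [hnorm.eventually_ge_atTop 1] with z hz
    have h2 : ‖Complex.exp (2 * Complex.I * z * L)‖ = Real.exp (-(2 * L * z.im)) := by
      rw [Complex.norm_exp]
      congr 1
      simp [Complex.mul_re, Complex.mul_im]
      ring
    rw [oscillation, norm_div, norm_mul, h2, norm_pow, norm_mul, Complex.norm_I, one_mul]
    exact div_le_self (by positivity) (one_le_pow₀ hz)
  have h1 : Tendsto D l (𝓝 1) := by
    have h2 : (fun z => D z - (1 - oscillation C L p z)) =o[l] fun _ => (1 : ℝ) := by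
      refine (h.mono hle).trans_isBigO ?_
      exact (isBigO_refl _ _).add (hosc.isBigO_one ℝ).norm_left
    have h3 := ((isLittleO_one_iff ℝ).1 h2).add (hosc.const_sub 1)
    simpa using h3
  have h2 : ∀ᶠ z in l, D z ≠ 0 := h1.eventually_ne one_ne_zero
  obtain ⟨A, hA⟩ := eventually_atTop.1 (eventually_comap.1 h2)
  exact ⟨A, fun z hz => hA z.im hz.le z rfl⟩

/-- A potential of the class `𝒱_{j,k}` is, on its support, a smooth function with prescribed jets
at the end points. -/
theorem IsInClass.exists_isJumpData (hV : IsInClass j k a b C₁ C₂ V) (hW : ContDiff ℝ ∞ W)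
    (hWc : HasCompactSupport W) :
    ∃ (N : ℕ) (r : ℝ) (g : ℝ → ℂ), 0 < r ∧ IsJumpData j k N a b r C₁ C₂ g W ∧
      V + W = jumpPotential a b g W := by
  obtain ⟨N, hjN, hkN, hN⟩ := hV.smooth
  have hab := hV.lt
  obtain ⟨g, hg, hgV⟩ := exists_contDiff_extension hab N V hN
  obtain ⟨B, hB, hB'⟩ := HasCompactSupport.exists_Ioo hWc 0
  rw [abs_zero] at hB
  have hsupp : ∀ x, x ∉ Set.Icc a b → V x = 0 := fun x hx => by
    by_contra h
    refine hx ?_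
    rw [← hV.convexHull_support]
    exact subset_convexHull ℝ _ (subset_tsupport _ h)
  have hleft : g ~[𝓝[>] a] fun x => C₁ * ((x - a : ℝ) : ℂ) ^ j := by
    refine hV.left_equiv.congr_left ?_
    filter_upwards [Ioo_mem_nhdsGT hab] with x hx
    exact (hgV ⟨hx.1.le, hx.2.le⟩).symm
  have hright : g ~[𝓝[<] b] fun x => ((-1) ^ k * C₂) * ((x - b : ℝ) : ℂ) ^ k := by
    refine (hV.right_equiv.congr_left ?_).congr_right (Eventually.of_forall fun x => ?_)
    · filter_upwards [Ioo_mem_nhdsLT hab] with x hx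
      exact (hgV ⟨hx.1.le, hx.2.le⟩).symm
    · have : ((b - x : ℝ) : ℂ) = -1 * ((x - b : ℝ) : ℂ) := by push_cast; ring
      simp only [this, mul_pow]
      ring
  obtain ⟨f1, f2⟩ := iteratedDeriv_of_isEquivalent (l := 𝓝[>] a)
    (nhdsWithin_mono a fun x hx => ne_of_gt hx)
    (hg.of_le (by exact_mod_cast hjN.le)) hleft
  obtain ⟨f3, f4⟩ := iteratedDeriv_of_isEquivalent (l := 𝓝[<] b)
    (nhdsWithin_mono b fun x hx => ne_of_lt hx)
    (hg.of_le (by exact_mod_cast hkN.le)) hright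
  refine ⟨N, B + |a| + |b| + 1, g, by positivity, ?_, ?_⟩
  · exact
      { lt := hab
        left_lt := by linarith [neg_abs_le a, abs_nonneg b]
        lt_right := by linarith [le_abs_self b, abs_nonneg a]
        lt_order := hjN
        lt_order' := hkN
        smooth := hg
        flat_left := f1
        jump_left := f2
        flat_right := f3
        jump_right := f4
        left_ne := hV.left_ne
        right_ne := hV.right_ne
        smooth' := hW
        support' := fun x hx => hB' x (by linarith [abs_nonneg a, abs_nonneg b]) }
  · funext x
    by_cases hx : x ∈ Set.Icc a b
    · simp [jumpPotential, Set.indicator_of_mem hx, hgV hx]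
    · simp [jumpPotential, Set.indicator_of_notMem hx, hsupp x hx]

theorem IsJumpData.isPotential {N : ℕ} (h : IsJumpData j k N a b r C₁ C₂ V W) :
    IsPotential (jumpPotential a b V W) {a, b} where
  finite := Set.toFinite _
  measurable := (h.smooth.continuous.measurable.indicator measurableSet_Icc).add
    h.smooth'.continuous.measurable
  bounded := by
    obtain ⟨B, hB⟩ := isCompact_Icc.exists_bound_of_continuousOn (s := Set.Icc a b)
      h.smooth.continuous.continuousOn
    have hc : HasCompactSupport W := HasCompactSupport.of_support_subset_isCompact
      (isCompact_Icc (a := -r) (b := r)) fun x hx => by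
        refine abs_le.1 ?_
        by_contra hlt
        exact hx (h.support' x (by linarith))
    obtain ⟨B', hB'⟩ := h.smooth'.continuous.bounded_above_of_compact_support hc
    have hB0 : 0 ≤ B := (norm_nonneg _).trans (hB a ⟨le_rfl, h.lt.le⟩)
    refine ⟨B + B', fun x => (norm_add_le _ _).trans (add_le_add ?_ (hB' x))⟩
    by_cases hx : x ∈ Set.Icc a b
    · rw [Set.indicator_of_mem hx]
      exact hB x hx
    · rwa [Set.indicator_of_notMem hx, norm_zero]
  continuousAt x hx := by
    refine ContinuousAt.add ?_ h.smooth'.continuous.continuousAt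
    rw [Set.mem_insert_iff, Set.mem_singleton_iff, not_or] at hx
    by_cases hx' : x ∈ Set.Icc a b
    · have : x ∈ Set.Ioo a b := ⟨lt_of_le_of_ne hx'.1 (Ne.symm hx.1), lt_of_le_of_ne hx'.2 hx.2⟩
      refine h.smooth.continuous.continuousAt.congr ?_
      filter_upwards [isOpen_Ioo.mem_nhds this] with y hy
      rw [Set.indicator_of_mem (show y ∈ Set.Icc a b from ⟨hy.1.le, hy.2.le⟩)]
    · refine (continuousAt_const (y := (0 : ℂ))).congr ?_
      filter_upwards [isClosed_Icc.isOpen_compl.mem_nhds hx'] with y hy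
      rw [Set.indicator_of_notMem hy]

theorem IsJumpData.eq_zero {N : ℕ} (h : IsJumpData j k N a b r C₁ C₂ V W) {x : ℝ} (hx : r < |x|) :
    jumpPotential a b V W x = 0 := by
  have h1 : x ∉ Set.Icc a b := fun h2 => by
    have := h.left_lt
    have := h.lt_right
    exact absurd (abs_lt.2 ⟨by linarith [h2.1], by linarith [h2.2]⟩ : |x| < r) (not_lt.2 hx.le)
  simp [jumpPotential, Set.indicator_of_notMem h1, h.support' x (by linarith)]

theorem approxZero_eq_leadingTerm (s : ℝ) (n : ℕ) :
    approxZero C (b - a) (j + k + 4) s n = leadingTerm j k a b C s n := by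
  simp only [approxZero, leadingTerm]
  push_cast
  ring

end main

end ResonanceSequence

end

theorem theorem1p2 (j k : ℕ) (a b : ℝ) (C₁ C₂ : ℂ) (V W : ℝ → ℂ)
    (hV : ResonanceSequence.IsInClass j k a b C₁ C₂ V)
    (hW : ContDiff ℝ ∞ W) (hWc : HasCompactSupport W)
    (M : ℝ) (hM : ((j : ℝ) + k + 4) / (2 * (b - a)) < M)
    (C : ℂ) (hC : C = (j.factorial : ℂ) * k.factorial * C₁ * C₂ / 2 ^ (j + k + 4)) :
    ∃ (R : ℝ) (Npos Nneg : ℕ) (lam : ℤ → ℂ), 0 < R ∧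
      -- the resonances in the region, each listed exactly once, are the `lam n`
      Set.BijOn lam {n : ℤ | (Npos : ℤ) < n ∨ n < -(Nneg : ℤ)}
        {z : ℂ | ResonanceSequence.IsResonance (V + W) z ∧
          z ∈ ResonanceSequence.logRegion M ∧ R < ‖z‖} ∧
      -- and all of them are simple
      (∀ z : ℂ, ResonanceSequence.IsResonance (V + W) z →
        z ∈ ResonanceSequence.logRegion M → R < ‖z‖ →
        ResonanceSequence.resonanceMultiplicity (V + W) z = 1) ∧
      Tendsto (fun n : ℕ => lam n - ResonanceSequence.leadingTerm j k a b C 1 n)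
        atTop (𝓝 0) ∧
      Tendsto (fun n : ℕ => lam (-(n : ℤ)) - ResonanceSequence.leadingTerm j k a b C (-1) n)
        atTop (𝓝 0) := by
  obtain ⟨N, r, g, hr, hg, hVW⟩ := hV.exists_isJumpData hW hWc
  rw [hVW]
  have hL : 0 < b - a := sub_pos.2 hV.lt
  have hM0 : 0 < M := lt_of_le_of_lt (by positivity) hM
  have hpot := hg.isPotential
  obtain ⟨J⟩ := ResonanceSequence.nonempty_jostPair hpot r
  have hC0 : C ≠ 0 := by
    rw [hC]
    exact div_ne_zero (mul_ne_zero (mul_ne_zero (mul_ne_zero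
      (by exact_mod_cast j.factorial_ne_zero) (by exact_mod_cast k.factorial_ne_zero)) hV.left_ne)
      hV.right_ne) (pow_ne_zero _ two_ne_zero)
  set D : ℂ → ℂ := fun z => J.det z / (2 * Complex.I * z) with hD
  have hosc : ResonanceSequence.HasOscillation D C (b - a) (j + k + 4) M :=
    hg.det_asymptotics J hM0 hC
  have hden : ∀ z : ℂ, z ≠ 0 → 2 * Complex.I * z ≠ 0 := fun z hz => by simp [hz]
  have hDd : ∀ z : ℂ, z ≠ 0 → HasDerivAt D ((deriv J.det z * (2 * Complex.I * z) -
      J.det z * (2 * Complex.I)) / (2 * Complex.I * z) ^ 2) z := fun z hz => by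
    have h1 : HasDerivAt (fun z : ℂ => 2 * Complex.I * z) (2 * Complex.I) z := by
      simpa using (hasDerivAt_id z).const_mul (2 * Complex.I)
    exact (J.differentiable_det z).hasDerivAt.div h1 (hden z hz)
  obtain ⟨A, hA⟩ := hosc.exists_ne_zero hL hM0
  have hA' : ∀ z : ℂ, A < z.im → J.det z ≠ 0 := fun z hz h0 => hA z hz (by simp [hD, h0])
  have hres := fun z => J.isResonance_iff hpot hr (fun x hx => hg.eq_zero hx) hA' z
  have hiff : ∀ z : ℂ, z ≠ 0 →
      (D z = 0 ↔ ResonanceSequence.IsResonance (ResonanceSequence.jumpPotential a b g W) z) :=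
    fun z hz => by
      rw [(hres z).1, hD, div_eq_zero_iff, or_iff_left (hden z hz)]
  obtain ⟨R, Npos, Nneg, lam, hR, hbij, hsimple, h1, h2⟩ := hosc.exists_zeros hC0
    (fun z hz => (hDd z hz).differentiableAt) hL (by push_cast; exact hM)
  have hne : ∀ z : ℂ, R < ‖z‖ → z ≠ 0 := fun z hz => norm_pos_iff.1 (hR.trans hz)
  simp only [ResonanceSequence.approxZero_eq_leadingTerm] at h1 h2
  refine ⟨R, Npos, Nneg, lam, hR, ?_, fun z z1 z2 z3 => ?_, h1, h2⟩
  · convert hbij using 1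
    ext z
    exact ⟨fun h => ⟨(hiff z (hne z h.2.2)).2 h.1, h.2⟩,
      fun h => ⟨(hiff z (hne z h.2.2)).1 h.1, h.2⟩⟩
  · have hz := hne z z3
    have h3 := (hres z).1.1 z1
    have h4 := hsimple z ((hiff z hz).2 z1) z2 z3
    refine (hres z).2 h3 fun h5 => h4 ?_
    rw [(hDd z hz).deriv, h3, h5]
    simp
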